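/- Identify $\mathbb{R}^2$ with $\mathbb{C}$. For $1<q<\infty$ let $\dot W^{1,q}(\mathbb{R}^2;\mathbb{R}^2)$ be the space of $u=(u_1,u_2)\in L^1_{\mathrm{loc}}$ whose weak derivatives $\partial_j u_i$ all lie in $L^q(\mathbb{R}^2)$, with $\|u\|_{\dot W^{1,q}}=\|\,|\nabla u|\,\|_{L^q}$, $|\nabla u|=(\sum_{i,j}|\partial_j u_i|^2)^{1/2}$, and let $Ju=\det(\partial_j u_i)_{i,j=1}^2$. For $\varepsilon>0$ put $$S_\varepsilon v(z)=-\frac1\pi\int_{|z-y|>\varepsilon}\frac{v(y)}{(z-y)^2}\,dy,\qquad Sv(z)=\lim_{\varepsilon\to0}S_\varepsilon v(z),$$ (the Beurling transform), and let $[b,S]v=b\,Sv-S(bv)$. Let $p\in[1,\infty)$, let $p'$ and $(2p)'$ be the conjugate exponents of $p$ and $2p$ ($p'=\infty$ if $p=1$). Then there is a constant $K$ depending only on $p$ such that the following holds. (a) Let $b\in L^{p'}(\mathbb{C};\mathbb{C})$. Then $b\,J(u)$ is integrable for every $u\in\dot W^{1,2p}(\mathbb{R}^2;\mathbb{R}^2)$;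 for every $v\in L^{2p}(\mathbb{C})$ the limits defining $Sv$ and $S(bv)$ exist almost everywhere and $[b,S]v\in L^{(2p)'}(\mathbb{C})$; and the quantities $$\sup\Big\{\Big|\int bJ(u)\Big|:u\in\dot W^{1,2p}(\mathbb{R}^2;\mathbb{R}^2),\ \|u\|_{\dot W^{1,2p}}\le1\Big\}\quad\text{and}\quad\|[b,S]\|_{L^{2p}(\mathbb{C})\to L^{(2p)'}(\mathbb{C})}$$ are each at most $K$ times the other. (b) Let $b\in L^1_{\mathrm{loc}}(\mathbb{C};\mathbb{C})$ be arbitrary. Then, as elements of $[0,\infty]$, the quantities $$\sup\Big\{\Big|\int bJ(u)\Big|:u\in C_c^\infty(\mathbb{R}^2;\mathbb{R}^2),\ \|u\|_{\dot W^{1,2p}}\le1\Big\}\quad\text{and}\quad\sup\Big\{\|[b,S]v\|_{L^{(2p)'}}:v\in C_c^\infty(\mathbb{C};\mathbb{C}),\ \|v\|_{L^{2p}}\le1\Big\}$$ are each at most $K$ times the other. Here $[b,S]v=\lim_{\varepsilon\to0}(b\,S_\varepsilon v-S_\varepsilon(bv))$ is a limit in the sense of distributions, and its $L^{(2p)'}$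 norm is $\infty$ if it is not a function in $L^{(2p)'}$. -/

import Mathlib

open MeasureTheory Filter Topology
open scoped ENNReal NNReal ContDiff

namespace JacobianCommutator

noncomputable section

/-! The plane `ℝ²` is identified with `ℂ` (coordinates `z = x₁ + i x₂`); `volume` on `ℂ` is the
two-dimensional Lebesgue measure. A vector field `u = (u₁, u₂)` on the plane is given by its
two real components, `u : Fin 2 → ℂ → ℝ`. -/

/-- The standard basis of `ℝ² = ℂ`. -/
def dir : Fin 2 → ℂ := ![1, Complex.I]

/-- `φ` is a test function, i.e. a smooth function with compact support. -/
def IsTest {F : Type*} [NormedAddCommGroup F] [NormedSpace ℝ F] (φ : ℂ → F) : Prop :=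
  ContDiff ℝ ∞ φ ∧ HasCompactSupport φ

/-- `g` is a weak partial derivative of `f` in the `j`-th coordinate direction. -/
def HasWeakPartial (j : Fin 2) (f g : ℂ → ℝ) : Prop :=
  LocallyIntegrable f ∧ LocallyIntegrable g ∧
    ∀ φ : ℂ → ℝ, IsTest φ → ∫ z, f z * fderiv ℝ φ z (dir j) = -∫ z, g z * φ z

open Classical in
/-- The weak partial derivative `∂ⱼ f` (well defined up to null sets; zero if there is none). -/
def weakPartial (j : Fin 2) (f : ℂ → ℝ) : ℂ → ℝ :=
  if h : ∃ g, HasWeakPartial j f g then h.choose else 0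

/-- The homogeneous Sobolev space of all locally integrable `u : ℝ² → ℝ²` whose weak partial
derivatives `∂ⱼ uᵢ` exist and belong to `L^q`. -/
def homSobolev (q : ℝ≥0∞) : Set (Fin 2 → ℂ → ℝ) :=
  {u | ∀ i j, (∃ g, HasWeakPartial j (u i) g) ∧ MemLp (weakPartial j (u i)) q}

/-- The norm of the homogeneous Sobolev space: the `L^q` norm of the pointwise Euclidean norm
`|∇u| = (∑ |∂ⱼ uᵢ|²)^{1/2}`. -/
def homSobolevNorm (q : ℝ≥0∞) (u : Fin 2 → ℂ → ℝ) : ℝ≥0∞ :=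
  eLpNorm (fun z => √(∑ i, ∑ j, weakPartial j (u i) z ^ 2)) q

/-- The Jacobian determinant `J u = det (∂ⱼ uᵢ)`. -/
def jacobian (u : Fin 2 → ℂ → ℝ) (z : ℂ) : ℝ :=
  (Matrix.of fun i j => weakPartial j (u i) z).det

/-- The vector fields both of whose components are test functions. -/
def testFields : Set (Fin 2 → ℂ → ℝ) := {u | ∀ i, IsTest (u i)}

/-- `sup |∫ b J(u)|` over those `u ∈ D` that lie in the closed unit ball of the homogeneous
Sobolev space with exponent `q`. -/
def jacobianSup (q : ℝ≥0∞) (D : Set (Fin 2 → ℂ → ℝ)) (b : ℂ → ℂ) : ℝ≥0∞ :=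
  ⨆ u ∈ D ∩ {u | u ∈ homSobolev q ∧ homSobolevNorm q u ≤ 1},
    ‖∫ z, b z * (jacobian u z : ℂ)‖ₑ

/-- The truncated Beurling transform
`S_ε v (z) = -π⁻¹ ∫_{|z - y| > ε} v(y) / (z - y)² dy`. -/
def truncBeurling (ε : ℝ) (v : ℂ → ℂ) (z : ℂ) : ℂ :=
  -(1 / (Real.pi : ℂ)) * ∫ y in {y : ℂ | ε < ‖z - y‖}, v y / (z - y) ^ 2

/-- The principal value integral defining `S v (z)` converges. -/
def BeurlingExistsAt (v : ℂ → ℂ) (z : ℂ) : Prop :=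
  ∃ l : ℂ, Tendsto (fun ε : ℝ => truncBeurling ε v z) (𝓝[>] 0) (𝓝 l)

/-- The Beurling transform `S v (z) = -π⁻¹ p.v. ∫ v(y) / (z - y)² dy`. -/
def beurling (v : ℂ → ℂ) (z : ℂ) : ℂ :=
  limUnder (𝓝[>] (0 : ℝ)) (fun ε : ℝ => truncBeurling ε v z)

/-- The commutator `[b, S] v = b S v - S (b v)`, pointwise. -/
def commutator (b v : ℂ → ℂ) (z : ℂ) : ℂ :=
  b z * beurling v z - beurling (fun y => b y * v y) z

/-- The operator norm of `[b, S] : L^q → L^r`, the operator acting on all of `L^q`. -/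
def commutatorNorm (q r : ℝ≥0∞) (b : ℂ → ℂ) : ℝ≥0∞ :=
  ⨆ v ∈ {v : ℂ → ℂ | MemLp v q ∧ eLpNorm v q ≤ 1}, eLpNorm (commutator b v) r

/-- `w` is the principal value commutator `[b, S] v = lim_{ε → 0} (b S_ε v - S_ε (b v))`, the
limit being taken in the sense of distributions. For locally integrable `b` and a test function
`v`, the limit distribution always exists, whether or not it is a function. -/
def IsDistribCommutator (b v w : ℂ → ℂ) : Prop :=
  ∀ φ : ℂ → ℂ, IsTest φ →
    Tendsto
      (fun ε : ℝ => ∫ z, (b z * truncBeurling ε v z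
        - truncBeurling ε (fun y => b y * v y) z) * φ z)
      (𝓝[>] 0) (𝓝 (∫ z, w z * φ z))

/-- The operator norm `L^q → L^r` of `[b, S]` as an operator densely defined on test functions:
`sup ‖[b, S] v‖_{L^r}` over test functions `v` with `‖v‖_{L^q} ≤ 1`, where the `L^r` norm of
the distribution `[b, S] v` is `∞` if it is not given by a function in `L^r`. -/
def testCommutatorNorm (q r : ℝ≥0∞) (b : ℂ → ℂ) : ℝ≥0∞ :=
  ⨆ v ∈ {v : ℂ → ℂ | IsTest v ∧ eLpNorm v q ≤ 1},
    ⨅ w ∈ {w : ℂ → ℂ | MemLp w r ∧ IsDistribCommutator b v w}, eLpNorm w r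

end

end JacobianCommutator

/-!
# Jacobians and commutators with the Beurling transform

Write `U = u₁ + i u₂`, `f = ∂̄U` and `F = ∂U`. Then `F = S f`, and the Jacobian is
`J u = |∂U|² - |∂̄U|² = F h - f S h` with `h = F̄`, because conjugation turns the relation `F = S f`
into `f̄ = S F̄`. The Beurling transform is symmetric for the bilinear pairing `∫ f g`, so
`∫ b J u = ∫ ([b, S] f) h`, and Hölder's inequality bounds the supremum over Jacobians by the
commutator norm (`jacobianSup_le_commutatorNorm`, `jacobianSup_le_testCommutatorNorm`).

For the converse the quadratic form `U ↦ ∫ b |∂U|² - b |∂̄U|²` is polarised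
(`norm_integral_polarJacobian_le`). This bounds `∫ b (∂U ∂̄V - ∂̄U ∂V)` by the Sobolev norms of `U`
and `V`, hence by those of `v = ∂̄U` and `h = ∂̄V`, since `‖∂U‖_q ≤ C ‖∂̄U‖_q`. The bounded form is
`∫ ([b, S] v) h`. If `b` is in the dual of `L^p`, density of the functions `∂̄U`, `U` a test function,
finishes the argument (`commutatorNorm_le_jacobianSup`).

If `b` is only locally integrable, `v` and `h` have to be test functions themselves, and their Cauchy
transforms `U`, `V` have no compact support. Cutting these off at radius `R` costs `O(1 / R)` when
`b` grows at most linearly (`norm_integral_commutatorDensity_le_of_growth`). The hypothesis on `b`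
is invariant under translations, so it passes to mollifications `ρ * b`. These do have linear growth:
`∂ρ` and `∂̄ρ` are polarised Jacobians of test functions, so that `∂(ρ * b)` and `∂̄(ρ * b)`
are bounded (`exists_norm_mollify_le`). Letting `ρ` shrink gives the bound for `b`
(`norm_integral_commutatorDensity_le`). Finally a functional on test functions that is bounded in
`L^q`, `q ≥ 2`, is represented by a function in the dual space
(`exists_memLp_forall_integral_mul_eq`).

The facts about `S` come from two sources. The bound in `L^r` (`exists_beurlingBound`) is
obtained for `r ≤ 2` by the method of rotations: the kernel `1 / w²` is an average of rotated
products of two conjugate Poisson kernels, and M. Riesz's theorem applies in each variable; for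
`r ≥ 2` it follows by symmetry. For the principal value, the truncated transform of `∂̄u` is exactly
the mean of `∂u` over the disc that is cut out (`truncBeurling_dzb`), so almost everywhere
convergence is Lebesgue's differentiation theorem (`IsBeurling.ae_tendsto`).
-/

namespace JacobianCommutator

open Complex

/-! ### Wirtinger calculus for test functions -/

/-- The Wirtinger derivative `∂u = (∂₁u - i ∂₂u) / 2`. -/
noncomputable def dz (u : ℂ → ℂ) (z : ℂ) : ℂ := (fderiv ℝ u z 1 - I * fderiv ℝ u z I) / 2

/-- The Wirtinger derivative `∂̄u = (∂₁u + i ∂₂u) / 2`. -/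
noncomputable def dzb (u : ℂ → ℂ) (z : ℂ) : ℂ := (fderiv ℝ u z 1 + I * fderiv ℝ u z I) / 2

section IsTest

variable {F : Type*} [NormedAddCommGroup F] [NormedSpace ℝ F] {f g : ℂ → F}

lemma IsTest.continuous (hf : IsTest f) : Continuous f := hf.1.continuous

lemma IsTest.differentiable (hf : IsTest f) : Differentiable ℝ f := hf.1.differentiable (by simp)

lemma IsTest.integrable (hf : IsTest f) : Integrable f :=
  hf.continuous.integrable_of_hasCompactSupport hf.2

lemma IsTest.memLp (hf : IsTest f) (r : ℝ≥0∞) : MemLp f r :=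
  hf.continuous.memLp_of_hasCompactSupport hf.2

lemma IsTest.add (hf : IsTest f) (hg : IsTest g) : IsTest fun z => f z + g z :=
  ⟨hf.1.add hg.1, hf.2.add hg.2⟩

lemma IsTest.neg (hf : IsTest f) : IsTest fun z => -f z :=
  ⟨hf.1.neg, hf.2.neg⟩

lemma IsTest.sub (hf : IsTest f) (hg : IsTest g) : IsTest fun z => f z - g z := by
  simpa [sub_eq_add_neg] using hf.add hg.neg

lemma IsTest.clm_comp {G : Type*} [NormedAddCommGroup G] [NormedSpace ℝ G] (hf : IsTest f)
    (L : F →L[ℝ] G) : IsTest fun z => L (f z) :=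
  ⟨L.contDiff.comp hf.1, hf.2.comp_left (g := L) (map_zero L)⟩

lemma IsTest.fderiv_apply (hf : IsTest f) (v : ℂ) : IsTest fun z => fderiv ℝ f z v :=
  ⟨(hf.1.fderiv_right (m := ∞) (by simp)).clm_apply contDiff_const, hf.2.fderiv_apply (𝕜 := ℝ) v⟩

lemma IsTest.exists_bound (hf : IsTest f) : ∃ C, 0 ≤ C ∧ ∀ z, ‖f z‖ ≤ C := by
  obtain ⟨C, hC⟩ := hf.2.exists_bound_of_continuous hf.continuous
  exact ⟨C, (norm_nonneg _).trans (hC 0), hC⟩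

lemma IsTest.exists_radius (hf : IsTest f) : ∃ R : ℝ, 0 < R ∧ ∀ z, R < ‖z‖ → f z = 0 := by
  obtain ⟨R, hR⟩ := hf.2.isCompact.isBounded.subset_closedBall 0
  refine ⟨max R 1, by positivity, fun z hz => ?_⟩
  by_contra h
  have := hR (subset_tsupport f h)
  simp only [Metric.mem_closedBall, dist_zero_right] at this
  exact absurd hz (not_lt.2 (this.trans (le_max_left _ _)))

lemma IsTest.comp_add (hf : IsTest f) (a : ℂ) : IsTest fun z => f (z + a) :=
  ⟨hf.1.comp (contDiff_id.add contDiff_const), hf.2.comp_homeomorph (Homeomorph.addRight a)⟩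

lemma IsTest.comp_sub_left (hf : IsTest f) (a : ℂ) : IsTest fun z => f (a - z) :=
  ⟨hf.1.comp (contDiff_const.sub contDiff_id), hf.2.comp_homeomorph (Homeomorph.subLeft a)⟩

end IsTest

lemma IsTest.ofReal {f : ℂ → ℝ} (hf : IsTest f) : IsTest fun z => (f z : ℂ) :=
  hf.clm_comp Complex.ofRealCLM

lemma IsTest.conj {f : ℂ → ℂ} (hf : IsTest f) : IsTest fun z => starRingEnd ℂ (f z) :=
  hf.clm_comp (Complex.conjCLE : ℂ →L[ℝ] ℂ)

lemma IsTest.const_mul {f : ℂ → ℂ} (hf : IsTest f) (c : ℂ) : IsTest fun z => c * f z :=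
  ⟨contDiff_const.mul hf.1, hf.2.mul_left⟩

lemma IsTest.mul_smooth {f g : ℂ → ℂ} (hf : IsTest f) (hg : ContDiff ℝ ∞ g) :
    IsTest fun z => f z * g z :=
  ⟨hf.1.mul hg, hf.2.mul_right⟩

lemma IsTest.smooth_mul {f g : ℂ → ℂ} (hf : IsTest f) (hg : ContDiff ℝ ∞ g) :
    IsTest fun z => g z * f z :=
  ⟨hg.mul hf.1, hf.2.mul_left⟩

lemma isTest_dz {f : ℂ → ℂ} (hf : IsTest f) : IsTest (dz f) := by
  have := ((hf.fderiv_apply 1).sub ((hf.fderiv_apply I).const_mul I)).const_mul (1 / 2)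
  convert this using 2
  simp [dz]; ring

lemma isTest_dzb {f : ℂ → ℂ} (hf : IsTest f) : IsTest (dzb f) := by
  have := ((hf.fderiv_apply 1).add ((hf.fderiv_apply I).const_mul I)).const_mul (1 / 2)
  convert this using 2
  simp [dzb]; ring

lemma contDiff_dz {f : ℂ → ℂ} (hf : ContDiff ℝ ∞ f) : ContDiff ℝ ∞ (dz f) := by
  have h := hf.fderiv_right (m := ∞) (by simp)
  exact ((h.clm_apply contDiff_const).sub
    (contDiff_const.mul (h.clm_apply contDiff_const))).div_const 2

lemma contDiff_dzb {f : ℂ → ℂ} (hf : ContDiff ℝ ∞ f) : ContDiff ℝ ∞ (dzb f) := by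
  have h := hf.fderiv_right (m := ∞) (by simp)
  exact ((h.clm_apply contDiff_const).add
    (contDiff_const.mul (h.clm_apply contDiff_const))).div_const 2

section rules

variable {f g : ℂ → ℂ} {z : ℂ}

lemma dz_add (hf : DifferentiableAt ℝ f z) (hg : DifferentiableAt ℝ g z) :
    dz (fun w => f w + g w) z = dz f z + dz g z := by
  simp only [dz, fderiv_fun_add hf hg, add_apply]; ring

lemma dzb_add (hf : DifferentiableAt ℝ f z) (hg : DifferentiableAt ℝ g z) :
    dzb (fun w => f w + g w) z = dzb f z + dzb g z := by
  simp only [dzb, fderiv_fun_add hf hg, add_apply]; ring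

lemma dz_mul (hf : DifferentiableAt ℝ f z) (hg : DifferentiableAt ℝ g z) :
    dz (fun w => f w * g w) z = dz f z * g z + f z * dz g z := by
  simp only [dz, fderiv_fun_mul hf hg, add_apply, smul_apply,
    smul_eq_mul]; ring

lemma dzb_mul (hf : DifferentiableAt ℝ f z) (hg : DifferentiableAt ℝ g z) :
    dzb (fun w => f w * g w) z = dzb f z * g z + f z * dzb g z := by
  simp only [dzb, fderiv_fun_mul hf hg, add_apply,
    smul_apply, smul_eq_mul]; ring

lemma dz_const_mul (c : ℂ) (hf : DifferentiableAt ℝ f z) :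
    dz (fun w => c * f w) z = c * dz f z := by
  simp only [dz, fderiv_const_mul hf, smul_apply, smul_eq_mul]; ring

lemma dzb_const_mul (c : ℂ) (hf : DifferentiableAt ℝ f z) :
    dzb (fun w => c * f w) z = c * dzb f z := by
  simp only [dzb, fderiv_const_mul hf, smul_apply, smul_eq_mul]; ring

lemma dz_sub (hf : DifferentiableAt ℝ f z) (hg : DifferentiableAt ℝ g z) :
    dz (fun w => f w - g w) z = dz f z - dz g z := by
  simp only [dz, fderiv_fun_sub hf hg, sub_apply]; ring

lemma dzb_sub (hf : DifferentiableAt ℝ f z) (hg : DifferentiableAt ℝ g z) :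
    dzb (fun w => f w - g w) z = dzb f z - dzb g z := by
  simp only [dzb, fderiv_fun_sub hf hg, sub_apply]; ring

lemma fderiv_conj_apply (hf : DifferentiableAt ℝ f z) (v : ℂ) :
    fderiv ℝ (fun w => starRingEnd ℂ (f w)) z v = starRingEnd ℂ (fderiv ℝ f z v) := by
  have := ((Complex.conjCLE : ℂ →L[ℝ] ℂ).hasFDerivAt.comp z hf.hasFDerivAt).fderiv
  have h2 := congrArg (fun L => L v) this
  simpa [Function.comp_def] using h2

lemma dz_conj (hf : DifferentiableAt ℝ f z) :
    dz (fun w => starRingEnd ℂ (f w)) z = starRingEnd ℂ (dzb f z) := by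
  simp only [dz, dzb, fderiv_conj_apply hf, map_div₀, map_add, map_mul, conj_I, conj_ofNat]; ring

lemma dzb_conj (hf : DifferentiableAt ℝ f z) :
    dzb (fun w => starRingEnd ℂ (f w)) z = starRingEnd ℂ (dz f z) := by
  simp only [dz, dzb, fderiv_conj_apply hf, map_div₀, map_sub, map_mul, conj_I, conj_ofNat]; ring

lemma fderiv_comp_sub_left_apply (a : ℂ) (hf : DifferentiableAt ℝ f (a - z)) (v : ℂ) :
    fderiv ℝ (fun w => f (a - w)) z v = -fderiv ℝ f (a - z) v := by
  have h : HasFDerivAt (fun w : ℂ => a - w) (-ContinuousLinearMap.id ℝ ℂ) z :=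
    (hasFDerivAt_id z).const_sub a
  have h2 : HasFDerivAt (fun w => f (a - w)) _ z := HasFDerivAt.comp z hf.hasFDerivAt h
  rw [h2.fderiv]; simp

lemma dz_comp_sub_left (a : ℂ) (hf : DifferentiableAt ℝ f (a - z)) :
    dz (fun w => f (a - w)) z = -dz f (a - z) := by
  simp only [dz, fderiv_comp_sub_left_apply a hf]; ring

lemma dzb_comp_sub_left (a : ℂ) (hf : DifferentiableAt ℝ f (a - z)) :
    dzb (fun w => f (a - w)) z = -dzb f (a - z) := by
  simp only [dzb, fderiv_comp_sub_left_apply a hf]; ring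

lemma dz_comp_add (a : ℂ) : dz (fun w => f (w + a)) z = dz f (z + a) := by
  simp only [dz, fderiv_comp_add_right (f := f) a]

lemma dzb_comp_add (a : ℂ) : dzb (fun w => f (w + a)) z = dzb f (z + a) := by
  simp only [dzb, fderiv_comp_add_right (f := f) a]

lemma dz_eq_of_eventuallyEq (h : f =ᶠ[𝓝 z] g) : dz f z = dz g z := by
  simp only [dz, h.fderiv_eq]

lemma dzb_eq_of_eventuallyEq (h : f =ᶠ[𝓝 z] g) : dzb f z = dzb g z := by
  simp only [dzb, h.fderiv_eq]

lemma norm_dzb_le : ‖dzb f z‖ ≤ ‖fderiv ℝ f z‖ := by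
  have h1 := (fderiv ℝ f z).le_opNorm 1
  have h2 := (fderiv ℝ f z).le_opNorm I
  simp only [norm_one, mul_one, norm_I] at h1 h2
  rw [dzb, norm_div, Complex.norm_ofNat]
  have := norm_add_le (fderiv ℝ f z 1) (I * fderiv ℝ f z I)
  rw [norm_mul, norm_I, one_mul] at this
  linarith

lemma fderiv_one_eq : fderiv ℝ f z 1 = dz f z + dzb f z := by simp [dz, dzb]; ring

lemma fderiv_I_eq : fderiv ℝ f z I = I * (dz f z - dzb f z) := by
  have : I * I = -1 := I_mul_I
  simp only [dz, dzb]; linear_combination (fderiv ℝ f z I) * this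

end rules

lemma fderiv_fderiv_apply {f : ℂ → ℂ} (hf : ContDiff ℝ ∞ f) (z v w : ℂ) :
    fderiv ℝ (fun x => fderiv ℝ f x v) z w = fderiv ℝ (fderiv ℝ f) z w v := by
  have h : DifferentiableAt ℝ (fderiv ℝ f) z :=
    ((hf.fderiv_right (m := 1) (by norm_cast)).differentiable (by simp)) z
  rw [fderiv_clm_apply h (by fun_prop)]
  simp

lemma dz_dzb_comm {f : ℂ → ℂ} (hf : ContDiff ℝ ∞ f) (z : ℂ) : dz (dzb f) z = dzb (dz f) z := by
  have hs : fderiv ℝ (fderiv ℝ f) z 1 I = fderiv ℝ (fderiv ℝ f) z I 1 :=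
    (hf.contDiffAt.isSymmSndFDerivAt (by simp; norm_cast)) 1 I
  have h (v : ℂ) : Differentiable ℝ fun x => fderiv ℝ f x v :=
    ((hf.fderiv_right (m := 1) (by norm_cast)).clm_apply contDiff_const).differentiable (by simp)
  have e1 (v : ℂ) : fderiv ℝ (dzb f) z v =
      (fderiv ℝ (fderiv ℝ f) z v 1 + I * fderiv ℝ (fderiv ℝ f) z v I) / 2 := by
    have : dzb f = fun x => (1 / 2 : ℂ) * (fderiv ℝ f x 1 + I * fderiv ℝ f x I) := by
      ext x; simp [dzb]; ring
    have h3 : HasFDerivAt (fun x => (1 / 2 : ℂ) * (fderiv ℝ f x 1 + I * fderiv ℝ f x I)) _ z :=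
      ((h 1 z).hasFDerivAt.add ((h I z).hasFDerivAt.const_mul I)).const_mul (1 / 2 : ℂ)
    rw [this, HasFDerivAt.fderiv h3]
    simp [fderiv_fderiv_apply hf]; ring
  have e2 (v : ℂ) : fderiv ℝ (dz f) z v =
      (fderiv ℝ (fderiv ℝ f) z v 1 - I * fderiv ℝ (fderiv ℝ f) z v I) / 2 := by
    have : dz f = fun x => (1 / 2 : ℂ) * (fderiv ℝ f x 1 - I * fderiv ℝ f x I) := by
      ext x; simp [dz]; ring
    have h3 : HasFDerivAt (fun x => (1 / 2 : ℂ) * (fderiv ℝ f x 1 - I * fderiv ℝ f x I)) _ z :=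
      ((h 1 z).hasFDerivAt.sub ((h I z).hasFDerivAt.const_mul I)).const_mul (1 / 2 : ℂ)
    rw [this, HasFDerivAt.fderiv h3]
    simp [fderiv_fderiv_apply hf]; ring
  rw [dz, dzb, e1, e1, e2, e2, hs]
  ring

/-- Integration by parts against a test function. -/
lemma integral_mul_fderiv_test {f g : ℂ → ℂ} (hf : ContDiff ℝ ∞ f) (hg : IsTest g) (v : ℂ) :
    ∫ z, f z * fderiv ℝ g z v = -∫ z, fderiv ℝ f z v * g z := by
  refine integral_mul_fderiv_eq_neg_fderiv_mul_of_integrable ?_ ?_ ?_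
    (fun x _ => hf.differentiable (by simp) x) (fun x _ => hg.differentiable x)
  · have := (hf.fderiv_right (m := ∞) (by simp)).clm_apply (contDiff_const (c := v))
    exact (hg.smooth_mul this).integrable
  · exact ((hg.fderiv_apply v).smooth_mul hf).integrable
  · exact (hg.smooth_mul hf).integrable

lemma integral_mul_dz {f g : ℂ → ℂ} (hf : ContDiff ℝ ∞ f) (hg : IsTest g) :
    ∫ z, f z * dz g z = -∫ z, dz f z * g z := by
  have hf' (v : ℂ) := (hf.fderiv_right (m := ∞) (by simp)).clm_apply (contDiff_const (c := v))
  have h1 := integral_mul_fderiv_test hf hg 1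
  have h2 := integral_mul_fderiv_test hf hg I
  have e1 : ∫ z, f z * dz g z
      = ((∫ z, f z * fderiv ℝ g z 1) - I * ∫ z, f z * fderiv ℝ g z I) / 2 := by
    rw [← integral_const_mul, ← integral_sub ((hg.fderiv_apply 1).smooth_mul hf).integrable
      (((hg.fderiv_apply I).smooth_mul hf).integrable.const_mul I), ← integral_div]
    congr 1; ext z; simp only [dz]; ring
  have e2 : ∫ z, dz f z * g z
      = ((∫ z, fderiv ℝ f z 1 * g z) - I * ∫ z, fderiv ℝ f z I * g z) / 2 := by
    rw [← integral_const_mul, ← integral_sub (hg.smooth_mul (hf' 1)).integrable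
      ((hg.smooth_mul (hf' I)).integrable.const_mul I), ← integral_div]
    congr 1; ext z; simp only [dz]; ring
  rw [e1, e2, h1, h2]; ring

lemma integral_mul_dzb {f g : ℂ → ℂ} (hf : ContDiff ℝ ∞ f) (hg : IsTest g) :
    ∫ z, f z * dzb g z = -∫ z, dzb f z * g z := by
  have hf' (v : ℂ) := (hf.fderiv_right (m := ∞) (by simp)).clm_apply (contDiff_const (c := v))
  have h1 := integral_mul_fderiv_test hf hg 1
  have h2 := integral_mul_fderiv_test hf hg I
  have e1 : ∫ z, f z * dzb g z
      = ((∫ z, f z * fderiv ℝ g z 1) + I * ∫ z, f z * fderiv ℝ g z I) / 2 := by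
    rw [← integral_const_mul, ← integral_add ((hg.fderiv_apply 1).smooth_mul hf).integrable
      (((hg.fderiv_apply I).smooth_mul hf).integrable.const_mul I), ← integral_div]
    congr 1; ext z; simp only [dzb]; ring
  have e2 : ∫ z, dzb f z * g z
      = ((∫ z, fderiv ℝ f z 1 * g z) + I * ∫ z, fderiv ℝ f z I * g z) / 2 := by
    rw [← integral_const_mul, ← integral_add (hg.smooth_mul (hf' 1)).integrable
      ((hg.smooth_mul (hf' I)).integrable.const_mul I), ← integral_div]
    congr 1; ext z; simp only [dzb]; ring
  rw [e1, e2, h1, h2]; ring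

/-- For test functions `∫ ∂u ∂̄v = ∫ ∂̄u ∂v`: this is the symmetry of the Beurling transform. -/
lemma integral_dz_mul_dzb {u v : ℂ → ℂ} (hu : IsTest u) (hv : IsTest v) :
    ∫ z, dz u z * dzb v z = ∫ z, dzb u z * dz v z := by
  rw [integral_mul_dzb (contDiff_dz hu.1) hv, integral_mul_dz (contDiff_dzb hu.1) hv]
  congr 2; ext z; rw [dz_dzb_comm hu.1]

/-! ### M. Riesz's theorem on the line -/

/-- Jensen's inequality for powers of lower integrals. -/
lemma lintegral_rpow_le {α : Type*} [MeasurableSpace α] (μ : Measure α) {r : ℝ} (hr : 1 < r)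
    {f : α → ℝ≥0∞} (hf : AEMeasurable f μ) :
    (∫⁻ a, f a ∂μ) ^ r ≤ μ Set.univ ^ (r - 1) * ∫⁻ a, f a ^ r ∂μ := by
  have hpq := Real.HolderConjugate.conjExponent hr
  have hr0 : 0 < r := by linarith
  have h := ENNReal.lintegral_mul_le_Lp_mul_Lq μ hpq hf (aemeasurable_const (b := (1 : ℝ≥0∞)))
  simp only [Pi.mul_apply, mul_one, ENNReal.one_rpow, lintegral_const, one_mul] at h
  calc (∫⁻ a, f a ∂μ) ^ r
      ≤ ((∫⁻ a, f a ^ r ∂μ) ^ (1 / r) * μ Set.univ ^ (1 / r.conjExponent)) ^ r := by gcongr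
    _ = μ Set.univ ^ (r - 1) * ∫⁻ a, f a ^ r ∂μ := by
      rw [ENNReal.mul_rpow_of_nonneg _ _ hr0.le, ← ENNReal.rpow_mul, ← ENNReal.rpow_mul, mul_comm]
      congr 2
      · rw [Real.conjExponent]; field_simp
      · rw [one_div_mul_cancel hr0.ne', ENNReal.rpow_one]

/-- The pointwise inequality behind M. Riesz's theorem: on the right half plane `|ζ|^r` is
controlled by `(Re ζ)^r`, up to a multiple of the harmonic function `Re ζ^r`. It holds since
`cos (rπ/2) < 0`. -/
lemma exists_norm_rpow_le {r : ℝ} (hr : 1 < r) (hr2 : r ≤ 2) :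
    ∃ A B : ℝ, 0 ≤ A ∧ 0 ≤ B ∧ ∀ ζ : ℂ, 0 < ζ.re →
      ‖ζ‖ ^ r ≤ A * ζ.re ^ r - B * (ζ ^ (r : ℂ)).re := by
  have hpi := Real.pi_pos
  have hr0 : 0 < r := by linarith
  -- any angle strictly between `π / (2r)` and `π / 2` separates the two regimes
  set φ := (Real.pi / (2 * r) + Real.pi / 2) / 2 with hφ
  have hlt : Real.pi / (2 * r) < Real.pi / 2 := by
    apply div_lt_div_of_pos_left hpi <;> linarith
  have h0 : 0 < Real.pi / (2 * r) := by positivity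
  have hφ1 : Real.pi / (2 * r) < φ := by linarith
  have hφ2 : φ < Real.pi / 2 := by linarith
  have hcosφ : 0 < Real.cos φ := Real.cos_pos_of_mem_Ioo ⟨by linarith, hφ2⟩
  have hrφ : Real.pi / 2 < r * φ := by
    have := mul_lt_mul_of_pos_left hφ1 hr0
    have e : r * (Real.pi / (2 * r)) = Real.pi / 2 := by field_simp
    linarith
  have hrφ2 : r * φ < Real.pi := by nlinarith
  have hneg : Real.cos (r * φ) < 0 := Real.cos_neg_of_pi_div_two_lt_of_lt hrφ (by linarith)
  -- with this `B` the term `-B cos (rθ)` is at least `1` for angles `θ ≥ φ`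
  set B := -(Real.cos (r * φ))⁻¹ with hB
  have hB0 : 0 < B := by rw [hB, neg_pos]; exact inv_lt_zero.2 hneg
  have hcr : 0 < Real.cos φ ^ r := Real.rpow_pos_of_pos hcosφ r
  refine ⟨(1 + B) / Real.cos φ ^ r, B, by positivity, hB0.le, fun ζ hζ => ?_⟩
  have hζ0 : ζ ≠ 0 := by rintro rfl; simp at hζ
  have hn : 0 < ‖ζ‖ := norm_pos_iff.2 hζ0
  have hre : ζ.re = ‖ζ‖ * Real.cos (arg ζ) := by rw [Complex.cos_arg hζ0]; field_simp
  have hpow : (ζ ^ (r : ℂ)).re = ‖ζ‖ ^ r * Real.cos (r * arg ζ) := by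
    rw [cpow_def_of_ne_zero hζ0, exp_re, Real.rpow_def_of_pos hn]
    simp [log_re, log_im, mul_comm]
  have harg : |arg ζ| < Real.pi / 2 := abs_arg_lt_pi_div_two_iff.2 (Or.inl hζ)
  have hcos : 0 < Real.cos (arg ζ) := by
    apply Real.cos_pos_of_mem_Ioo; rw [abs_lt] at harg; exact harg
  rw [hpow, hre, Real.mul_rpow hn.le hcos.le]
  suffices h : 1 ≤ (1 + B) / Real.cos φ ^ r * Real.cos (arg ζ) ^ r - B * Real.cos (r * arg ζ) by
    have := mul_le_mul_of_nonneg_left h (Real.rpow_pos_of_pos hn r).le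
    linarith
  rw [← Real.cos_abs (arg ζ), ← Real.cos_abs (r * arg ζ), abs_mul, abs_of_pos hr0]
  rw [← Real.cos_abs (arg ζ)] at hcos
  set θ := |arg ζ|
  have hθ0 : 0 ≤ θ := abs_nonneg _
  rcases le_total φ θ with h | h
  · have h1 : Real.cos (r * θ) ≤ Real.cos (r * φ) := by
      apply Real.cos_le_cos_of_nonneg_of_le_pi <;> nlinarith
    have h2 : 1 ≤ -(B * Real.cos (r * θ)) := by
      have : B * Real.cos (r * θ) ≤ B * Real.cos (r * φ) := by gcongr
      have e : B * Real.cos (r * φ) = -1 := by rw [hB, neg_mul, inv_mul_cancel₀ hneg.ne]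
      linarith
    have h3 : 0 ≤ (1 + B) / Real.cos φ ^ r * Real.cos θ ^ r := by positivity
    linarith
  · have h1 : Real.cos φ ≤ Real.cos θ := Real.cos_le_cos_of_nonneg_of_le_pi hθ0 (by linarith) h
    have h2 : 1 + B ≤ (1 + B) / Real.cos φ ^ r * Real.cos θ ^ r := by
      rw [div_mul_eq_mul_div, le_div_iff₀ hcr]; gcongr
    have h3 : B * Real.cos (r * θ) ≤ B * 1 := by gcongr; exact Real.cos_le_one _
    linarith

/-- The Cauchy integral of a density on the real line, normalised so that for `Im z > 0` its real
part is the Poisson integral of `f` and its imaginary part the conjugate Poisson integral. -/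
noncomputable def cauchyLine (f : ℝ → ℝ) (z : ℂ) : ℂ :=
  I / (Real.pi : ℂ) * ∫ t, (f t : ℂ) / (z - t)

section cauchyLine

variable {f : ℝ → ℝ} (hf : Continuous f) (hc : HasCompactSupport f)
include hf hc

lemma cauchyLine_integrable {z : ℂ} (hz : 0 < z.im) :
    Integrable fun t : ℝ => (f t : ℂ) / (z - t) := by
  refine Continuous.integrable_of_hasCompactSupport ?_ ?_
  · refine Continuous.div (by fun_prop) (by fun_prop) fun t h => ?_
    have := congrArg Complex.im h
    simp at this; linarith
  · exact (hc.comp_left (g := fun x : ℝ => (x : ℂ)) (by simp)).mul_right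

lemma differentiableAt_cauchyLine {z : ℂ} (hz : 0 < z.im) :
    DifferentiableAt ℂ (cauchyLine f) z := by
  refine DifferentiableAt.const_mul ?_ _
  have him (w : ℂ) (t : ℝ) : w.im ≤ ‖w - t‖ := by
    have := abs_im_le_norm (w - t); simp at this; exact (le_abs_self _).trans this
  have hne (w : ℂ) (hw : 0 < w.im) (t : ℝ) : w - t ≠ 0 :=
    norm_pos_iff.1 (hw.trans_le (him w t))
  have hs : {w : ℂ | z.im / 2 < w.im} ∈ 𝓝 z :=
    (isOpen_lt continuous_const continuous_im).mem_nhds (by simp; linarith)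
  refine (hasDerivAt_integral_of_dominated_loc_of_deriv_le (𝕜 := ℂ)
    (F := fun w t => (f t : ℂ) / (w - t)) (F' := fun w t => -(f t : ℂ) / (w - t) ^ 2)
    (bound := fun t => |f t| / (z.im / 2) ^ 2)
    hs ?_ (cauchyLine_integrable hf hc hz) ?_ ?_ ?_ ?_).2.differentiableAt
  · filter_upwards [hs] with w hw
    exact (cauchyLine_integrable hf hc (by have : z.im / 2 < w.im := hw; linarith)).1
  · refine Continuous.aestronglyMeasurable (Continuous.div (by fun_prop) (by fun_prop) ?_)
    exact fun t => pow_ne_zero 2 (hne z hz t)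
  · refine Eventually.of_forall fun t w (hw : z.im / 2 < w.im) => ?_
    rw [norm_div, norm_neg, norm_pow, norm_real, Real.norm_eq_abs]
    gcongr
    exact hw.le.trans (him w t)
  · exact ((hf.abs.integrable_of_hasCompactSupport hc.abs).div_const _)
  · refine Eventually.of_forall fun t w (hw : z.im / 2 < w.im) => ?_
    have h1 := hne w (by linarith) t
    have h2 : HasDerivAt (fun w : ℂ => w - t) 1 w := (hasDerivAt_id w).sub_const _
    simpa using (hasDerivAt_const w (f t : ℂ)).fun_div h2 h1

lemma norm_cauchyLine_le {A : ℝ} (hA : ∀ t, A < |t| → f t = 0) :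
    ∃ B : ℝ, 0 ≤ B ∧ ∀ z : ℂ, A < ‖z‖ → ‖cauchyLine f z‖ ≤ B / (‖z‖ - A) := by
  refine ⟨1 / Real.pi * ∫ t, |f t|, by positivity, fun z hz => ?_⟩
  rw [cauchyLine, norm_mul, norm_div, norm_I, norm_real, Real.norm_eq_abs,
    abs_of_pos Real.pi_pos, mul_div_assoc]
  gcongr
  rw [div_eq_inv_mul, ← integral_const_mul]
  refine norm_integral_le_of_norm_le
    ((hf.abs.integrable_of_hasCompactSupport hc.abs).const_mul _) (Eventually.of_forall fun t => ?_)
  by_cases ht : f t = 0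
  · simp [ht]
  have ht' : |t| ≤ A := by by_contra h; exact ht (hA t (not_le.1 h))
  rw [norm_div, norm_real, Real.norm_eq_abs, div_eq_inv_mul]
  have : 0 < ‖z‖ - A := by linarith
  gcongr
  have := norm_sub_norm_le z (t : ℂ)
  rw [norm_real, Real.norm_eq_abs] at this
  linarith

lemma cauchyLine_re {y : ℝ} (hy : 0 < y) (x : ℝ) :
    (cauchyLine f (x + y * I)).re = 1 / Real.pi * ∫ t, y / ((x - t) ^ 2 + y ^ 2) * f t := by
  have hint := cauchyLine_integrable hf hc (z := x + y * I) (by simp [hy])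
  have e : (cauchyLine f (x + y * I)).re
      = -(1 / Real.pi) * (∫ t, (f t : ℂ) / (x + y * I - t)).im := by
    rw [cauchyLine, div_mul_eq_mul_div, div_ofReal_re]; simp; ring
  rw [e, neg_mul, ← mul_neg]
  congr 1
  have := imCLM.integral_comp_comm hint
  simp only [imCLM_apply] at this
  rw [← this, ← integral_neg]
  congr 1; ext t
  rw [div_im]; simp [normSq_apply]; ring

lemma cauchyLine_im {y : ℝ} (hy : 0 < y) (x : ℝ) :
    (cauchyLine f (x + y * I)).im = 1 / Real.pi * ∫ t, (x - t) / ((x - t) ^ 2 + y ^ 2) * f t := by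
  have hint := cauchyLine_integrable hf hc (z := x + y * I) (by simp [hy])
  have e : (cauchyLine f (x + y * I)).im
      = (1 / Real.pi) * (∫ t, (f t : ℂ) / (x + y * I - t)).re := by
    rw [cauchyLine, div_mul_eq_mul_div, div_ofReal_im]; simp; ring
  rw [e]
  congr 1
  have := reCLM.integral_comp_comm hint
  simp only [reCLM_apply] at this
  rw [← this]
  congr 1; ext t
  rw [div_re]; simp [normSq_apply]; ring

lemma cauchyLine_re_pos (h0 : ∀ t, 0 ≤ f t) {t₀ : ℝ} (ht₀ : f t₀ ≠ 0) {z : ℂ} (hz : 0 < z.im) :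
    0 < (cauchyLine f z).re := by
  rw [← re_add_im z, cauchyLine_re hf hc hz]
  have hden (t : ℝ) : 0 < (z.re - t) ^ 2 + z.im ^ 2 := by positivity
  refine mul_pos (by have := Real.pi_pos; positivity) ?_
  refine Continuous.integral_pos_of_hasCompactSupport_nonneg_nonzero (x := t₀) ?_ ?_ ?_ ?_
  · exact (continuous_const.div (by fun_prop) fun t => (hden t).ne').mul hf
  · exact hc.mul_left
  · intro t; have := hden t; have := h0 t; simp only [Pi.zero_apply]; positivity
  · have := hden t₀; positivity

/-- Cauchy's theorem on growing squares: the integral of `F ^ r` over horizontal lines vanishes. -/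
lemma tendsto_integral_cauchyLine_cpow (h0 : ∀ t, 0 ≤ f t) {t₀ : ℝ} (ht₀ : f t₀ ≠ 0) {r y : ℝ}
    (hr : 1 < r) (hy : 0 < y) :
    Tendsto (fun R : ℝ => ∫ x in (-R)..R, cauchyLine f (x + y * I) ^ (r : ℂ)) atTop (𝓝 0) := by
  obtain ⟨A, hA⟩ := hc.isCompact.isBounded.subset_closedBall 0
  have hA' : ∀ t, max A 0 < |t| → f t = 0 := fun t ht => by
    by_contra h
    have := hA (subset_tsupport f h)
    simp at this
    exact absurd ht (not_lt.2 (this.trans (le_max_left _ _)))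
  set A' := max A 0
  have hA0 : 0 ≤ A' := le_max_right _ _
  obtain ⟨B, hB0, hB⟩ := norm_cauchyLine_le hf hc hA'
  set G : ℂ → ℂ := fun z => cauchyLine f z ^ (r : ℂ) with hG
  have hr0 : 0 < r := by linarith
  have hGb (R : ℝ) (hR : A' < R) (z : ℂ) (hz : R ≤ ‖z‖) : ‖G z‖ ≤ (B / (R - A')) ^ r := by
    rw [hG]; simp only; rw [norm_cpow_real]
    have h1 := hB z (by linarith)
    have h2 : B / (‖z‖ - A') ≤ B / (R - A') := by
      apply div_le_div_of_nonneg_left hB0 <;> linarith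
    exact Real.rpow_le_rpow (norm_nonneg _) (h1.trans h2) hr0.le
  have hGd : DifferentiableOn ℂ G {z | 0 < z.im} := fun z hz =>
    ((differentiableAt_cauchyLine hf hc hz).cpow_const
      (Or.inl (cauchyLine_re_pos hf hc h0 ht₀ hz))).differentiableWithinAt
  have key (R : ℝ) (hR : A' < R) :
      ‖∫ x in (-R)..R, G (x + y * I)‖ ≤ 4 * (R * (B / (R - A')) ^ r) := by
    have hR0 : 0 < R := by linarith
    have H := integral_boundary_rect_eq_zero_of_differentiableOn G (-R + y * I)
      (R + (y + R : ℝ) * I) (hGd.mono ?_)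
    · simp only [add_re, neg_re, ofReal_re, mul_re, I_re, mul_zero, ofReal_im, I_im, mul_one,
        sub_self, add_zero, add_im, neg_im, neg_zero, mul_im, zero_add] at H
      have e : (∫ x in (-R)..R, G (x + y * I)) = (∫ x in (-R)..R, G (x + (y + R : ℝ) * I))
          - I • (∫ t in y..(y + R), G (R + t * I)) + I • ∫ t in y..(y + R), G ((-R : ℝ) + t * I) := by
        linear_combination H
      rw [e]
      have b1 : ‖∫ x in (-R)..R, G (x + (y + R : ℝ) * I)‖ ≤ (B / (R - A')) ^ r * |R - -R| := by
        refine intervalIntegral.norm_integral_le_of_norm_le_const fun x _ => hGb R hR _ ?_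
        have := abs_im_le_norm ((x : ℂ) + (y + R : ℝ) * I)
        simp at this
        have h3 := le_abs_self (y + R)
        push_cast
        linarith
      have b2 : ‖∫ t in y..(y + R), G (R + t * I)‖ ≤ (B / (R - A')) ^ r * |y + R - y| := by
        refine intervalIntegral.norm_integral_le_of_norm_le_const fun x _ => hGb R hR _ ?_
        have := abs_re_le_norm ((R : ℂ) + x * I)
        simp at this
        exact (le_abs_self R).trans this
      have b3 : ‖∫ t in y..(y + R), G ((-R : ℝ) + t * I)‖ ≤ (B / (R - A')) ^ r * |y + R - y| := by
        refine intervalIntegral.norm_integral_le_of_norm_le_const fun x _ => hGb R hR _ ?_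
        have := abs_re_le_norm (((-R : ℝ) : ℂ) + x * I)
        simp at this
        push_cast
        exact (le_abs_self R).trans this
      have e1 : |R - -R| = 2 * R := by rw [abs_of_pos] <;> linarith
      have e2 : |y + R - y| = R := by rw [abs_of_pos] <;> linarith
      rw [e1] at b1; rw [e2] at b2 b3
      have n2 : ‖I • (∫ t in y..(y + R), G (R + t * I))‖ = ‖∫ t in y..(y + R), G (R + t * I)‖ := by
        rw [norm_smul, norm_I, one_mul]
      have n3 : ‖I • (∫ t in y..(y + R), G ((-R : ℝ) + t * I))‖
          = ‖∫ t in y..(y + R), G ((-R : ℝ) + t * I)‖ := by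
        rw [norm_smul, norm_I, one_mul]
      refine (norm_add_le _ _).trans ?_
      have := norm_sub_le (∫ x in (-R)..R, G (x + (y + R : ℝ) * I))
        (I • (∫ t in y..(y + R), G (R + t * I)))
      rw [n2] at this; rw [n3]
      linarith
    · intro z hz
      have h2 := hz.2
      simp only [add_im, neg_im, ofReal_im, neg_zero, mul_im, ofReal_re, I_im, mul_one, I_re,
        mul_zero, add_zero, zero_add, Set.mem_preimage] at h2
      rw [Set.uIcc_of_le (by linarith)] at h2
      exact hy.trans_le h2.1
  rw [tendsto_zero_iff_norm_tendsto_zero]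
  refine squeeze_zero' (g := fun R => 4 * (2 * B) ^ r * R ^ (-(r - 1)))
    (Eventually.of_forall fun R => norm_nonneg _) ?_ ?_
  · filter_upwards [eventually_ge_atTop (2 * A' + 1)] with R hR
    have hR0 : 0 < R := by linarith
    refine (key R (by linarith)).trans ?_
    have h1 : B / (R - A') ≤ 2 * B / R := by
      rw [div_le_div_iff₀ (by linarith) hR0]; nlinarith
    have h2 : (B / (R - A')) ^ r ≤ (2 * B / R) ^ r :=
      Real.rpow_le_rpow (div_nonneg hB0 (by linarith)) h1 hr0.le
    have h3 : R * (2 * B / R) ^ r = (2 * B) ^ r * R ^ (-(r - 1)) := by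
      rw [Real.div_rpow (by positivity) hR0.le, neg_sub, Real.rpow_sub hR0, Real.rpow_one]
      ring
    calc 4 * (R * (B / (R - A')) ^ r) ≤ 4 * (R * (2 * B / R) ^ r) := by gcongr
      _ = _ := by rw [h3]; ring
  · have := (tendsto_rpow_neg_atTop (show 0 < r - 1 by linarith)).const_mul (4 * (2 * B) ^ r)
    simpa using this

end cauchyLine

/-- The conjugate Poisson kernel `x / (x² + y²)` (not normalised). -/
noncomputable def conjPoisson (y x : ℝ) : ℝ := x / (x ^ 2 + y ^ 2)

lemma continuous_conjPoisson {y : ℝ} (hy : 0 < y) : Continuous (conjPoisson y) := by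
  refine Continuous.div (by fun_prop) (by fun_prop) fun x => ?_
  positivity

/-- The Poisson integral is a contraction on `L^r`: the Poisson kernel is a probability density (that
of a Cauchy distribution), so Jensen's inequality applies. -/
lemma lintegral_cauchyLine_re_le {f : ℝ → ℝ} (hf : Continuous f) (hc : HasCompactSupport f)
    (h0 : ∀ t, 0 ≤ f t) {r y : ℝ} (hr : 1 < r) (hy : 0 < y) :
    ∫⁻ x : ℝ, ENNReal.ofReal (cauchyLine f (x + y * I)).re ^ r
      ≤ ∫⁻ t, ENNReal.ofReal (f t) ^ r := by
  lift y to ℝ≥0 using hy.le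
  have hy' : y ≠ 0 := by rintro rfl; simp at hy
  have hmeas : Measurable fun t => ENNReal.ofReal (f t) := by fun_prop
  have h1 (x : ℝ) : ENNReal.ofReal (cauchyLine f (x + (y : ℝ) * I)).re
      = ∫⁻ t, ENNReal.ofReal (f t) ∂(volume.withDensity (ProbabilityTheory.cauchyPDF x y)) := by
    rw [lintegral_withDensity_eq_lintegral_mul _ (ProbabilityTheory.measurable_cauchyPDF _ _) hmeas,
      cauchyLine_re hf hc hy, ← integral_const_mul, ofReal_integral_eq_lintegral_ofReal]
    · refine lintegral_congr fun t => ?_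
      rw [Pi.mul_apply, ProbabilityTheory.cauchyPDF, ← ENNReal.ofReal_mul]
      · rw [ProbabilityTheory.cauchyPDFReal_def, ← neg_sub x t, neg_sq]; congr 1; ring
      · exact (ProbabilityTheory.cauchyPDF_pos x hy' t).le
    · refine Continuous.integrable_of_hasCompactSupport ?_ (hc.mul_left.mul_left)
      exact continuous_const.mul ((continuous_const.div (by fun_prop)
        fun t => by positivity).mul hf)
    · refine Eventually.of_forall fun t => ?_
      have := h0 t; have := Real.pi_pos
      simp only [Pi.zero_apply]; positivity
  calc ∫⁻ x : ℝ, ENNReal.ofReal (cauchyLine f (x + (y : ℝ) * I)).re ^ r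
      ≤ ∫⁻ x : ℝ, ∫⁻ t, ProbabilityTheory.cauchyPDF t y x * ENNReal.ofReal (f t) ^ r := by
        refine lintegral_mono fun x => ?_
        rw [h1]
        refine (lintegral_rpow_le _ hr hmeas.aemeasurable).trans ?_
        rw [withDensity_apply _ MeasurableSet.univ, Measure.restrict_univ,
          ProbabilityTheory.lintegral_cauchyPDF_eq_one x hy', ENNReal.one_rpow, one_mul,
          lintegral_withDensity_eq_lintegral_mul _ (ProbabilityTheory.measurable_cauchyPDF _ _)
            (hmeas.pow_const r)]
        refine le_of_eq (lintegral_congr fun t => ?_)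
        simp only [Pi.mul_apply, ProbabilityTheory.cauchyPDF, ProbabilityTheory.cauchyPDFReal_def]
        rw [← neg_sub x t, neg_sq]
    _ = ∫⁻ t, ∫⁻ x : ℝ, ProbabilityTheory.cauchyPDF t y x * ENNReal.ofReal (f t) ^ r := by
        refine lintegral_lintegral_swap (Measurable.aemeasurable ?_)
        refine Measurable.mul ?_ ((hmeas.pow_const r).comp measurable_snd)
        simp only [ProbabilityTheory.cauchyPDF,
          ProbabilityTheory.cauchyPDFReal_def]
        fun_prop
    _ = ∫⁻ t, ENNReal.ofReal (f t) ^ r := by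
        refine lintegral_congr fun t => ?_
        rw [lintegral_mul_const _ (ProbabilityTheory.measurable_cauchyPDF _ _),
          ProbabilityTheory.lintegral_cauchyPDF_eq_one t hy', one_mul]

/-- M. Riesz's theorem for nonnegative densities, uniformly in the height `y`. Positivity keeps the
Cauchy integral `F` in the right half plane, where `|F|^r ≤ A (Re F)^r - B Re F^r`; integrated over a
horizontal line, the holomorphic term drops out. -/
lemma exists_conjPoisson_nonneg_bound {r : ℝ} (hr : 1 < r) (hr2 : r ≤ 2) :
    ∃ C : ℝ≥0, ∀ (f : ℝ → ℝ), Continuous f → HasCompactSupport f → (∀ t, 0 ≤ f t) →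
      ∀ y : ℝ, 0 < y → ∫⁻ x, ‖∫ t, conjPoisson y (x - t) * f t‖ₑ ^ r
        ≤ C * ∫⁻ t, ‖f t‖ₑ ^ r := by
  obtain ⟨A, B, hA, hB, hAB⟩ := exists_norm_rpow_le hr hr2
  have hr0 : 0 < r := by linarith
  have hpi := Real.pi_pos
  refine ⟨(Real.pi ^ r * A).toNNReal, fun f hf hc h0 y hy => ?_⟩
  by_cases hz : ∀ t, f t = 0
  · simp [hz, hr0]
  push Not at hz
  obtain ⟨t₀, ht₀⟩ := hz
  have hcont : Continuous fun x : ℝ => cauchyLine f (x + y * I) := by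
    refine continuous_iff_continuousAt.2 fun x => ?_
    have := (differentiableAt_cauchyLine hf hc (z := x + y * I) (by simp [hy])).continuousAt
    exact ContinuousAt.comp (f := fun x : ℝ => (x : ℂ) + y * I) this (by fun_prop)
  have hpos (x : ℝ) : 0 < (cauchyLine f (x + y * I)).re :=
    cauchyLine_re_pos hf hc h0 ht₀ (by simp [hy])
  have e (x : ℝ) : ‖∫ t, conjPoisson y (x - t) * f t‖ₑ ^ r
      = ENNReal.ofReal (Real.pi ^ r) * ENNReal.ofReal (|(cauchyLine f (x + y * I)).im| ^ r) := by
    rw [← ENNReal.ofReal_mul (by positivity), ← Real.mul_rpow hpi.le (abs_nonneg _),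
      cauchyLine_im hf hc hy, abs_mul, abs_of_pos (by positivity), ← mul_assoc,
      mul_one_div_cancel hpi.ne', one_mul, Real.enorm_eq_ofReal_abs,
      ENNReal.ofReal_rpow_of_nonneg (abs_nonneg _) hr0.le]
    rfl
  have hcu : Continuous fun x : ℝ => (cauchyLine f (x + y * I)).re ^ r :=
    (continuous_re.comp hcont).rpow_const fun x => Or.inr hr0.le
  have hcv : Continuous fun x : ℝ => |(cauchyLine f (x + y * I)).im| ^ r :=
    (continuous_im.comp hcont).abs.rpow_const fun x => Or.inr hr0.le
  have hcG : Continuous fun x : ℝ => cauchyLine f (x + y * I) ^ (r : ℂ) :=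
    hcont.cpow continuous_const fun x => Or.inl (hpos x)
  set u := fun x : ℝ => (cauchyLine f (x + y * I)).re ^ r
  set v := fun x : ℝ => |(cauchyLine f (x + y * I)).im| ^ r
  set G := fun x : ℝ => cauchyLine f (x + y * I) ^ (r : ℂ)
  have hu0 (x : ℝ) : 0 ≤ u x := Real.rpow_nonneg (hpos x).le _
  have hv0 (x : ℝ) : 0 ≤ v x := Real.rpow_nonneg (abs_nonneg _) _
  have hfin (R : ℝ) (hR : 0 < R) : ∫⁻ x in Set.Ioc (-R) R, ENNReal.ofReal (v x)
      ≤ ENNReal.ofReal A * (∫⁻ x, ENNReal.ofReal (u x))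
        + ENNReal.ofReal (B * ‖∫ x in (-R)..R, G x‖) := by
    have i1 : IntervalIntegrable u volume (-R) R := hcu.intervalIntegrable _ _
    have i2 : IntervalIntegrable v volume (-R) R := hcv.intervalIntegrable _ _
    have i3 : IntervalIntegrable G volume (-R) R := hcG.intervalIntegrable _ _
    have hRR : -R ≤ R := by linarith
    have hle : ∫ x in (-R)..R, v x ≤ A * (∫ x in (-R)..R, u x) - B * (∫ x in (-R)..R, G x).re := by
      have hre : (∫ x in (-R)..R, G x).re = ∫ x in (-R)..R, (G x).re := by
        rw [intervalIntegral.integral_of_le hRR, intervalIntegral.integral_of_le hRR]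
        have := reCLM.integral_comp_comm i3.1
        simpa using this.symm
      have i3r : IntervalIntegrable (fun x => (G x).re) volume (-R) R :=
        (continuous_re.comp hcG).intervalIntegrable _ _
      rw [hre, ← intervalIntegral.integral_const_mul, ← intervalIntegral.integral_const_mul,
        ← intervalIntegral.integral_sub (i1.const_mul A) (i3r.const_mul B)]
      refine intervalIntegral.integral_mono_on hRR i2 ((i1.const_mul A).sub (i3r.const_mul B))
        fun x _ => ?_
      refine le_trans ?_ (hAB _ (hpos x))
      exact Real.rpow_le_rpow (abs_nonneg _) (abs_im_le_norm _) hr0.le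
    have hbound : ∫ x in (-R)..R, v x ≤ A * (∫ x in (-R)..R, u x) + B * ‖∫ x in (-R)..R, G x‖ := by
      have := (abs_le.1 (abs_re_le_norm (∫ x in (-R)..R, G x))).1
      nlinarith
    rw [← ofReal_integral_eq_lintegral_ofReal i2.1 (Eventually.of_forall hv0),
      ← intervalIntegral.integral_of_le hRR]
    refine (ENNReal.ofReal_le_ofReal hbound).trans (ENNReal.ofReal_add_le.trans ?_)
    gcongr
    rw [ENNReal.ofReal_mul hA]
    gcongr
    rw [intervalIntegral.integral_of_le hRR,
      ofReal_integral_eq_lintegral_ofReal i1.1 (Eventually.of_forall hu0)]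
    exact setLIntegral_le_lintegral _ _
  have hlim : ∫⁻ x, ENNReal.ofReal (v x) ≤ ENNReal.ofReal A * (∫⁻ x, ENNReal.ofReal (u x)) := by
    have t1 : Tendsto (fun R : ℝ => ∫⁻ x in Set.Ioc (-R) R, ENNReal.ofReal (v x)) atTop
        (𝓝 (∫⁻ x, ENNReal.ofReal (v x))) :=
      (aecover_Ioc tendsto_neg_atTop_atBot tendsto_id).lintegral_tendsto_of_countably_generated
        (by fun_prop)
    have t2 : Tendsto (fun R : ℝ => ENNReal.ofReal A * (∫⁻ x, ENNReal.ofReal (u x))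
        + ENNReal.ofReal (B * ‖∫ x in (-R)..R, G x‖)) atTop
        (𝓝 (ENNReal.ofReal A * (∫⁻ x, ENNReal.ofReal (u x)) + ENNReal.ofReal (B * ‖(0 : ℂ)‖))) := by
      refine tendsto_const_nhds.add (ENNReal.tendsto_ofReal (Tendsto.const_mul _ ?_))
      exact (tendsto_integral_cauchyLine_cpow hf hc h0 ht₀ hr hy).norm
    rw [norm_zero, mul_zero, ENNReal.ofReal_zero, add_zero] at t2
    refine le_of_tendsto_of_tendsto t1 t2 ?_
    filter_upwards [eventually_gt_atTop 0] with R hR using hfin R hR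
  simp_rw [e]
  rw [lintegral_const_mul _ (hcv.measurable.ennreal_ofReal)]
  have hP := lintegral_cauchyLine_re_le hf hc h0 hr hy
  have hu (x : ℝ) : ENNReal.ofReal (u x) = ENNReal.ofReal (cauchyLine f (x + y * I)).re ^ r :=
    (ENNReal.ofReal_rpow_of_nonneg (hpos x).le hr0.le).symm
  simp_rw [hu] at hlim
  calc _ ≤ ENNReal.ofReal (Real.pi ^ r) * (ENNReal.ofReal A * ∫⁻ t, ENNReal.ofReal (f t) ^ r) := by
        gcongr; exact hlim.trans (by gcongr)
    _ = _ := by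
        rw [← mul_assoc, ← ENNReal.ofReal_mul (by positivity)]
        congr 1
        refine lintegral_congr fun t => ?_
        rw [Real.enorm_eq_ofReal (h0 t)]

/-- M. Riesz's theorem: convolution with `x / (x² + y²)` is bounded on `L^r(ℝ)`, `1 < r ≤ 2`,
uniformly in `y > 0`. -/
lemma exists_conjPoisson_bound {r : ℝ} (hr : 1 < r) (hr2 : r ≤ 2) :
    ∃ C : ℝ≥0, ∀ (g : ℝ → ℂ), Continuous g → HasCompactSupport g →
      ∀ y : ℝ, 0 < y → ∫⁻ x, ‖∫ t, (conjPoisson y (x - t) : ℂ) * g t‖ₑ ^ r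
        ≤ C * ∫⁻ t, ‖g t‖ₑ ^ r := by
  obtain ⟨C, hC⟩ := exists_conjPoisson_nonneg_bound hr hr2
  have hr0 : 0 < r := by linarith
  refine ⟨4 ^ r * C, fun g hg hgc y hy => ?_⟩
  -- positive and negative parts of the real and imaginary parts
  let G : Fin 4 → ℝ → ℝ :=
    ![fun t => max (g t).re 0, fun t => max (-(g t).re) 0, fun t => max (g t).im 0,
      fun t => max (-(g t).im) 0]
  let c : Fin 4 → ℂ := ![1, -1, I, -I]
  have hGc : ∀ i, Continuous (G i) := by
    intro i; fin_cases i <;> simp [G] <;> fun_prop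
  have hGs : ∀ i, HasCompactSupport (G i) := by
    intro i
    fin_cases i
    · exact hgc.comp_left (g := fun z : ℂ => max z.re 0) (by simp)
    · exact hgc.comp_left (g := fun z : ℂ => max (-z.re) 0) (by simp)
    · exact hgc.comp_left (g := fun z : ℂ => max z.im 0) (by simp)
    · exact hgc.comp_left (g := fun z : ℂ => max (-z.im) 0) (by simp)
  have hG0 : ∀ i t, 0 ≤ G i t := by
    intro i t; fin_cases i <;> simp [G]
  have hGle : ∀ i t, ‖G i t‖ ≤ ‖g t‖ := by
    intro i t
    rw [Real.norm_of_nonneg (hG0 i t)]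
    have h1 := abs_le.1 (abs_re_le_norm (g t))
    have h2 := abs_le.1 (abs_im_le_norm (g t))
    have h3 := norm_nonneg (g t)
    fin_cases i <;> simp [G] <;> linarith
  have hsum : ∀ t, g t = ∑ i, c i * (G i t : ℂ) := by
    intro t
    have hmax (x : ℝ) : max x 0 - max (-x) 0 = x := by
      rcases le_total 0 x with h | h <;> simp [h]
    rw [Fin.sum_univ_four]
    simp only [G, c, Matrix.cons_val]
    have h1 := hmax (g t).re
    have h2 := hmax (g t).im
    apply Complex.ext <;> simp <;> linarith
  have hcn : ∀ i, ‖c i‖ₑ = 1 := by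
    intro i; fin_cases i <;> simp [c, ← ofReal_norm]
  have hint (x : ℝ) (i : Fin 4) : Integrable fun t => (conjPoisson y (x - t) : ℂ) * (G i t : ℂ) := by
    refine Continuous.integrable_of_hasCompactSupport ?_ ?_
    · have : Continuous fun t => conjPoisson y (x - t) :=
        (continuous_conjPoisson hy).comp (by fun_prop)
      exact (continuous_ofReal.comp this).mul (continuous_ofReal.comp (hGc i))
    · exact ((hGs i).comp_left (g := fun x : ℝ => (x : ℂ)) (by simp)).mul_left
  have hle (x : ℝ) : ‖∫ t, (conjPoisson y (x - t) : ℂ) * g t‖ₑ ^ r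
      ≤ 4 ^ (r - 1) * ∑ i, ‖∫ t, conjPoisson y (x - t) * G i t‖ₑ ^ r := by
    have e1 : ∫ t, (conjPoisson y (x - t) : ℂ) * g t
        = ∑ i, c i * ((∫ t, conjPoisson y (x - t) * G i t : ℝ) : ℂ) := by
      calc ∫ t, (conjPoisson y (x - t) : ℂ) * g t
          = ∫ t, ∑ i, c i * ((conjPoisson y (x - t) : ℂ) * (G i t : ℂ)) := by
            congr 1; ext t; rw [hsum t, Finset.mul_sum]
            exact Finset.sum_congr rfl fun i _ => by ring
        _ = _ := by
            rw [integral_finsetSum _ fun i _ => (hint x i).const_mul (c i)]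
            refine Finset.sum_congr rfl fun i _ => ?_
            rw [integral_const_mul, ← integral_complex_ofReal]
            simp
    have e2 : ‖∫ t, (conjPoisson y (x - t) : ℂ) * g t‖ₑ
        ≤ ∑ i, ‖∫ t, conjPoisson y (x - t) * G i t‖ₑ := by
      rw [e1]
      refine (enorm_sum_le _ _).trans (Finset.sum_le_sum fun i _ => ?_)
      rw [enorm_mul, hcn, one_mul, ← ofReal_norm, norm_real, ofReal_norm]
    have h3 := lintegral_rpow_le (Measure.count (α := Fin 4)) hr
      (f := fun i => ‖∫ t, conjPoisson y (x - t) * G i t‖ₑ) Measurable.of_discrete.aemeasurable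
    simp only [lintegral_fintype, Measure.count_singleton, mul_one, Measure.count_univ] at h3
    refine (ENNReal.rpow_le_rpow e2 hr0.le).trans (h3.trans (le_of_eq ?_))
    simp
  have hmeas (i : Fin 4) : Measurable fun x => ‖∫ t, conjPoisson y (x - t) * G i t‖ₑ ^ r := by
    have : StronglyMeasurable fun x => ∫ t, conjPoisson y (x - t) * G i t := by
      refine StronglyMeasurable.integral_prod_right (f := fun x t => conjPoisson y (x - t) * G i t) ?_
      refine Continuous.stronglyMeasurable ?_
      exact ((continuous_conjPoisson hy).comp (continuous_fst.sub continuous_snd)).mul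
        ((hGc i).comp continuous_snd)
    exact this.measurable.enorm.pow_const r
  calc ∫⁻ x, ‖∫ t, (conjPoisson y (x - t) : ℂ) * g t‖ₑ ^ r
      ≤ ∫⁻ x, 4 ^ (r - 1) * ∑ i, ‖∫ t, conjPoisson y (x - t) * G i t‖ₑ ^ r := lintegral_mono hle
    _ = 4 ^ (r - 1) * ∑ i, ∫⁻ x, ‖∫ t, conjPoisson y (x - t) * G i t‖ₑ ^ r := by
        rw [lintegral_const_mul _ (Finset.measurable_fun_sum _ fun i _ => hmeas i),
          lintegral_finsetSum _ fun i _ => hmeas i]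
    _ ≤ 4 ^ (r - 1) * ∑ _i : Fin 4, C * ∫⁻ t, ‖g t‖ₑ ^ r := by
        gcongr with i
        refine (hC _ (hGc i) (hGs i) (hG0 i) y hy).trans ?_
        gcongr with t
        exact enorm_le_iff_norm_le.2 (hGle i t)
    _ = _ := by
        have h4 : (4 : ℝ≥0∞) ^ r = 4 ^ (r - 1) * 4 := by
          conv_lhs => rw [show r = (r - 1) + 1 by ring]
          rw [ENNReal.rpow_add _ _ (by norm_num) (by norm_num), ENNReal.rpow_one]
        rw [Finset.sum_const, Finset.card_univ, Fintype.card_fin, nsmul_eq_mul, ENNReal.coe_mul,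
          ENNReal.coe_rpow_of_nonneg _ hr0.le]
        push_cast
        rw [h4]; ring

/-! ### Double conjugate Poisson kernels and their rotations -/

lemma lintegral_complex_eq {F : ℂ → ℝ≥0∞} (hF : Measurable F) :
    ∫⁻ z, F z = ∫⁻ x : ℝ, ∫⁻ y : ℝ, F ⟨x, y⟩ := by
  rw [← volume_preserving_equiv_real_prod.symm.lintegral_comp_emb
    measurableEquivRealProd.symm.measurableEmbedding, Measure.volume_eq_prod, lintegral_prod]
  · rfl
  · exact (hF.comp measurableEquivRealProd.symm.measurable).aemeasurable

lemma integral_complex_eq {F : ℂ → ℂ} (hF : Integrable F) :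
    ∫ z, F z = ∫ y : ℝ, ∫ x : ℝ, F ⟨x, y⟩ := by
  rw [← volume_preserving_equiv_real_prod.symm.integral_comp
    measurableEquivRealProd.symm.measurableEmbedding, Measure.volume_eq_prod, integral_prod_symm]
  · rfl
  · rw [← Measure.volume_eq_prod]
    exact (volume_preserving_equiv_real_prod.symm.integrable_comp_emb
      measurableEquivRealProd.symm.measurableEmbedding).2 hF

/-- The tensor square of the conjugate Poisson kernel, as a kernel on the plane. -/
noncomputable def doublePoisson (δ : ℝ) (w : ℂ) : ℂ :=
  ((conjPoisson δ w.re * conjPoisson δ w.im : ℝ) : ℂ)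

lemma continuous_doublePoisson {δ : ℝ} (hδ : 0 < δ) : Continuous (doublePoisson δ) := by
  have := continuous_conjPoisson hδ
  unfold doublePoisson
  fun_prop

/-- Applying M. Riesz's theorem in each variable. -/
lemma exists_doublePoisson_bound {r : ℝ} (hr : 1 < r) (hr2 : r ≤ 2) :
    ∃ C : ℝ≥0, ∀ (g : ℂ → ℂ), Continuous g → HasCompactSupport g →
      ∀ δ : ℝ, 0 < δ → ∫⁻ z, ‖∫ w, doublePoisson δ (z - w) * g w‖ₑ ^ r
        ≤ C * ∫⁻ z, ‖g z‖ₑ ^ r := by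
  obtain ⟨C, hC⟩ := exists_conjPoisson_bound hr hr2
  refine ⟨C * C, fun g hg hgc δ hδ => ?_⟩
  have hq := continuous_conjPoisson hδ
  obtain ⟨R, hR⟩ := hgc.isCompact.isBounded.subset_closedBall 0
  have hg0 (s t : ℝ) (h : R < |s| ∨ R < |t|) : g ⟨s, t⟩ = 0 := by
    by_contra h'
    have := hR (subset_tsupport g h')
    simp only [Metric.mem_closedBall, dist_zero_right] at this
    have h1 := abs_re_le_norm (⟨s, t⟩ : ℂ)
    have h2 := abs_im_le_norm (⟨s, t⟩ : ℂ)
    simp only at h1 h2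
    rcases h with h | h <;> linarith
  have hmk : Continuous fun p : ℝ × ℝ => (⟨p.1, p.2⟩ : ℂ) := by
    have : (fun p : ℝ × ℝ => (⟨p.1, p.2⟩ : ℂ)) = fun p => (p.1 : ℂ) + p.2 * I := by
      ext p; exact mk_eq_add_mul_I _ _
    rw [this]; fun_prop
  have hg2 : Continuous fun p : ℝ × ℝ => g ⟨p.1, p.2⟩ := hg.comp hmk
  have hcs (s : ℝ → ℂ) (hs : ∀ t, R < |t| → s t = 0) : HasCompactSupport s := by
    refine HasCompactSupport.intro (isCompact_closedBall (0 : ℝ) R) fun t ht => hs t ?_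
    simpa using ht
  -- the transform in the first variable
  let h : ℝ → ℝ → ℂ := fun x t => ∫ s, (conjPoisson δ (x - s) : ℂ) * g ⟨s, t⟩
  have hhc : Continuous fun p : ℝ × ℝ => h p.1 p.2 := by
    rw [← continuousOn_univ]
    refine continuousOn_integral_of_compact_support (k := Metric.closedBall (0 : ℝ) R)
      (f := fun (p : ℝ × ℝ) s => (conjPoisson δ (p.1 - s) : ℂ) * g ⟨s, p.2⟩)
      (isCompact_closedBall _ _) (Continuous.continuousOn ?_) fun p s _ hs => ?_
    · refine (continuous_ofReal.comp (hq.comp (by fun_prop))).mul ?_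
      exact hg2.comp (f := fun p : (ℝ × ℝ) × ℝ => (p.2, p.1.2)) (by fun_prop)
    · rw [hg0 s p.2 (Or.inl (by simpa using hs)), mul_zero]
  have hh0 (x t : ℝ) (ht : R < |t|) : h x t = 0 := by
    simp [h, hg0 _ t (Or.inr ht)]
  have hint (z : ℂ) : Integrable fun w => doublePoisson δ (z - w) * g w :=
    Continuous.integrable_of_hasCompactSupport
      (((continuous_doublePoisson hδ).comp (by fun_prop)).mul hg) hgc.mul_left
  have e1 (x y : ℝ) : ∫ w, doublePoisson δ (⟨x, y⟩ - w) * g w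
      = ∫ t, (conjPoisson δ (y - t) : ℂ) * h x t := by
    rw [integral_complex_eq (hint _)]
    congr 1; ext t
    rw [← integral_const_mul]
    congr 1; ext s
    simp only [doublePoisson, sub_re, sub_im]
    push_cast; ring
  have hm1 : Measurable fun z => ‖∫ w, doublePoisson δ (z - w) * g w‖ₑ ^ r := by
    have : StronglyMeasurable fun z => ∫ w, doublePoisson δ (z - w) * g w := by
      refine StronglyMeasurable.integral_prod_right (f := fun z w => doublePoisson δ (z - w) * g w) ?_
      exact (((continuous_doublePoisson hδ).comp (by fun_prop)).mul
        (hg.comp continuous_snd)).stronglyMeasurable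
    exact this.measurable.enorm.pow_const r
  rw [lintegral_complex_eq hm1, lintegral_complex_eq (hg.enorm.measurable.pow_const r)]
  simp_rw [e1]
  calc ∫⁻ x : ℝ, ∫⁻ y : ℝ, ‖∫ t, (conjPoisson δ (y - t) : ℂ) * h x t‖ₑ ^ r
      ≤ ∫⁻ x : ℝ, C * ∫⁻ t : ℝ, ‖h x t‖ₑ ^ r := by
        gcongr with x
        exact hC _ (hhc.comp (f := fun t => (x, t)) (by fun_prop)) (hcs _ (hh0 x)) δ hδ
    _ = C * ∫⁻ t : ℝ, ∫⁻ x : ℝ, ‖h x t‖ₑ ^ r := by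
        have hm : Measurable fun p : ℝ × ℝ => ‖h p.1 p.2‖ₑ ^ r :=
          hhc.enorm.measurable.pow_const r
        rw [lintegral_const_mul _ hm.lintegral_prod_right', lintegral_lintegral_swap hm.aemeasurable]
    _ ≤ C * ∫⁻ t : ℝ, C * ∫⁻ s : ℝ, ‖g ⟨s, t⟩‖ₑ ^ r := by
        gcongr with t
        exact hC _ (hg2.comp (f := fun s => (s, t)) (by fun_prop))
          (hcs _ fun s hs => hg0 s t (Or.inl hs)) δ hδ
    _ = (C * C : ℝ≥0) * ∫⁻ s : ℝ, ∫⁻ t : ℝ, ‖g ⟨s, t⟩‖ₑ ^ r := by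
        have hm : Measurable fun p : ℝ × ℝ => ‖g ⟨p.1, p.2⟩‖ₑ ^ r :=
          hg2.enorm.measurable.pow_const r
        rw [lintegral_const_mul _ hm.lintegral_prod_left', ← mul_assoc, ENNReal.coe_mul,
          lintegral_lintegral_swap (f := fun s t : ℝ => ‖g ⟨s, t⟩‖ₑ ^ r) hm.aemeasurable]

/-- The kernel `doublePoisson δ` rotated by the angle `θ`. -/
noncomputable def rotatedPoisson (δ θ : ℝ) (w : ℂ) : ℂ := doublePoisson δ (exp (-(θ * I)) * w)

lemma continuous_rotatedPoisson {δ : ℝ} (hδ : 0 < δ) :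
    Continuous fun p : ℝ × ℂ => rotatedPoisson δ p.1 p.2 := by
  unfold rotatedPoisson
  exact (continuous_doublePoisson hδ).comp (by fun_prop)

lemma exists_rotatedPoisson_bound {r : ℝ} (hr : 1 < r) (hr2 : r ≤ 2) :
    ∃ C : ℝ≥0, ∀ (g : ℂ → ℂ), Continuous g → HasCompactSupport g →
      ∀ δ : ℝ, 0 < δ → ∀ θ : ℝ, ∫⁻ z, ‖∫ w, rotatedPoisson δ θ (z - w) * g w‖ₑ ^ r
        ≤ C * ∫⁻ z, ‖g z‖ₑ ^ r := by
  obtain ⟨C, hC⟩ := exists_doublePoisson_bound hr hr2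
  refine ⟨C, fun g hg hgc δ hδ θ => ?_⟩
  let e : ℂ ≃ₗᵢ[ℝ] ℂ := rotation (Circle.exp θ)
  have he (z : ℂ) : e z = exp (θ * I) * z := by simp [e, rotation_apply]
  have hee (z : ℂ) : exp (-(θ * I)) * e z = z := by
    rw [he, ← mul_assoc, ← Complex.exp_add]; simp
  have hemb : MeasurableEmbedding e := e.toHomeomorph.measurableEmbedding
  have hmp : MeasurePreserving e volume volume := e.measurePreserving
  have h1 (z : ℂ) : ∫ w, rotatedPoisson δ θ (e z - w) * g w
      = ∫ w, doublePoisson δ (z - w) * g (e w) := by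
    rw [← hmp.integral_comp hemb]
    congr 1; ext w
    rw [rotatedPoisson, ← map_sub, hee]
  rw [← hmp.lintegral_comp_emb hemb, ← hmp.lintegral_comp_emb hemb (fun z => ‖g z‖ₑ ^ r)]
  simp_rw [h1]
  exact hC (fun w => g (e w)) (hg.comp e.continuous) (hgc.comp_homeomorph e.toHomeomorph) δ hδ

/-- The superposition `∫ e^{-2iθ} (doublePoisson δ rotated by θ) dθ`, which regularises a multiple
of the Beurling kernel `1 / w²`. -/
noncomputable def averagedPoisson (δ : ℝ) (w : ℂ) : ℂ :=
  ∫ θ in Set.Ioc (-Real.pi) Real.pi, exp (-(2 * θ * I)) * rotatedPoisson δ θ w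

lemma norm_doublePoisson_le {δ : ℝ} (hδ : 0 < δ) (w : ℂ) : ‖doublePoisson δ w‖ ≤ (δ⁻¹) ^ 2 := by
  have h (x : ℝ) : |conjPoisson δ x| ≤ δ⁻¹ := by
    rw [conjPoisson, abs_div, abs_of_pos (by positivity : 0 < x ^ 2 + δ ^ 2),
      div_le_iff₀ (by positivity), ← div_eq_inv_mul, le_div_iff₀ hδ]
    nlinarith [sq_nonneg (|x| - δ), sq_abs x, sq_nonneg x]
  rw [doublePoisson, norm_real, Real.norm_eq_abs, abs_mul, pow_two]
  exact mul_le_mul (h _) (h _) (abs_nonneg _) (by positivity)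

lemma norm_exp_neg_two_mul_I (θ : ℝ) : ‖exp (-(2 * θ * I))‖ = 1 := by
  rw [show -(2 * (θ : ℂ) * I) = ((-2 * θ : ℝ) : ℂ) * I by push_cast; ring, norm_exp_ofReal_mul_I]

lemma integral_averagedPoisson {δ : ℝ} (hδ : 0 < δ) {g : ℂ → ℂ} (hg : Continuous g)
    (hgc : HasCompactSupport g) (z : ℂ) :
    ∫ w, averagedPoisson δ (z - w) * g w = ∫ θ in Set.Ioc (-Real.pi) Real.pi,
      exp (-(2 * θ * I)) * ∫ w, rotatedPoisson δ θ (z - w) * g w := by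
  simp_rw [averagedPoisson, ← integral_mul_const, ← integral_const_mul]
  rw [integral_integral_swap]
  · simp_rw [mul_assoc]
  · have hdom : Integrable (fun p : ℂ × ℝ => ‖g p.1‖ * (δ⁻¹) ^ 2)
        ((volume : Measure ℂ).prod (volume.restrict (Set.Ioc (-Real.pi) Real.pi))) :=
      Integrable.mul_prod (f := fun w => ‖g w‖) (g := fun _ : ℝ => (δ⁻¹) ^ 2)
        (hg.integrable_of_hasCompactSupport hgc).norm (integrable_const _)
    refine hdom.mono' ?_ (Eventually.of_forall fun p => ?_)
    · refine Continuous.aestronglyMeasurable (Continuous.mul (Continuous.mul (by fun_prop) ?_)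
        (hg.comp continuous_fst))
      exact (continuous_rotatedPoisson hδ).comp
        (f := fun p : ℂ × ℝ => (p.2, z - p.1)) (by fun_prop)
    · simp only [Function.uncurry]
      rw [norm_mul, norm_mul, norm_exp_neg_two_mul_I, one_mul, mul_comm]
      gcongr
      exact norm_doublePoisson_le hδ _

lemma exists_averagedPoisson_bound {r : ℝ} (hr : 1 < r) (hr2 : r ≤ 2) :
    ∃ C : ℝ≥0, ∀ (g : ℂ → ℂ), Continuous g → HasCompactSupport g →
      ∀ δ : ℝ, 0 < δ → ∫⁻ z, ‖∫ w, averagedPoisson δ (z - w) * g w‖ₑ ^ r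
        ≤ C * ∫⁻ z, ‖g z‖ₑ ^ r := by
  obtain ⟨C, hC⟩ := exists_rotatedPoisson_bound hr hr2
  have hr0 : 0 < r := by linarith
  set m : ℝ≥0∞ := volume (Set.Ioc (-Real.pi) Real.pi) with hm
  have hmtop : m ≠ ⊤ := by simp [hm]
  refine ⟨(m ^ (r - 1) * m).toNNReal * C, fun g hg hgc δ hδ => ?_⟩
  have hmt : m ^ (r - 1) * m ≠ ⊤ :=
    ENNReal.mul_ne_top (ENNReal.rpow_ne_top_of_nonneg (by linarith) hmtop) hmtop
  rw [ENNReal.coe_mul, ENNReal.coe_toNNReal hmt]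
  have hmeas : Measurable fun p : ℂ × ℝ => ‖∫ w, rotatedPoisson δ p.2 (p.1 - w) * g w‖ₑ := by
    have : StronglyMeasurable fun p : ℂ × ℝ => ∫ w, rotatedPoisson δ p.2 (p.1 - w) * g w := by
      refine StronglyMeasurable.integral_prod_right
        (f := fun (p : ℂ × ℝ) w => rotatedPoisson δ p.2 (p.1 - w) * g w) ?_
      refine (Continuous.mul ?_ (hg.comp continuous_snd)).stronglyMeasurable
      exact (continuous_rotatedPoisson hδ).comp
        (f := fun p : (ℂ × ℝ) × ℂ => (p.1.2, p.1.1 - p.2)) (by fun_prop)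
    exact this.measurable.enorm
  have hpt (z : ℂ) : ‖∫ w, averagedPoisson δ (z - w) * g w‖ₑ ^ r ≤ m ^ (r - 1) *
      ∫⁻ θ in Set.Ioc (-Real.pi) Real.pi, ‖∫ w, rotatedPoisson δ θ (z - w) * g w‖ₑ ^ r := by
    rw [integral_averagedPoisson hδ hg hgc]
    have h1 : ‖∫ θ in Set.Ioc (-Real.pi) Real.pi,
        exp (-(2 * θ * I)) * ∫ w, rotatedPoisson δ θ (z - w) * g w‖ₑ
        ≤ ∫⁻ θ in Set.Ioc (-Real.pi) Real.pi, ‖∫ w, rotatedPoisson δ θ (z - w) * g w‖ₑ := by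
      refine (enorm_integral_le_lintegral_enorm _).trans (lintegral_mono fun θ => ?_)
      rw [enorm_mul, ← ofReal_norm, norm_exp_neg_two_mul_I, ENNReal.ofReal_one, one_mul]
    refine (ENNReal.rpow_le_rpow h1 hr0.le).trans ?_
    have := lintegral_rpow_le (volume.restrict (Set.Ioc (-Real.pi) Real.pi)) hr
      (f := fun θ => ‖∫ w, rotatedPoisson δ θ (z - w) * g w‖ₑ)
      (hmeas.comp (measurable_prodMk_left (x := z))).aemeasurable
    rwa [Measure.restrict_apply_univ] at this
  calc ∫⁻ z, ‖∫ w, averagedPoisson δ (z - w) * g w‖ₑ ^ r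
      ≤ ∫⁻ z, m ^ (r - 1) * ∫⁻ θ in Set.Ioc (-Real.pi) Real.pi,
          ‖∫ w, rotatedPoisson δ θ (z - w) * g w‖ₑ ^ r := lintegral_mono hpt
    _ = m ^ (r - 1) * ∫⁻ θ in Set.Ioc (-Real.pi) Real.pi, ∫⁻ z,
          ‖∫ w, rotatedPoisson δ θ (z - w) * g w‖ₑ ^ r := by
        rw [lintegral_const_mul _ (hmeas.pow_const r).lintegral_prod_right',
          lintegral_lintegral_swap (hmeas.pow_const r).aemeasurable]
    _ ≤ m ^ (r - 1) * ∫⁻ _ in Set.Ioc (-Real.pi) Real.pi, C * ∫⁻ z, ‖g z‖ₑ ^ r := by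
        gcongr with θ
        exact hC g hg hgc δ hδ θ
    _ = m ^ (r - 1) * m * C * ∫⁻ z, ‖g z‖ₑ ^ r := by
        rw [setLIntegral_const]; ring

/-- The function `ζ² · doublePoisson δ ζ`. -/
noncomputable def weightedPoisson (δ : ℝ) (ζ : ℂ) : ℂ := ζ ^ 2 * doublePoisson δ ζ

/-- The function of `|w|` that `w² · averagedPoisson δ w` depends on. -/
noncomputable def radialProfile (δ ρ : ℝ) : ℂ :=
  ∫ θ in Set.Ioc (-Real.pi) Real.pi, 2 * I *
    (((ρ * Real.cos θ) ^ 2 / ((ρ * Real.cos θ) ^ 2 + δ ^ 2) *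
      ((ρ * Real.sin θ) ^ 2 / ((ρ * Real.sin θ) ^ 2 + δ ^ 2)) : ℝ) : ℂ)

/-- Multiplied by `w²`, the averaged kernel is radial: the phase of `w²` compensates the weight
`e^{-2iθ}`, and the average runs over all rotations. -/
lemma sq_mul_averagedPoisson {δ : ℝ} (hδ : 0 < δ) (w : ℂ) :
    w ^ 2 * averagedPoisson δ w = radialProfile δ ‖w‖ := by
  have hcΦ : Continuous (weightedPoisson δ) :=
    (continuous_pow 2).mul (continuous_doublePoisson hδ)
  let Ψ : ℝ → ℂ := fun θ => weightedPoisson δ (‖w‖ * exp (θ * I))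
  have hΨc : Continuous Ψ := hcΦ.comp (by fun_prop)
  have hper : Function.Periodic Ψ (2 * Real.pi) := fun θ => by
    simp only [Ψ]; push_cast
    rw [add_mul, Complex.exp_add, Complex.exp_two_pi_mul_I, mul_one]
  have hpi := Real.pi_pos
  have hle : -Real.pi ≤ Real.pi := by linarith
  have e1 : w ^ 2 * averagedPoisson δ w = ∫ θ in (-Real.pi)..Real.pi, Ψ (arg w - θ) := by
    rw [averagedPoisson, ← integral_const_mul, intervalIntegral.integral_of_le hle]
    congr 1; ext θ
    simp only [Ψ]
    have hw : (‖w‖ : ℂ) * exp ((arg w - θ : ℝ) * I) = exp (-(θ * I)) * w := by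
      conv_rhs => rw [← norm_mul_exp_arg_mul_I w]
      push_cast; rw [sub_mul, sub_eq_add_neg, Complex.exp_add]; ring
    rw [hw, weightedPoisson, rotatedPoisson, mul_pow, ← Complex.exp_nat_mul]
    rw [show ((2 : ℕ) : ℂ) * -(θ * I) = -(2 * θ * I) by push_cast; ring]
    ring
  have e2 : ∫ θ in (-Real.pi)..Real.pi, Ψ (arg w - θ) = ∫ θ in (-Real.pi)..Real.pi, Ψ θ := by
    rw [intervalIntegral.integral_comp_sub_left]
    have := hper.intervalIntegral_add_eq (arg w - Real.pi) (-Real.pi)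
    convert this using 2 <;> ring
  -- symmetrisation in `θ` leaves only the part `2i xy` of `(x + iy)²`, as the kernel is odd in `y`
  have e3 : ∫ θ in (-Real.pi)..Real.pi, Ψ θ = ∫ θ in (-Real.pi)..Real.pi, (Ψ θ + Ψ (-θ)) / 2 := by
    have h1 : ∫ θ in (-Real.pi)..Real.pi, Ψ (-θ) = ∫ θ in (-Real.pi)..Real.pi, Ψ θ := by
      rw [intervalIntegral.integral_comp_neg, neg_neg]
    have hneg : Continuous fun θ => Ψ (-θ) := hΨc.comp continuous_neg
    rw [intervalIntegral.integral_div, intervalIntegral.integral_add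
      (hΨc.intervalIntegrable _ _) (hneg.intervalIntegrable _ _), h1]
    ring
  rw [e1, e2, e3, intervalIntegral.integral_of_le hle, radialProfile]
  congr 1; ext θ
  have hval (t : ℝ) : (‖w‖ : ℂ) * exp (t * I) = ⟨‖w‖ * Real.cos t, ‖w‖ * Real.sin t⟩ := by
    rw [exp_mul_I]; apply Complex.ext <;> simp [← ofReal_cos, ← ofReal_sin]
  simp only [Ψ, weightedPoisson, doublePoisson, conjPoisson, hval, Real.cos_neg, Real.sin_neg]
  rw [mk_eq_add_mul_I, mk_eq_add_mul_I]
  have hI : I ^ 2 = -1 := I_sq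
  set a := ‖w‖ * Real.cos θ
  have ha : (a ^ 2 + δ ^ 2) ≠ 0 := by positivity
  have hb : ((‖w‖ * Real.sin θ) ^ 2 + δ ^ 2) ≠ 0 := by positivity
  rw [show ‖w‖ * -Real.sin θ = -(‖w‖ * Real.sin θ) by ring]
  set b := ‖w‖ * Real.sin θ
  rw [neg_sq]
  push_cast
  ring

lemma norm_radialProfile_integrand_le {δ : ℝ} (hδ : 0 < δ) (a b : ℝ) :
    ‖2 * I * ((a ^ 2 / (a ^ 2 + δ ^ 2) * (b ^ 2 / (b ^ 2 + δ ^ 2)) : ℝ) : ℂ)‖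
      ≤ min 2 (2 * a ^ 2 / δ ^ 2) := by
  have h1 (x : ℝ) : x ^ 2 / (x ^ 2 + δ ^ 2) ≤ 1 := by
    rw [div_le_one (by positivity)]; nlinarith
  have h2 : a ^ 2 / (a ^ 2 + δ ^ 2) ≤ a ^ 2 / δ ^ 2 := by
    gcongr; nlinarith
  have h0 (x : ℝ) : 0 ≤ x ^ 2 / (x ^ 2 + δ ^ 2) := by positivity
  rw [norm_mul, norm_mul, norm_I, norm_real, Real.norm_of_nonneg (mul_nonneg (h0 _) (h0 _)),
    Complex.norm_ofNat, mul_one]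
  refine le_min ?_ ?_
  · nlinarith [h0 a, h0 b, h1 a, h1 b]
  · rw [mul_div_assoc]
    nlinarith [h0 a, h0 b, h1 a, h1 b]

lemma norm_radialProfile_le {δ : ℝ} (hδ : 0 < δ) (ρ : ℝ) :
    ‖radialProfile δ ρ‖ ≤ 4 * Real.pi ∧
      ‖radialProfile δ ρ‖ ≤ 4 * Real.pi / δ ^ 2 * ρ ^ 2 := by
  have hpi := Real.pi_pos
  have hvol : volume.real (Set.Ioc (-Real.pi) Real.pi) = 2 * Real.pi := by
    rw [Real.volume_real_Ioc_of_le (by linarith)]; ring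
  have hfin : volume (Set.Ioc (-Real.pi) Real.pi) < ⊤ := by simp
  constructor
  · refine (norm_setIntegral_le_of_norm_le_const (C := 2) hfin fun θ _ => ?_).trans ?_
    · exact (norm_radialProfile_integrand_le hδ _ _).trans (min_le_left _ _)
    · rw [hvol]; linarith
  · refine (norm_setIntegral_le_of_norm_le_const (C := 2 * ρ ^ 2 / δ ^ 2) hfin fun θ _ => ?_).trans ?_
    · refine (norm_radialProfile_integrand_le hδ _ _).trans ((min_le_right _ _).trans ?_)
      refine div_le_div_of_nonneg_right ?_ (by positivity)
      nlinarith [Real.sin_sq_add_cos_sq θ, sq_nonneg (ρ * Real.sin θ)]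
    · rw [hvol]; apply le_of_eq; ring

lemma continuous_radialProfile {δ : ℝ} (hδ : 0 < δ) : Continuous (radialProfile δ) := by
  have hne (x : ℝ) : x ^ 2 + δ ^ 2 ≠ 0 := by positivity
  refine continuous_of_dominated (bound := fun _ => 2) (fun ρ => ?_) (fun ρ => ?_)
    (integrable_const _) ?_
  · refine Continuous.aestronglyMeasurable ?_
    refine continuous_const.mul (continuous_ofReal.comp (Continuous.mul ?_ ?_)) <;>
    · exact Continuous.div (by fun_prop) (by fun_prop) fun θ => hne _
  · exact Eventually.of_forall fun θ =>
      (norm_radialProfile_integrand_le hδ _ _).trans (min_le_left _ _)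
  · refine Eventually.of_forall fun θ => ?_
    refine continuous_const.mul (continuous_ofReal.comp (Continuous.mul ?_ ?_)) <;>
    · exact Continuous.div (by fun_prop) (by fun_prop) fun ρ => hne _

/-- As `δ → 0` the profile becomes constant, so that `averagedPoisson δ w` tends to `4πi / w²`. -/
lemma tendsto_radialProfile {ρ : ℝ} (hρ : 0 < ρ) :
    Tendsto (fun δ : ℝ => radialProfile δ ρ) (𝓝[>] 0) (𝓝 (4 * Real.pi * I)) := by
  have hlim : (4 * Real.pi * I : ℂ) = ∫ _ in Set.Ioc (-Real.pi) Real.pi, 2 * I := by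
    have hvol : volume.real (Set.Ioc (-Real.pi) Real.pi) = 2 * Real.pi := by
      rw [Real.volume_real_Ioc_of_le (by linarith [Real.pi_pos])]; ring
    rw [setIntegral_const, hvol]; simp; ring
  rw [hlim]
  refine tendsto_integral_filter_of_dominated_convergence (fun _ => 2) ?_ ?_ (integrable_const _) ?_
  · filter_upwards [self_mem_nhdsWithin] with δ (hδ : 0 < δ)
    refine Continuous.aestronglyMeasurable ?_
    refine continuous_const.mul (continuous_ofReal.comp (Continuous.mul ?_ ?_)) <;>
    · exact Continuous.div (by fun_prop) (by fun_prop) fun θ => by positivity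
  · filter_upwards [self_mem_nhdsWithin] with δ (hδ : 0 < δ)
    exact Eventually.of_forall fun θ =>
      (norm_radialProfile_integrand_le hδ _ _).trans (min_le_left _ _)
  · have hcount : {θ : ℝ | Real.sin (2 * θ) = 0}.Countable := by
      refine (Set.countable_range fun n : ℤ => (n * Real.pi) / 2).mono fun θ hθ => ?_
      obtain ⟨n, hn⟩ := Real.sin_eq_zero_iff.1 hθ
      exact ⟨n, by simp only; rw [hn]; ring⟩
    refine ae_restrict_of_ae ?_
    filter_upwards [hcount.ae_notMem volume] with θ hθ
    have hsc : Real.sin θ ≠ 0 ∧ Real.cos θ ≠ 0 := by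
      replace hθ : ¬ Real.sin (2 * θ) = 0 := hθ
      rw [Real.sin_two_mul] at hθ
      exact ⟨fun h => hθ (by simp [h]), fun h => hθ (by simp [h])⟩
    have hx (x : ℝ) (hx : x ≠ 0) :
        Tendsto (fun δ : ℝ => x ^ 2 / (x ^ 2 + δ ^ 2)) (𝓝[>] 0) (𝓝 1) := by
      have : ContinuousAt (fun δ : ℝ => x ^ 2 / (x ^ 2 + δ ^ 2)) 0 :=
        ContinuousAt.div (by fun_prop) (by fun_prop) (by positivity)
      have h := this.tendsto.mono_left (nhdsWithin_le_nhds (s := Set.Ioi 0))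
      simpa [div_self (pow_ne_zero 2 hx)] using h
    have h := (hx _ (mul_ne_zero hρ.ne' hsc.2)).mul (hx _ (mul_ne_zero hρ.ne' hsc.1))
    have h2 := ((continuous_ofReal.tendsto _).comp h).const_mul (2 * I)
    simpa using h2

/-! ### Truncations are averages; the Cauchy transform -/

/-- Integration by parts of a Lipschitz function, with almost everywhere line derivative `m'`,
against a test function. -/
lemma integral_lipschitz_mul_fderiv {m m' g : ℂ → ℂ} {C : ℝ≥0} (hm : LipschitzWith C m)
    (hg : IsTest g) (v : ℂ) (hm' : ∀ᵐ x, HasLineDerivAt ℝ m (m' x) x v) :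
    ∫ x, m x * fderiv ℝ g x v = -∫ x, m' x * g x := by
  obtain ⟨D, hD⟩ := hg.1.lipschitzWith_of_hasCompactSupport hg.2 (by simp)
  obtain ⟨ρ, hρ, hρ0⟩ := hg.exists_radius
  have t1 : Tendsto (fun t : ℝ => ∫ x, (t⁻¹ • (m (x + t • v) - m x)) * g x) (𝓝[>] 0)
      (𝓝 (∫ x, m' x * g x)) := by
    refine tendsto_integral_filter_of_dominated_convergence (fun x => (C * ‖v‖) * ‖g x‖) ?_ ?_
      (hg.integrable.norm.const_mul _) ?_
    · refine Eventually.of_forall fun t => Continuous.aestronglyMeasurable ?_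
      have := hm.continuous
      have := hg.continuous
      fun_prop
    · filter_upwards [self_mem_nhdsWithin] with t (ht : 0 < t)
      refine Eventually.of_forall fun x => ?_
      rw [norm_mul, norm_smul, norm_inv, Real.norm_of_nonneg ht.le]
      refine mul_le_mul_of_nonneg_right ?_ (norm_nonneg _)
      rw [inv_mul_le_iff₀ ht]
      have := hm.norm_sub_le (x + t • v) x
      rw [add_sub_cancel_left, norm_smul, Real.norm_of_nonneg ht.le] at this
      linarith
    · filter_upwards [hm'] with x hx
      exact hx.tendsto_slope_zero_right.mul_const _
  have t2 : Tendsto (fun t : ℝ => ∫ x, m x * (t⁻¹ • (g (x + t • (-v)) - g x))) (𝓝[>] 0)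
      (𝓝 (∫ x, m x * fderiv ℝ g x (-v))) := by
    refine tendsto_integral_filter_of_dominated_convergence
      ((Metric.closedBall (0 : ℂ) (ρ + ‖v‖)).indicator fun x => ‖m x‖ * (D * ‖v‖)) ?_ ?_ ?_ ?_
    · refine Eventually.of_forall fun t => Continuous.aestronglyMeasurable ?_
      have := hm.continuous
      have := hg.continuous
      fun_prop
    · filter_upwards [Ioc_mem_nhdsGT (zero_lt_one (α := ℝ))] with t ht
      refine Eventually.of_forall fun x => ?_
      by_cases hx : x ∈ Metric.closedBall (0 : ℂ) (ρ + ‖v‖)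
      · rw [Set.indicator_of_mem hx, norm_mul, norm_smul, norm_inv, Real.norm_of_nonneg ht.1.le]
        refine mul_le_mul_of_nonneg_left ?_ (norm_nonneg _)
        rw [inv_mul_le_iff₀ ht.1]
        have := hD.norm_sub_le (x + t • (-v)) x
        rw [add_sub_cancel_left, norm_smul, Real.norm_of_nonneg ht.1.le, norm_neg] at this
        linarith
      · rw [Set.indicator_of_notMem hx]
        simp only [Metric.mem_closedBall, dist_zero_right, not_le] at hx
        have h1 : ρ < ‖x + t • (-v)‖ := by
          have h2 := norm_sub_le (x + t • (-v)) (t • (-v))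
          rw [add_sub_cancel_right, norm_smul, Real.norm_of_nonneg ht.1.le, norm_neg] at h2
          nlinarith [ht.2, norm_nonneg v]
        rw [hρ0 _ h1, hρ0 x (by linarith [norm_nonneg v])]
        simp
    · refine IntegrableOn.integrable_indicator ?_ measurableSet_closedBall
      exact (hm.continuous.norm.mul continuous_const).continuousOn.integrableOn_compact
        (isCompact_closedBall _ _)
    · refine Eventually.of_forall fun x => ?_
      exact ((hg.differentiable x).hasFDerivAt.hasLineDerivAt (-v)).tendsto_slope_zero_right.const_mul _
  have e : ∀ t : ℝ, ∫ x, (t⁻¹ • (m (x + t • v) - m x)) * g x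
      = ∫ x, m x * (t⁻¹ • (g (x + t • (-v)) - g x)) := by
    intro t
    have hgt : IsTest fun x => g (x + t • (-v)) := hg.comp_add _
    have i1 : Integrable fun x => m (x + t • v) * g x :=
      Continuous.integrable_of_hasCompactSupport ((hm.continuous.comp (by fun_prop)).mul
        hg.continuous) hg.2.mul_left
    have i2 : Integrable fun x => m x * g x :=
      Continuous.integrable_of_hasCompactSupport (hm.continuous.mul hg.continuous) hg.2.mul_left
    have i3 : Integrable fun x => m x * g (x + t • (-v)) :=
      Continuous.integrable_of_hasCompactSupport (hm.continuous.mul hgt.continuous) hgt.2.mul_left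
    have e3 : ∫ x, m (x + t • v) * g x = ∫ x, m x * g (x + t • (-v)) := by
      rw [← integral_add_right_eq_self _ (t • (-v))]; simp
    have a1 : ∀ x, (t⁻¹ • (m (x + t • v) - m x)) * g x
        = (t⁻¹ : ℂ) * (m (x + t • v) * g x - m x * g x) := by
      intro x; rw [real_smul]; push_cast; ring
    have a2 : ∀ x, m x * (t⁻¹ • (g (x + t • (-v)) - g x))
        = (t⁻¹ : ℂ) * (m x * g (x + t • (-v)) - m x * g x) := by
      intro x; rw [real_smul]; push_cast; ring
    simp_rw [a1, a2]
    rw [integral_const_mul, integral_const_mul, integral_sub i1 i2, integral_sub i3 i2, e3]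
  simp_rw [e] at t1
  have := tendsto_nhds_unique t1 t2
  rw [this, ← integral_neg]
  congr 1; ext x; simp

/-- The regularisation `w̄ / max(|w|, ε)²` of the Cauchy kernel `1 / w`. Up to a constant it is the
Cauchy transform of the normalised indicator function of the disc of radius `ε`. -/
noncomputable def regCauchy (ε : ℝ) (w : ℂ) : ℂ := starRingEnd ℂ w / ((max ‖w‖ ε : ℝ) : ℂ) ^ 2

lemma regCauchy_of_le {ε : ℝ} {w : ℂ} (h : ‖w‖ ≤ ε) :
    regCauchy ε w = starRingEnd ℂ w / (ε : ℂ) ^ 2 := by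
  rw [regCauchy, max_eq_right h]

lemma regCauchy_of_ge {ε : ℝ} {w : ℂ} (h : ε ≤ ‖w‖) : regCauchy ε w = w⁻¹ := by
  rw [regCauchy, max_eq_left h, inv_def, normSq_eq_norm_sq]; push_cast; rw [div_eq_mul_inv]

lemma lipschitzWith_regCauchy {ε : ℝ} (hε : 0 < ε) :
    LipschitzWith (Real.toNNReal (1 / ε ^ 2)) (regCauchy ε) := by
  refine LipschitzWith.of_dist_le_mul fun w w' => ?_
  rw [Real.coe_toNNReal _ (by positivity), dist_eq_norm, dist_eq_norm]
  set M := max ‖w‖ ε with hM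
  set M' := max ‖w'‖ ε with hM'
  have h1 : ε ≤ M := le_max_right _ _
  have h2 : ε ≤ M' := le_max_right _ _
  have hM0 : 0 < M := by linarith
  have hM0' : 0 < M' := by linarith
  have key : ‖regCauchy ε w - regCauchy ε w'‖ ≤ ‖w - w'‖ / (M * M') := by
    have e : regCauchy ε w - regCauchy ε w' = starRingEnd ℂ (w / (M : ℂ) ^ 2 - w' / (M' : ℂ) ^ 2) := by
      simp [regCauchy, hM, hM']
    rw [e, Complex.norm_conj]
    refine (pow_le_pow_iff_left₀ (norm_nonneg _) (by positivity) two_ne_zero).1 ?_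
    rw [div_pow, ← normSq_eq_norm_sq, ← normSq_eq_norm_sq]
    have ha : w.re ^ 2 + w.im ^ 2 = ‖w‖ ^ 2 := by rw [← normSq_eq_norm_sq, normSq_apply]; ring
    have hb : w'.re ^ 2 + w'.im ^ 2 = ‖w'‖ ^ 2 := by rw [← normSq_eq_norm_sq, normSq_apply]; ring
    -- `M` and `|w| / M` are both nondecreasing functions of `|w|`
    have hsign : (1 / M ^ 2 - 1 / M' ^ 2) * (‖w‖ ^ 2 / M ^ 2 - ‖w'‖ ^ 2 / M' ^ 2) ≤ 0 := by
      have hl (x : ℝ) (hx : 0 ≤ x) : x ^ 2 / (max x ε) ^ 2 ≤ 1 := by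
        rw [div_le_one (by positivity)]; gcongr; exact le_max_left _ _
      have hq (x y : ℝ) (h : max x ε < max y ε) : y ^ 2 / (max y ε) ^ 2 = 1 := by
        have : ε < y := by
          by_contra h'
          rw [max_eq_right (not_lt.1 h')] at h
          exact absurd (le_max_right x ε) (not_le.2 h)
        have hy : 0 < y := hε.trans this
        rw [max_eq_left this.le, div_self (by positivity)]
      rcases lt_trichotomy M M' with h | h | h
      · rw [hq _ _ h]
        refine mul_nonpos_of_nonneg_of_nonpos ?_ (by linarith [hl ‖w‖ (norm_nonneg _)])
        rw [sub_nonneg]; gcongr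
      · rw [h]; simp
      · rw [hq _ _ h]
        refine mul_nonpos_of_nonpos_of_nonneg ?_ (by linarith [hl ‖w'‖ (norm_nonneg _)])
        rw [sub_nonpos]; gcongr
    have e1 : normSq (w / (M : ℂ) ^ 2 - w' / (M' : ℂ) ^ 2)
        = (w.re / M ^ 2 - w'.re / M' ^ 2) ^ 2 + (w.im / M ^ 2 - w'.im / M' ^ 2) ^ 2 := by
      rw [normSq_apply, ← ofReal_pow, ← ofReal_pow, sub_re, sub_im, div_ofReal_re, div_ofReal_re,
        div_ofReal_im, div_ofReal_im]
      ring
    have e2 : normSq (w - w') = (w.re - w'.re) ^ 2 + (w.im - w'.im) ^ 2 := by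
      rw [normSq_apply]; simp; ring
    rw [e1, e2]
    have e3 : (w.re / M ^ 2 - w'.re / M' ^ 2) ^ 2 + (w.im / M ^ 2 - w'.im / M' ^ 2) ^ 2
        = ((w.re - w'.re) ^ 2 + (w.im - w'.im) ^ 2) / (M * M') ^ 2
          + (1 / M ^ 2 - 1 / M' ^ 2) * (‖w‖ ^ 2 / M ^ 2 - ‖w'‖ ^ 2 / M' ^ 2) := by
      rw [← ha, ← hb]; field_simp; ring
    linarith
  refine key.trans ?_
  rw [div_eq_mul_inv, mul_comm, ← one_div]
  gcongr
  nlinarith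

/-- The line derivative of `regCauchy ε` in the direction `v`, off the circle `|w| = ε`. -/
noncomputable def regCauchyDeriv (ε : ℝ) (v w : ℂ) : ℂ :=
  if ‖w‖ ≤ ε then starRingEnd ℂ v / (ε : ℂ) ^ 2 else -v / w ^ 2

lemma hasLineDerivAt_regCauchy {ε : ℝ} (hε : 0 < ε) (v : ℂ) :
    ∀ᵐ w, HasLineDerivAt ℝ (regCauchy ε) (regCauchyDeriv ε v w) w v := by
  have hs : volume (Metric.sphere (0 : ℂ) ε) = 0 := Measure.addHaar_sphere _ _ _
  filter_upwards [measure_eq_zero_iff_ae_notMem.1 hs] with w hw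
  have hne : ‖w‖ ≠ ε := by simpa using hw
  rcases lt_or_gt_of_ne hne with h | h
  · rw [regCauchyDeriv, if_pos h.le]
    have h1 : HasFDerivAt (fun w : ℂ => starRingEnd ℂ w / (ε : ℂ) ^ 2) _ w :=
      ((Complex.conjCLE : ℂ →L[ℝ] ℂ).hasFDerivAt (x := w)).mul_const (((ε : ℂ) ^ 2)⁻¹)
    have h2 : regCauchy ε =ᶠ[𝓝 w] fun w : ℂ => starRingEnd ℂ w / (ε : ℂ) ^ 2 := by
      filter_upwards [(isOpen_lt continuous_norm continuous_const).mem_nhds h] with x hx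
      exact regCauchy_of_le (le_of_lt hx)
    have h3 := (h1.congr_of_eventuallyEq h2).hasLineDerivAt v
    simpa [div_eq_inv_mul] using h3
  · rw [regCauchyDeriv, if_neg (not_le.2 h)]
    have hw0 : w ≠ 0 := norm_pos_iff.1 (hε.trans h)
    have h1 : HasFDerivAt (fun w : ℂ => w⁻¹) _ w :=
      ((hasDerivAt_inv hw0).hasFDerivAt.restrictScalars ℝ)
    have h2 : regCauchy ε =ᶠ[𝓝 w] fun w : ℂ => w⁻¹ := by
      filter_upwards [(isOpen_lt continuous_const continuous_norm).mem_nhds h] with x hx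
      exact regCauchy_of_ge (le_of_lt hx)
    have h3 := (h1.congr_of_eventuallyEq h2).hasLineDerivAt v
    simpa [div_eq_mul_inv] using h3

lemma integrable_regCauchyDeriv_mul {ε : ℝ} (hε : 0 < ε) (v : ℂ) {g : ℂ → ℂ} (hg : IsTest g) :
    Integrable fun w => regCauchyDeriv ε v w * g w := by
  refine hg.integrable.bdd_mul (c := ‖v‖ / ε ^ 2) ?_ (Eventually.of_forall fun w => ?_)
  · refine Measurable.aestronglyMeasurable ?_
    exact Measurable.ite (measurableSet_le measurable_norm measurable_const) measurable_const
      (by fun_prop)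
  · rw [regCauchyDeriv]
    split_ifs with h
    · simp
    · have h := (not_le.1 h).le
      simp only [norm_div, norm_neg, norm_pow]
      gcongr

lemma integral_regCauchy_mul_dz {ε : ℝ} (hε : 0 < ε) {g : ℂ → ℂ} (hg : IsTest g) :
    ∫ w, regCauchy ε w * dz g w = ∫ w in {w : ℂ | ε < ‖w‖}, g w / w ^ 2 := by
  have hL := (lipschitzWith_regCauchy hε)
  have i (v : ℂ) : Integrable fun w => regCauchy ε w * fderiv ℝ g w v :=
    Continuous.integrable_of_hasCompactSupport (hL.continuous.mul (hg.fderiv_apply v).continuous)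
      (hg.fderiv_apply v).2.mul_left
  have e : ∫ w, regCauchy ε w * dz g w = ((∫ w, regCauchy ε w * fderiv ℝ g w 1)
      - I * ∫ w, regCauchy ε w * fderiv ℝ g w I) / 2 := by
    rw [← integral_const_mul, ← integral_sub (i 1) ((i I).const_mul I), ← integral_div]
    congr 1; ext z; simp only [dz]; ring
  have j (v : ℂ) := integrable_regCauchyDeriv_mul hε v hg
  have j' (v : ℂ) : Integrable fun w => -(regCauchyDeriv ε v w * g w) := (j v).neg
  rw [e, integral_lipschitz_mul_fderiv hL hg 1 (hasLineDerivAt_regCauchy hε 1),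
    integral_lipschitz_mul_fderiv hL hg I (hasLineDerivAt_regCauchy hε I), ← integral_neg,
    ← integral_neg, ← integral_const_mul, ← integral_sub (j' 1) ((j' I).const_mul I),
    ← integral_div, ← integral_indicator (measurableSet_lt measurable_const measurable_norm)]
  congr 1; ext w
  have hI : I * I = -1 := I_mul_I
  by_cases h : ‖w‖ ≤ ε
  · rw [Set.indicator_of_notMem (by simpa using h)]
    simp only [regCauchyDeriv, if_pos h, map_one, conj_I]
    linear_combination (-g w / (2 * (ε : ℂ) ^ 2)) * hI
  · rw [Set.indicator_of_mem (by simpa using h)]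
    simp only [regCauchyDeriv, if_neg h]
    linear_combination (-g w / (2 * w ^ 2)) * hI

lemma integral_regCauchy_mul_dzb {ε : ℝ} (hε : 0 < ε) {g : ℂ → ℂ} (hg : IsTest g) :
    ∫ w, regCauchy ε w * dzb g w = -(1 / (ε : ℂ) ^ 2 * ∫ w in Metric.closedBall 0 ε, g w) := by
  have hL := (lipschitzWith_regCauchy hε)
  have i (v : ℂ) : Integrable fun w => regCauchy ε w * fderiv ℝ g w v :=
    Continuous.integrable_of_hasCompactSupport (hL.continuous.mul (hg.fderiv_apply v).continuous)
      (hg.fderiv_apply v).2.mul_left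
  have e : ∫ w, regCauchy ε w * dzb g w = ((∫ w, regCauchy ε w * fderiv ℝ g w 1)
      + I * ∫ w, regCauchy ε w * fderiv ℝ g w I) / 2 := by
    rw [← integral_const_mul, ← integral_add (i 1) ((i I).const_mul I), ← integral_div]
    congr 1; ext z; simp only [dzb]; ring
  have j (v : ℂ) := integrable_regCauchyDeriv_mul hε v hg
  have j' (v : ℂ) : Integrable fun w => -(regCauchyDeriv ε v w * g w) := (j v).neg
  rw [e, integral_lipschitz_mul_fderiv hL hg 1 (hasLineDerivAt_regCauchy hε 1),
    integral_lipschitz_mul_fderiv hL hg I (hasLineDerivAt_regCauchy hε I), ← integral_neg,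
    ← integral_neg, ← integral_const_mul, ← integral_add (j' 1) ((j' I).const_mul I),
    ← integral_div, ← integral_indicator measurableSet_closedBall, ← neg_mul, ← integral_const_mul]
  congr 1; ext w
  have hI : I * I = -1 := I_mul_I
  by_cases h : ‖w‖ ≤ ε
  · rw [Set.indicator_of_mem (by simpa using h)]
    simp only [regCauchyDeriv, if_pos h, map_one, conj_I]
    linear_combination (g w / (2 * (ε : ℂ) ^ 2)) * hI
  · rw [Set.indicator_of_notMem (by simpa using h)]
    simp only [regCauchyDeriv, if_neg h]
    linear_combination (g w / (2 * w ^ 2)) * hI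

/-- The average of `F` over the closed disc of radius `ε` about `z`. -/
noncomputable def ballAvg (F : ℂ → ℂ) (z : ℂ) (ε : ℝ) : ℂ :=
  1 / ((Real.pi : ℂ) * (ε : ℂ) ^ 2) * ∫ w in Metric.closedBall z ε, F w

lemma ballAvg_eq_average (F : ℂ → ℂ) (z : ℂ) {ε : ℝ} (hε : 0 < ε) :
    ballAvg F z ε = ⨍ w in Metric.closedBall z ε, F w := by
  have hv : volume.real (Metric.closedBall z ε) = Real.pi * ε ^ 2 := by
    rw [Measure.real, Complex.volume_closedBall]; simp [hε.le, mul_comm]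
  rw [setAverage_eq, hv, ballAvg, real_smul]
  push_cast; ring

lemma tendsto_ballAvg {F : ℂ → ℂ} (hF : Continuous F) (z : ℂ) :
    Tendsto (ballAvg F z) (𝓝[>] 0) (𝓝 (F z)) := by
  rw [Metric.tendsto_nhds]
  intro η hη
  obtain ⟨δ, hδ, h⟩ := Metric.continuousAt_iff.1 hF.continuousAt (η / 2) (by positivity)
  filter_upwards [Ioo_mem_nhdsGT hδ] with ε hε
  have hv : volume.real (Metric.closedBall z ε) = Real.pi * ε ^ 2 := by
    rw [Measure.real, Complex.volume_closedBall]; simp [hε.1.le, mul_comm]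
  have hpos : 0 < Real.pi * ε ^ 2 := by have := Real.pi_pos; have := hε.1; positivity
  have hvol : volume (Metric.closedBall z ε) < ⊤ := measure_closedBall_lt_top
  have hint : IntegrableOn F (Metric.closedBall z ε) :=
    hF.continuousOn.integrableOn_compact (isCompact_closedBall _ _)
  have e : ballAvg F z ε - F z
      = 1 / ((Real.pi : ℂ) * (ε : ℂ) ^ 2) * ∫ w in Metric.closedBall z ε, (F w - F z) := by
    rw [integral_sub hint (integrableOn_const hvol.ne), setIntegral_const, hv, ballAvg, real_smul,
      mul_sub]
    congr 1
    have h1 : (Real.pi : ℂ) * (ε : ℂ) ^ 2 ≠ 0 := by exact_mod_cast hpos.ne'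
    push_cast
    rw [one_div, inv_mul_cancel_left₀ h1]
  rw [dist_eq_norm, e, norm_mul]
  have h2 : ‖∫ w in Metric.closedBall z ε, (F w - F z)‖ ≤ η / 2 * (Real.pi * ε ^ 2) := by
    rw [← hv]
    refine norm_setIntegral_le_of_norm_le_const hvol fun w hw => ?_
    rw [← dist_eq_norm]
    exact (h ((Metric.mem_closedBall.1 hw).trans_lt hε.2)).le
  have h3 : ‖1 / ((Real.pi : ℂ) * (ε : ℂ) ^ 2)‖ = 1 / (Real.pi * ε ^ 2) := by
    rw [← ofReal_pow, ← ofReal_mul, norm_div, norm_real, Real.norm_of_nonneg hpos.le, norm_one]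
  rw [h3]
  calc 1 / (Real.pi * ε ^ 2) * ‖∫ w in Metric.closedBall z ε, (F w - F z)‖
      ≤ 1 / (Real.pi * ε ^ 2) * (η / 2 * (Real.pi * ε ^ 2)) := by gcongr
    _ = η / 2 := by rw [one_div, mul_comm, mul_inv_cancel_right₀ hpos.ne']
    _ < η := by linarith

lemma truncBeurling_eq (ε : ℝ) (v : ℂ → ℂ) (z : ℂ) : truncBeurling ε v z
    = -(1 / (Real.pi : ℂ)) * ∫ w in {w : ℂ | ε < ‖w‖}, v (z - w) / w ^ 2 := by
  rw [truncBeurling]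
  congr 1
  rw [← integral_indicator (measurableSet_lt measurable_const (by fun_prop)),
    ← integral_indicator (measurableSet_lt measurable_const measurable_norm),
    ← integral_sub_left_eq_self _ volume z]
  congr 1; ext w
  simp only [Set.indicator_apply, Set.mem_ofPred_eq, sub_sub_cancel]

/-- The truncated Beurling transform of `∂̄u` is exactly the average of `∂u` over the disc that is
cut out. -/
lemma truncBeurling_dzb {u : ℂ → ℂ} (hu : IsTest u) (z : ℂ) {ε : ℝ} (hε : 0 < ε) :
    truncBeurling ε (dzb u) z = ballAvg (dz u) z ε := by
  have h1 : IsTest fun w => dzb u (z - w) := (isTest_dzb hu).comp_sub_left z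
  have h2 : IsTest fun w => dz u (z - w) := (isTest_dz hu).comp_sub_left z
  have e : dz (fun w => dzb u (z - w)) = dzb fun w => dz u (z - w) := by
    ext w
    rw [dz_comp_sub_left z ((isTest_dzb hu).differentiable _),
      dzb_comp_sub_left z ((isTest_dz hu).differentiable _), dz_dzb_comm hu.1]
  have e2 : ∫ w in Metric.closedBall z ε, dz u w = ∫ w in Metric.closedBall 0 ε, dz u (z - w) := by
    rw [← integral_indicator measurableSet_closedBall, ← integral_indicator measurableSet_closedBall,
      ← integral_sub_left_eq_self _ volume z]
    congr 1; ext w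
    by_cases h : ‖w‖ ≤ ε
    · rw [Set.indicator_of_mem, Set.indicator_of_mem] <;> simpa [dist_eq_norm] using h
    · rw [Set.indicator_of_notMem, Set.indicator_of_notMem] <;> simpa [dist_eq_norm] using h
  rw [truncBeurling_eq, ← integral_regCauchy_mul_dz hε h1, e, integral_regCauchy_mul_dzb hε h2, ← e2,
    ballAvg]
  ring

/-- The Cauchy–Pompeiu formula for test functions. -/
lemma integral_dzb_div {g : ℂ → ℂ} (hg : IsTest g) :
    ∫ w, dzb g w / w = -((Real.pi : ℂ) * g 0) := by
  have hint : Integrable fun w => ‖dzb g w‖ * ‖w‖⁻¹ := by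
    have hl : LocallyIntegrable (fun w : ℂ => ‖w‖⁻¹) := by
      refine locallyIntegrable_of_norm_le_rpow (C := 1) (α := 1) (by simp) (by simp)
        (Eventually.of_forall fun w => ?_) (by fun_prop)
      rw [Real.rpow_neg_one, norm_inv, norm_norm, one_mul]
    have := hl.integrable_smul_left_of_hasCompactSupport (isTest_dzb hg).continuous.norm
      (isTest_dzb hg).2.norm
    exact this
  have t1 : Tendsto (fun ε : ℝ => ∫ w, regCauchy ε w * dzb g w) (𝓝[>] 0)
      (𝓝 (∫ w, dzb g w / w)) := by
    refine tendsto_integral_filter_of_dominated_convergence _ ?_ ?_ hint ?_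
    · filter_upwards [self_mem_nhdsWithin] with ε (hε : 0 < ε)
      exact ((lipschitzWith_regCauchy hε).continuous.mul
        (isTest_dzb hg).continuous).aestronglyMeasurable
    · filter_upwards [self_mem_nhdsWithin] with ε (hε : 0 < ε)
      refine Eventually.of_forall fun w => ?_
      rw [norm_mul, mul_comm]
      gcongr
      rcases eq_or_ne w 0 with rfl | hw
      · simp [regCauchy]
      have hw' := norm_pos_iff.2 hw
      rw [regCauchy, norm_div, Complex.norm_conj, norm_pow, norm_real,
        Real.norm_of_nonneg (by positivity), div_le_iff₀ (by positivity), inv_mul_eq_div,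
        le_div_iff₀ hw', ← pow_two]
      gcongr
      exact le_max_left _ _
    · refine (Measure.ae_ne volume (0 : ℂ)).mono fun w hw => ?_
      refine tendsto_const_nhds.congr' ?_
      filter_upwards [Ioo_mem_nhdsGT (norm_pos_iff.2 hw)] with ε hε
      rw [regCauchy_of_ge hε.2.le, div_eq_inv_mul]
  have t2 : Tendsto (fun ε : ℝ => ∫ w, regCauchy ε w * dzb g w) (𝓝[>] 0)
      (𝓝 (-((Real.pi : ℂ) * g 0))) := by
    refine (((tendsto_ballAvg hg.continuous 0).const_mul (Real.pi : ℂ)).neg).congr' ?_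
    filter_upwards [self_mem_nhdsWithin] with ε (hε : 0 < ε)
    rw [integral_regCauchy_mul_dzb hε hg, ballAvg]
    have : (Real.pi : ℂ) ≠ 0 := by exact_mod_cast Real.pi_ne_zero
    have : (ε : ℂ) ≠ 0 := by exact_mod_cast hε.ne'
    field_simp
  exact tendsto_nhds_unique t1 t2

lemma locallyIntegrable_inv : LocallyIntegrable fun w : ℂ => w⁻¹ := by
  refine locallyIntegrable_of_norm_le_rpow (C := 1) (α := 1) (by simp) (by simp)
    (Eventually.of_forall fun w => ?_) (by fun_prop)
  rw [Real.rpow_neg_one]; simp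

/-- The Cauchy transform `π⁻¹ ∫ f(z - w) / w dw`. -/
noncomputable def cauchyTransform (f : ℂ → ℂ) (z : ℂ) : ℂ := 1 / (Real.pi : ℂ) * ∫ w, f (z - w) / w

section cauchyTransform

open scoped Convolution

variable {f : ℂ → ℂ} (hf : IsTest f)

lemma cauchyTransform_eq_convolution (f : ℂ → ℂ) (z : ℂ) : cauchyTransform f z
    = 1 / (Real.pi : ℂ) * ((fun w : ℂ => w⁻¹) ⋆[ContinuousLinearMap.mul ℝ ℂ] f) z := by
  rw [cauchyTransform, convolution_def]
  congr 2; ext w; rw [ContinuousLinearMap.mul_apply', div_eq_inv_mul]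

lemma cauchyTransform_eq (f : ℂ → ℂ) (z : ℂ) :
    cauchyTransform f z = 1 / (Real.pi : ℂ) * ∫ y, f y / (z - y) := by
  rw [cauchyTransform, ← integral_sub_left_eq_self _ volume z]
  simp

include hf

lemma contDiff_cauchyTransform : ContDiff ℝ ∞ (cauchyTransform f) := by
  have : cauchyTransform f = fun z =>
      1 / (Real.pi : ℂ) * ((fun w : ℂ => w⁻¹) ⋆[ContinuousLinearMap.mul ℝ ℂ] f) z :=
    funext fun z => cauchyTransform_eq_convolution f z
  rw [this]
  exact contDiff_const.mul (hf.2.contDiff_convolution_right _ locallyIntegrable_inv hf.1)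

lemma fderiv_cauchyTransform (z v : ℂ) :
    fderiv ℝ (cauchyTransform f) z v = cauchyTransform (fun w => fderiv ℝ f w v) z := by
  have : cauchyTransform f = fun z =>
      1 / (Real.pi : ℂ) * ((fun w : ℂ => w⁻¹) ⋆[ContinuousLinearMap.mul ℝ ℂ] f) z :=
    funext fun z => cauchyTransform_eq_convolution f z
  have h := (hf.2.hasFDerivAt_convolution_right (ContinuousLinearMap.mul ℝ ℂ)
    locallyIntegrable_inv (hf.1.of_le (by norm_cast)) z).const_mul (1 / (Real.pi : ℂ))
  rw [this, h.fderiv, cauchyTransform_eq_convolution]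
  simp only [smul_apply, smul_eq_mul]
  congr 1
  exact convolution_precompR_apply _ locallyIntegrable_inv (hf.2.fderiv (𝕜 := ℝ))
    (hf.1.continuous_fderiv (by simp)) z v

lemma integrable_comp_sub_div (z : ℂ) : Integrable fun w => f (z - w) / w := by
  have := locallyIntegrable_inv.integrable_smul_left_of_hasCompactSupport
    (hf.comp_sub_left z).continuous (hf.comp_sub_left z).2
  simpa [div_eq_mul_inv] using this

lemma dz_cauchyTransform (z : ℂ) : dz (cauchyTransform f) z = cauchyTransform (dz f) z := by
  have h (v : ℂ) := integrable_comp_sub_div (hf.fderiv_apply v) z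
  rw [dz, fderiv_cauchyTransform hf, fderiv_cauchyTransform hf]
  simp only [cauchyTransform]
  have e : ∫ w, dz f (z - w) / w = ((∫ w, fderiv ℝ f (z - w) 1 / w)
      - I * ∫ w, fderiv ℝ f (z - w) I / w) / 2 := by
    rw [← integral_const_mul, ← integral_sub (h 1) ((h I).const_mul I), ← integral_div]
    congr 1; ext w; simp only [dz]; ring
  rw [e]; ring

lemma integral_dzb_comp_sub_div (z : ℂ) : ∫ w, dzb f (z - w) / w = (Real.pi : ℂ) * f z := by
  have := integral_dzb_div (hf.comp_sub_left z)
  simp only [sub_zero] at this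
  rw [← neg_inj, ← this, ← integral_neg]
  congr 1; ext w
  rw [dzb_comp_sub_left z (hf.differentiable _)]; ring

lemma cauchyTransform_dzb : cauchyTransform (dzb f) = f := by
  ext z
  have hpi : (Real.pi : ℂ) ≠ 0 := by exact_mod_cast Real.pi_ne_zero
  rw [cauchyTransform, integral_dzb_comp_sub_div hf]; field_simp

lemma dzb_cauchyTransform (z : ℂ) : dzb (cauchyTransform f) z = f z := by
  have h (v : ℂ) := integrable_comp_sub_div (hf.fderiv_apply v) z
  have e : ∫ w, dzb f (z - w) / w = ((∫ w, fderiv ℝ f (z - w) 1 / w)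
      + I * ∫ w, fderiv ℝ f (z - w) I / w) / 2 := by
    rw [← integral_const_mul, ← integral_add (h 1) ((h I).const_mul I), ← integral_div]
    congr 1; ext w; simp only [dzb]; ring
  have hpi : (Real.pi : ℂ) ≠ 0 := by exact_mod_cast Real.pi_ne_zero
  rw [dzb, fderiv_cauchyTransform hf, fderiv_cauchyTransform hf]
  simp only [cauchyTransform]
  have e3 := (integral_dzb_comp_sub_div hf z).symm.trans e
  field_simp
  linear_combination -2 * e3

lemma exists_norm_cauchyTransform_le :
    ∃ A C : ℝ, 0 < A ∧ 0 ≤ C ∧ ∀ z, A ≤ ‖z‖ → ‖cauchyTransform f z‖ ≤ C / ‖z‖ := by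
  obtain ⟨R, hR, hR0⟩ := hf.exists_radius
  have hpi := Real.pi_pos
  refine ⟨2 * R, 1 / Real.pi * (2 * ∫ y, ‖f y‖), by positivity, by positivity, fun z hz => ?_⟩
  rw [cauchyTransform_eq f, norm_mul, mul_div_assoc, norm_div, norm_one, norm_real,
    Real.norm_of_nonneg hpi.le]
  gcongr
  rw [mul_div_assoc, mul_comm, div_mul_eq_mul_div, mul_div_assoc, ← integral_mul_const]
  refine norm_integral_le_of_norm_le (hf.integrable.norm.mul_const _) (Eventually.of_forall fun y => ?_)
  by_cases hy : f y = 0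
  · simp [hy]
  have hy' : ‖y‖ ≤ R := by by_contra h; exact hy (hR0 y (not_le.1 h))
  have hz0 : 0 < ‖z‖ := by linarith
  rw [norm_div, div_eq_mul_inv]
  gcongr
  rw [inv_le_comm₀ (by have := norm_sub_norm_le z y; linarith) (by positivity), inv_div]
  have := norm_sub_norm_le z y
  linarith

/-- The decay is quadratic because `∂f` has mean zero. -/
lemma exists_norm_dz_cauchyTransform_le :
    ∃ A C : ℝ, 0 < A ∧ 0 ≤ C ∧ ∀ z, A ≤ ‖z‖ → ‖dz (cauchyTransform f) z‖ ≤ C / ‖z‖ ^ 2 := by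
  have hh := isTest_dz hf
  obtain ⟨R, hR, hR0⟩ := hh.exists_radius
  have hpi := Real.pi_pos
  have hint0 : ∫ y, dz f y = 0 := by
    have := integral_mul_dz (f := fun _ => 1) contDiff_const hf
    simpa [dz] using this
  refine ⟨2 * R, 1 / Real.pi * (2 * R * ∫ y, ‖dz f y‖), by positivity, by positivity, fun z hz => ?_⟩
  have hz0 : 0 < ‖z‖ := by linarith
  have hzne := norm_pos_iff.1 hz0
  have hi : Integrable fun y => dz f y / (z - y) := by
    have := (integrable_comp_sub_div hh z).comp_sub_left z
    simpa using this
  have e : ∫ y, dz f y / (z - y) = ∫ y, dz f y * (y / ((z - y) * z)) := by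
    have : ∫ y, dz f y * (y / ((z - y) * z)) = (∫ y, dz f y / (z - y)) - ∫ y, dz f y * z⁻¹ := by
      rw [← integral_sub hi (hh.integrable.mul_const _)]
      congr 1; ext y
      by_cases hy : dz f y = 0
      · simp [hy]
      have hy' : ‖y‖ ≤ R := by by_contra h; exact hy (hR0 y (not_le.1 h))
      have hzy : z - y ≠ 0 := by
        rw [← norm_pos_iff]; have := norm_sub_norm_le z y; linarith
      field_simp; ring
    rw [this, integral_mul_const, hint0]; simp
  rw [dz_cauchyTransform hf, cauchyTransform_eq, e, norm_mul, mul_div_assoc, norm_div, norm_one,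
    norm_real, Real.norm_of_nonneg hpi.le]
  gcongr
  rw [mul_comm (2 * R), mul_div_assoc, ← integral_mul_const]
  refine norm_integral_le_of_norm_le (hh.integrable.norm.mul_const _) (Eventually.of_forall fun y => ?_)
  by_cases hy : dz f y = 0
  · simp [hy]
  have hy' : ‖y‖ ≤ R := by by_contra h; exact hy (hR0 y (not_le.1 h))
  have hzy : ‖z‖ / 2 ≤ ‖z - y‖ := by have := norm_sub_norm_le z y; linarith
  have h0 : 0 < ‖z - y‖ := by linarith
  rw [norm_mul, norm_div, norm_mul]
  refine mul_le_mul_of_nonneg_left ?_ (norm_nonneg _)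
  rw [div_le_div_iff₀ (by positivity) (by positivity)]
  nlinarith [norm_nonneg y, mul_nonneg (norm_nonneg y) (sub_nonneg.2 hzy),
    mul_le_mul_of_nonneg_right hy' (mul_nonneg (norm_nonneg (z - y)) hz0.le)]

end cauchyTransform

/-! ### Radially modulated kernels and the `L^r` bound for `r ≤ 2` -/

/-- The integrand of the principal value integral `p.v. ∫ f(z - w) / w² dw` after subtraction of
the mean-zero kernel on the unit disc. -/
noncomputable def subtractedKernel (f : ℂ → ℂ) (z w : ℂ) : ℂ :=
  (f (z - w) - (Metric.ball (0 : ℂ) 1).indicator (fun _ => f z) w) / w ^ 2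

lemma integrable_subtractedKernel {f : ℂ → ℂ} (hf : IsTest f) (z : ℂ) :
    Integrable (subtractedKernel f z) := by
  obtain ⟨D, hD⟩ := hf.1.lipschitzWith_of_hasCompactSupport hf.2 (by simp)
  have hl : LocallyIntegrable (fun w : ℂ => ‖w‖⁻¹) := by
    refine locallyIntegrable_of_norm_le_rpow (C := 1) (α := 1) (by simp) (by simp)
      (Eventually.of_forall fun w => ?_) (by fun_prop)
    rw [Real.rpow_neg_one, norm_inv, norm_norm, one_mul]
  have h1 : Integrable ((Metric.closedBall (0 : ℂ) 1).indicator fun w : ℂ => ‖w‖⁻¹) :=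
    (hl.integrableOn_isCompact (isCompact_closedBall _ _)).integrable_indicator
      measurableSet_closedBall
  refine ((h1.const_mul D).add (hf.comp_sub_left z).integrable.norm).mono' ?_ ?_
  · have := hf.continuous
    refine AEMeasurable.aestronglyMeasurable ?_
    refine AEMeasurable.div (AEMeasurable.sub (by fun_prop) ?_) (by fun_prop)
    exact (measurable_const.indicator measurableSet_ball).aemeasurable
  · refine Eventually.of_forall fun w => ?_
    simp only [subtractedKernel, Pi.add_apply]
    by_cases hw : ‖w‖ < 1
    · rw [Set.indicator_of_mem (by simpa using hw), Set.indicator_of_mem (by simpa using hw.le)]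
      refine le_trans ?_ (le_add_of_nonneg_right (norm_nonneg _))
      rcases eq_or_ne w 0 with rfl | hw0
      · simp
      have hn := norm_pos_iff.2 hw0
      rw [norm_div, norm_pow, div_le_iff₀ (by positivity)]
      have := hD.norm_sub_le (z - w) z
      rw [sub_sub_cancel_left, norm_neg] at this
      refine this.trans (le_of_eq ?_)
      field_simp
    · rw [Set.indicator_of_notMem (by simpa using hw)]
      refine le_trans ?_ (le_add_of_nonneg_left (mul_nonneg D.2 (Set.indicator_nonneg (by simp) _)))
      rw [sub_zero, norm_div, norm_pow]
      exact div_le_self (norm_nonneg _) (one_le_pow₀ (not_lt.1 hw))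

/-- The substitution `w ↦ i w` changes the sign of `w²`. No integrability is needed, since the identity
also holds for the default value of the integral. -/
lemma integral_radial_div_sq (a : ℝ → ℂ) : ∫ w : ℂ, a ‖w‖ / w ^ 2 = 0 := by
  have hmp : MeasurePreserving (fun w : ℂ => I * w) := by
    exact (rotation ⟨I, by simp [Submonoid.unitSphere]⟩).measurePreserving
  have hme : MeasurableEmbedding (fun w : ℂ => I * w) :=
    (Homeomorph.mulLeft₀ I I_ne_zero).measurableEmbedding
  have h := hmp.integral_comp hme fun w => a ‖w‖ / w ^ 2
  have e (w : ℂ) : a ‖I * w‖ / (I * w) ^ 2 = -(a ‖w‖ / w ^ 2) := by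
    rw [norm_mul, norm_I, one_mul, mul_pow, I_sq]; ring
  simp_rw [e] at h
  rw [integral_neg] at h
  exact self_eq_neg.1 h.symm

lemma integral_radial_mul {f : ℂ → ℂ} (hf : IsTest f) (z : ℂ) {a : ℝ → ℂ} (ha : Measurable a)
    {M C : ℝ} (hM : ∀ ρ, ‖a ρ‖ ≤ M) (hC : ∀ ρ, ‖a ρ‖ ≤ C * ρ ^ 2) :
    ∫ w, a ‖w‖ / w ^ 2 * f (z - w) = ∫ w, a ‖w‖ * subtractedKernel f z w := by
  have i1 : Integrable fun w => a ‖w‖ * subtractedKernel f z w :=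
    (integrable_subtractedKernel hf z).bdd_mul (Measurable.aestronglyMeasurable (by fun_prop))
      (Eventually.of_forall fun w => hM _)
  have i2 : Integrable fun w : ℂ =>
      (Metric.ball (0 : ℝ) 1).indicator (fun ρ => a ρ * f z) ‖w‖ / w ^ 2 := by
    have i3 : Integrable ((Metric.ball (0 : ℂ) 1).indicator fun _ : ℂ => C * ‖f z‖) :=
      (integrableOn_const (by finiteness)).integrable_indicator measurableSet_ball
    refine i3.mono' ?_ ?_
    · refine AEMeasurable.aestronglyMeasurable (AEMeasurable.div ?_ (by fun_prop))
      have : Measurable ((Metric.ball (0 : ℝ) 1).indicator (fun ρ => a ρ * f z)) :=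
        (by fun_prop : Measurable fun ρ => a ρ * f z).indicator measurableSet_ball
      fun_prop
    · refine Eventually.of_forall fun w => ?_
      by_cases hw : ‖w‖ < 1
      · rw [Set.indicator_of_mem (by simpa using hw), Set.indicator_of_mem (by simpa using hw)]
        rcases eq_or_ne w 0 with rfl | hw0
        · have : a 0 = 0 := by have := hC 0; simpa using this
          simp [this]
          have := (norm_nonneg _).trans (hC 1)
          have h0 : 0 ≤ C := by simpa using this
          positivity
        have hn := norm_pos_iff.2 hw0
        rw [norm_div, norm_mul, norm_pow, div_le_iff₀ (by positivity)]
        nlinarith [hC ‖w‖, norm_nonneg (f z)]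
      · rw [Set.indicator_of_notMem (by simpa using hw), Set.indicator_of_notMem (by simpa using hw)]
        simp
  have e : ∀ w, a ‖w‖ / w ^ 2 * f (z - w) = a ‖w‖ * subtractedKernel f z w
      + (Metric.ball (0 : ℝ) 1).indicator (fun ρ => a ρ * f z) ‖w‖ / w ^ 2 := by
    intro w
    rw [subtractedKernel]
    by_cases hw : ‖w‖ < 1
    · rw [Set.indicator_of_mem (by simpa using hw), Set.indicator_of_mem (by simpa using hw)]
      ring
    · rw [Set.indicator_of_notMem (by simpa using hw), Set.indicator_of_notMem (by simpa using hw)]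
      ring
  simp_rw [e]
  rw [integral_add i1 i2, integral_radial_div_sq, add_zero]

/-- If radial modulations `a_n(|w|)` of the kernel `w⁻²` converge boundedly to a constant `c`, the
corresponding singular integrals converge to `c` times a limit that only depends on `f`. -/
lemma tendsto_integral_radial_mul {ι : Type*} {l : Filter ι} [l.IsCountablyGenerated] {f : ℂ → ℂ}
    (hf : IsTest f) (z : ℂ) {a : ι → ℝ → ℂ} {M : ℝ} {C : ι → ℝ} {c : ℂ}
    (ha : ∀ᶠ n in l, Measurable (a n) ∧ (∀ ρ, ‖a n ρ‖ ≤ M) ∧ ∀ ρ, ‖a n ρ‖ ≤ C n * ρ ^ 2)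
    (hc : ∀ ρ, 0 < ρ → Tendsto (fun n => a n ρ) l (𝓝 c)) :
    Tendsto (fun n => ∫ w, a n ‖w‖ / w ^ 2 * f (z - w)) l (𝓝 (c * ∫ w, subtractedKernel f z w)) := by
  have : Tendsto (fun n => ∫ w, a n ‖w‖ * subtractedKernel f z w) l
      (𝓝 (∫ w, c * subtractedKernel f z w)) := by
    refine tendsto_integral_filter_of_dominated_convergence
      (fun w => M * ‖subtractedKernel f z w‖) ?_ ?_ ?_ ?_
    · filter_upwards [ha] with n hn
      have := hn.1
      exact AEStronglyMeasurable.mul (Measurable.aestronglyMeasurable (by fun_prop))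
        (integrable_subtractedKernel hf z).aestronglyMeasurable
    · filter_upwards [ha] with n hn
      refine Eventually.of_forall fun w => ?_
      rw [norm_mul]
      exact mul_le_mul_of_nonneg_right (hn.2.1 _) (norm_nonneg _)
    · exact (integrable_subtractedKernel hf z).norm.const_mul _
    · filter_upwards [Measure.ae_ne volume (0 : ℂ)] with w hw
      exact (hc _ (norm_pos_iff.2 hw)).mul_const _
  rw [integral_const_mul] at this
  refine this.congr' ?_
  filter_upwards [ha] with n hn
  exact (integral_radial_mul hf z hn.1 hn.2.1 hn.2.2).symm

/-- The constant is found by comparison with the sharp truncations, which are averages of `∂u`. -/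
lemma integral_subtractedKernel_dzb {u : ℂ → ℂ} (hu : IsTest u) (z : ℂ) :
    ∫ w, subtractedKernel (dzb u) z w = -(Real.pi * dz u z) := by
  have hf := isTest_dzb hu
  have t1 := (tendsto_integral_radial_mul (l := 𝓝[>] (0 : ℝ)) hf z
    (a := fun ε => (Set.Ioi ε).indicator fun _ => 1) (M := 1) (C := fun ε => 1 / ε ^ 2) (c := 1)
    (by
      filter_upwards [self_mem_nhdsWithin] with ε (hε : 0 < ε)
      refine ⟨measurable_const.indicator measurableSet_Ioi, fun ρ => ?_, fun ρ => ?_⟩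
      · refine (norm_indicator_le_norm_self _ _).trans (by simp)
      · by_cases hρ : ε < ρ
        · rw [Set.indicator_of_mem (Set.mem_Ioi.2 hρ), norm_one, one_div, inv_mul_eq_div,
            le_div_iff₀ (by positivity)]
          nlinarith
        · rw [Set.indicator_of_notMem (by simpa using hρ)]; simp; positivity)
    (fun ρ hρ => by
      refine tendsto_const_nhds.congr' ?_
      filter_upwards [Ioo_mem_nhdsGT hρ] with ε hε
      rw [Set.indicator_of_mem (by exact hε.2)])).const_mul (-(1 / (Real.pi : ℂ)))
  have t2 := tendsto_ballAvg (isTest_dz hu).continuous z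
  have e := tendsto_nhds_unique (t1.congr' ?_) t2
  · have hpi : (Real.pi : ℂ) ≠ 0 := by exact_mod_cast Real.pi_ne_zero
    rw [← e]; field_simp
  · filter_upwards [self_mem_nhdsWithin] with ε (hε : 0 < ε)
    rw [← truncBeurling_dzb hu z hε, truncBeurling_eq,
      ← integral_indicator (measurableSet_lt measurable_const measurable_norm)]
    congr 2; ext w
    by_cases hw : ε < ‖w‖
    · rw [Set.indicator_of_mem (by exact hw), Set.indicator_of_mem (by exact hw)]; ring
    · rw [Set.indicator_of_notMem (by simpa using hw), Set.indicator_of_notMem (by simpa using hw)]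
      simp

lemma tendsto_integral_averagedPoisson {u : ℂ → ℂ} (hu : IsTest u) (z : ℂ) :
    Tendsto (fun δ : ℝ => ∫ w, averagedPoisson δ (z - w) * dzb u w) (𝓝[>] 0)
      (𝓝 (-(4 * Real.pi ^ 2 * I * dz u z))) := by
  have t := tendsto_integral_radial_mul (l := 𝓝[>] (0 : ℝ)) (isTest_dzb hu) z (a := radialProfile)
    (M := 4 * Real.pi) (C := fun δ => 4 * Real.pi / δ ^ 2) (c := 4 * Real.pi * I)
    (by
      filter_upwards [self_mem_nhdsWithin] with δ (hδ : 0 < δ)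
      exact ⟨(continuous_radialProfile hδ).measurable, fun ρ => (norm_radialProfile_le hδ ρ).1,
        fun ρ => (norm_radialProfile_le hδ ρ).2⟩) (fun ρ hρ => tendsto_radialProfile hρ)
  rw [integral_subtractedKernel_dzb hu] at t
  refine (t.congr' ?_).trans (le_of_eq (by congr 1; ring))
  filter_upwards [self_mem_nhdsWithin] with δ (hδ : 0 < δ)
  rw [← integral_sub_left_eq_self (fun w => averagedPoisson δ (z - w) * dzb u w) volume z]
  refine integral_congr_ae ((Measure.ae_ne volume (0 : ℂ)).mono fun w hw => ?_)
  simp only [sub_sub_cancel]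
  rw [← sq_mul_averagedPoisson hδ]
  field_simp

lemma stronglyMeasurable_integral_averagedPoisson {δ : ℝ} (hδ : 0 < δ) {g : ℂ → ℂ}
    (hg : Continuous g) : StronglyMeasurable fun z => ∫ w, averagedPoisson δ (z - w) * g w := by
  have h : StronglyMeasurable (averagedPoisson δ) := by
    refine StronglyMeasurable.integral_prod_right
      (f := fun (w : ℂ) (θ : ℝ) => exp (-(2 * θ * I)) * rotatedPoisson δ θ w) ?_
    refine (Continuous.mul (by fun_prop) ?_).stronglyMeasurable
    exact (continuous_rotatedPoisson hδ).comp (f := fun p : ℂ × ℝ => (p.2, p.1)) (by fun_prop)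
  refine StronglyMeasurable.integral_prod_right
    (f := fun (z w : ℂ) => averagedPoisson δ (z - w) * g w) ?_
  exact (h.comp_measurable (g := fun p : ℂ × ℂ => p.1 - p.2) (by fun_prop)).mul
    (hg.comp continuous_snd).stronglyMeasurable

/-- The `L^r` bound for the Beurling transform of test functions of the form `∂̄u`, in the range
`1 < r ≤ 2` (method of rotations). -/
lemma exists_lintegral_dz_le {r : ℝ} (hr : 1 < r) (hr2 : r ≤ 2) : ∃ C : ℝ≥0, ∀ u, IsTest u →
    ∫⁻ z, ‖dz u z‖ₑ ^ r ≤ C * ∫⁻ z, ‖dzb u z‖ₑ ^ r := by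
  obtain ⟨C, hC⟩ := exists_averagedPoisson_bound hr hr2
  refine ⟨C, fun u hu => ?_⟩
  have hf := isTest_dzb hu
  set δ : ℕ → ℝ := fun n => 1 / ((n : ℝ) + 1)
  have hδ (n) : 0 < δ n := by positivity
  have hδ0 : Tendsto δ atTop (𝓝[>] 0) := tendsto_nhdsWithin_iff.2
    ⟨tendsto_one_div_add_atTop_nhds_zero_nat, Eventually.of_forall hδ⟩
  have h1 (z : ℂ) : ‖dz u z‖ₑ ^ r ≤ liminf (fun n =>
      ‖∫ w, averagedPoisson (δ n) (z - w) * dzb u w‖ₑ ^ r) atTop := by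
    have t := (((tendsto_integral_averagedPoisson hu z).comp hδ0).enorm).ennrpow_const r
    refine le_trans ?_ (le_of_eq t.liminf_eq.symm)
    gcongr
    rw [enorm_le_iff_norm_le, norm_neg, norm_mul]
    refine le_mul_of_one_le_left (norm_nonneg _) ?_
    -- the limit is `∂u` up to a factor of modulus `4π² ≥ 1`
    have : (1 : ℝ) ≤ 4 * Real.pi ^ 2 := by nlinarith [Real.pi_gt_three]
    rw [norm_mul, norm_I, ← ofReal_pow, ← ofReal_ofNat, ← ofReal_mul, norm_real, mul_one,
      Real.norm_of_nonneg (by linarith)]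
    exact this
  calc ∫⁻ z, ‖dz u z‖ₑ ^ r
      ≤ ∫⁻ z, liminf (fun n => ‖∫ w, averagedPoisson (δ n) (z - w) * dzb u w‖ₑ ^ r) atTop :=
        lintegral_mono h1
    _ ≤ liminf (fun n => ∫⁻ z, ‖∫ w, averagedPoisson (δ n) (z - w) * dzb u w‖ₑ ^ r) atTop := by
        refine lintegral_liminf_le' fun n => ?_
        exact ((stronglyMeasurable_integral_averagedPoisson (hδ n)
          hf.continuous).measurable.enorm.pow_const r).aemeasurable
    _ ≤ C * ∫⁻ z, ‖dzb u z‖ₑ ^ r := by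
        refine liminf_le_of_le (by isBoundedDefault) fun b hb => ?_
        obtain ⟨n, hn⟩ := hb.exists
        exact hn.trans (hC _ hf.continuous hf.2 _ (hδ n))

/-! ### Hölder pairings -/

section holder

variable {α : Type*} [MeasurableSpace α] {μ : Measure α} {p q : ℝ≥0∞} [hpq : p.HolderConjugate q]

lemma enorm_integral_mul_le {f g : α → ℂ} (hf : AEStronglyMeasurable f μ)
    (hg : AEStronglyMeasurable g μ) :
    ‖∫ x, f x * g x ∂μ‖ₑ ≤ eLpNorm f p μ * eLpNorm g q μ := by
  refine (enorm_integral_le_lintegral_enorm _).trans ?_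
  rw [← eLpNorm_one_eq_lintegral_enorm]
  exact eLpNorm_smul_le_mul_eLpNorm (φ := f) (f := g) hg hf

lemma integrable_mul_of_memLp {f g : α → ℂ} (hf : MemLp f p μ) (hg : MemLp g q μ) :
    Integrable (fun x => f x * g x) μ := hf.integrable_mul hg

lemma tendsto_integral_mul {ι : Type*} {l : Filter ι} {f : ι → α → ℂ} {g : ι → α → ℂ}
    {F G : α → ℂ} (hf : ∀ n, MemLp (f n) p μ) (hg : ∀ n, MemLp (g n) q μ) (hF : MemLp F p μ)
    (hG : MemLp G q μ) (hfF : Tendsto (fun n => eLpNorm (f n - F) p μ) l (𝓝 0))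
    (hgG : Tendsto (fun n => eLpNorm (g n - G) q μ) l (𝓝 0)) :
    Tendsto (fun n => ∫ x, f n x * g n x ∂μ) l (𝓝 (∫ x, F x * G x ∂μ)) := by
  have e (n) : (∫ x, f n x * g n x ∂μ) - ∫ x, F x * G x ∂μ
      = (∫ x, (f n - F) x * (g n - G) x ∂μ) + (∫ x, (f n - F) x * G x ∂μ)
        + ∫ x, F x * (g n - G) x ∂μ := by
    have i1 := integrable_mul_of_memLp ((hf n).sub hF) ((hg n).sub hG)
    have i2 := integrable_mul_of_memLp ((hf n).sub hF) hG
    have i3 := integrable_mul_of_memLp hF ((hg n).sub hG)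
    rw [← integral_add i1 i2, ← integral_add (by exact i1.add i2) i3,
      ← integral_sub (integrable_mul_of_memLp (hf n) (hg n)) (integrable_mul_of_memLp hF hG)]
    congr 1; ext x; simp only [Pi.sub_apply]; ring
  rw [tendsto_iff_edist_tendsto_0]
  have hb (n) : edist (∫ x, f n x * g n x ∂μ) (∫ x, F x * G x ∂μ)
      ≤ eLpNorm (f n - F) p μ * eLpNorm (g n - G) q μ + eLpNorm (f n - F) p μ * eLpNorm G q μ
        + eLpNorm F p μ * eLpNorm (g n - G) q μ := by
    rw [edist_eq_enorm_sub, e]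
    have m1 := ((hf n).sub hF).1
    have m2 := ((hg n).sub hG).1
    refine (enorm_add_le _ _).trans (add_le_add ((enorm_add_le _ _).trans (add_le_add ?_ ?_)) ?_)
    · exact enorm_integral_mul_le m1 m2
    · exact enorm_integral_mul_le m1 hG.1
    · exact enorm_integral_mul_le hF.1 m2
  refine tendsto_of_tendsto_of_tendsto_of_le_of_le tendsto_const_nhds ?_ (fun _ => zero_le) hb
  have t1 := ENNReal.Tendsto.mul hfF (Or.inr ENNReal.zero_ne_top) hgG (Or.inr ENNReal.zero_ne_top)
  have t2 := ENNReal.Tendsto.mul_const (b := eLpNorm G q μ) hfF (Or.inr hG.2.ne)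
  have t3 := ENNReal.Tendsto.const_mul (a := eLpNorm F p μ) hgG (Or.inr hF.2.ne)
  simpa using (t1.add t2).add t3

/-- The function `|w|^{P - 2} w̄`, which lies in the dual space when `w ∈ L^P`. -/
noncomputable def dualPower (P : ℝ) (w : α → ℂ) (x : α) : ℂ :=
  ((‖w x‖ ^ (P - 2) : ℝ) : ℂ) * starRingEnd ℂ (w x)

/-- Pairing with `|w|^{p - 2} w̄` computes the `L^p` norm. -/
lemma dualPower_spec {w : α → ℂ} (hw : MemLp w p μ) (hp : 1 < p) (hp' : p ≠ ⊤) :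
    MemLp (dualPower p.toReal w) q μ ∧
      eLpNorm (dualPower p.toReal w) q μ = eLpNorm w p μ ^ (p.toReal - 1) ∧
      ‖∫ x, w x * dualPower p.toReal w x ∂μ‖ₑ = eLpNorm w p μ ^ p.toReal := by
  have hpr : 1 < p.toReal := by
    rw [← ENNReal.toReal_one]; exact (ENNReal.toReal_lt_toReal (by simp) hp').2 hp
  set P := p.toReal with hP
  have hc : P.HolderConjugate q.toReal := ENNReal.HolderConjugate.toReal hpr
  have hq0 : 0 < q.toReal := hc.symm.pos
  have hqt : q ≠ ⊤ := fun h => by simp [h] at hq0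
  have hq0' : q ≠ 0 := fun h => by simp [h] at hq0
  have hp0 : p ≠ 0 := (zero_lt_one.trans hp).ne'
  set g : α → ℂ := dualPower P w with hg
  have hgn (x) : ‖g x‖ = ‖w x‖ ^ (P - 1) := by
    rw [hg]; simp only [dualPower, norm_mul, norm_real, Complex.norm_conj]
    rw [Real.norm_of_nonneg (by positivity)]
    rcases eq_or_ne (w x) 0 with h | h
    · rw [h]; simp [Real.zero_rpow (by linarith : P - 1 ≠ 0)]
    · rw [← Real.rpow_add_one (norm_ne_zero_iff.2 h)]; congr 1; ring
  have hgm : AEStronglyMeasurable g μ := by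
    have := hw.1.aemeasurable
    refine AEMeasurable.aestronglyMeasurable ?_
    exact (Complex.measurable_ofReal.comp_aemeasurable (this.norm.pow_const _)).mul
      (Complex.continuous_conj.measurable.comp_aemeasurable this)
  have hge (x) : ‖g x‖ₑ = ‖w x‖ₑ ^ (P - 1) := by
    rw [← ofReal_norm, hgn, ← ofReal_norm, ENNReal.ofReal_rpow_of_nonneg (norm_nonneg _) (by linarith)]
  have hwL := eLpNorm_eq_lintegral_rpow_enorm_toReal (μ := μ) (f := w) hp0 hp'
  have hwL' : ∫⁻ x, ‖w x‖ₑ ^ P ∂μ = eLpNorm w p μ ^ P := by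
    rw [hwL, ← ENNReal.rpow_mul, one_div, inv_mul_cancel₀ (by positivity), ENNReal.rpow_one]
  have hgL : eLpNorm g q μ = eLpNorm w p μ ^ (P - 1) := by
    rw [eLpNorm_eq_lintegral_rpow_enorm_toReal hq0' hqt]
    have h1 : (P - 1) * q.toReal = P := hc.sub_one_mul_conj
    simp_rw [hge, ← ENNReal.rpow_mul, h1]
    rw [hwL', ← ENNReal.rpow_mul]
    congr 1
    rw [eq_comm, mul_one_div, eq_div_iff hq0.ne']; exact h1
  refine ⟨⟨hgm, ?_⟩, hgL, ?_⟩
  · rw [hgL]; exact ENNReal.rpow_lt_top_of_nonneg (by linarith) hw.2.ne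
  · have e (x) : w x * g x = ((‖w x‖ ^ P : ℝ) : ℂ) := by
      rw [hg, dualPower]
      rw [mul_left_comm, mul_conj, normSq_eq_norm_sq, ← ofReal_mul]
      congr 1
      rcases eq_or_ne (w x) 0 with h | h
      · rw [h]; simp [Real.zero_rpow (by linarith : P ≠ 0)]
      · rw [← Real.rpow_natCast, ← Real.rpow_add (norm_pos_iff.2 h)]; congr 1; push_cast; ring
    simp_rw [e]
    rw [integral_complex_ofReal, ← ofReal_norm, norm_real, Real.norm_of_nonneg (by positivity),
      ofReal_integral_eq_lintegral_ofReal, ← hwL']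
    · congr 1; ext x
      rw [← ofReal_norm, ENNReal.ofReal_rpow_of_nonneg (norm_nonneg _) (by linarith)]
    · exact hw.integrable_norm_rpow hp0 hp'
    · exact Eventually.of_forall fun x => by positivity

/-- A function in `L^p`, `1 < p < ∞`, is no larger than its pairings with `L^q` permit. -/
lemma eLpNorm_le_of_forall_pairing_le {w : α → ℂ} (hw : MemLp w p μ) (hp : 1 < p) (hp' : p ≠ ⊤)
    {M : ℝ≥0∞} (hM : ∀ g : α → ℂ, MemLp g q μ → ‖∫ x, w x * g x ∂μ‖ₑ ≤ M * eLpNorm g q μ) :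
    eLpNorm w p μ ≤ M := by
  obtain ⟨hg, hgn, hgi⟩ := dualPower_spec (q := q) hw hp hp'
  have hpr : 1 < p.toReal := by
    rw [← ENNReal.toReal_one]; exact (ENNReal.toReal_lt_toReal (by simp) hp').2 hp
  have h := hM _ hg
  rw [hgi, hgn] at h
  rcases eq_or_ne (eLpNorm w p μ) 0 with h0 | h0
  · rw [h0]; exact zero_le
  have h1 : eLpNorm w p μ ^ (p.toReal - 1) ≠ 0 := by
    simp [ENNReal.rpow_eq_zero_iff, h0, hw.2.ne]
  have h2 : eLpNorm w p μ ^ (p.toReal - 1) ≠ ⊤ :=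
    ENNReal.rpow_ne_top_of_nonneg (by linarith) hw.2.ne
  have e : eLpNorm w p μ ^ p.toReal = eLpNorm w p μ * eLpNorm w p μ ^ (p.toReal - 1) := by
    conv_rhs => rw [← ENNReal.rpow_one (eLpNorm w p μ)]
    rw [← ENNReal.rpow_mul, one_mul, ← ENNReal.rpow_add _ _ h0 hw.2.ne]; congr 1; ring
  rw [e] at h
  exact (ENNReal.mul_le_mul_iff_left h1 h2).1 h

end holder

/-! ### Cutoffs -/

/-- A smooth cutoff: `1` on the disc of radius `R` and `0` outside the disc of radius `2R`. -/
noncomputable def cutoff (R : ℝ) (z : ℂ) : ℂ :=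
  (((⟨1, 2, one_pos, one_lt_two⟩ : ContDiffBump (0 : ℂ)) (R⁻¹ • z) : ℝ) : ℂ)

section cutoff

variable {R : ℝ} (hR : 0 < R)

include hR

lemma cutoff_eq_one {z : ℂ} (hz : ‖z‖ ≤ R) : cutoff R z = 1 := by
  rw [cutoff, ContDiffBump.one_of_mem_closedBall, ofReal_one]
  rw [mem_closedBall_zero_iff, norm_smul, norm_inv, Real.norm_of_nonneg hR.le,
    inv_mul_le_iff₀ hR]
  simpa using hz

lemma cutoff_eq_zero {z : ℂ} (hz : 2 * R ≤ ‖z‖) : cutoff R z = 0 := by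
  rw [cutoff, ContDiffBump.zero_of_le_dist, ofReal_zero]
  rw [dist_zero_right, norm_smul, norm_inv, Real.norm_of_nonneg hR.le, le_inv_mul_iff₀ hR]
  linarith

omit hR in
lemma norm_cutoff_le (z : ℂ) : ‖cutoff R z‖ ≤ 1 := by
  rw [cutoff, norm_real, Real.norm_of_nonneg (ContDiffBump.nonneg _)]
  exact ContDiffBump.le_one _

lemma isTest_cutoff : IsTest (cutoff R) := by
  refine ⟨?_, ?_⟩
  · exact Complex.ofRealCLM.contDiff.comp ((ContDiffBump.contDiff _).comp (contDiff_const_smul _))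
  · refine HasCompactSupport.intro (isCompact_closedBall (0 : ℂ) (2 * R)) fun z hz => ?_
    exact cutoff_eq_zero hR (by simpa using (not_le.1 (by simpa using hz) : 2 * R < ‖z‖).le)

end cutoff

lemma exists_norm_fderiv_cutoff_le : ∃ C : ℝ, 0 ≤ C ∧ ∀ R : ℝ, 0 < R → ∀ z,
    ‖fderiv ℝ (cutoff R) z‖ ≤ C / R := by
  have h1 := isTest_cutoff one_pos
  obtain ⟨C, hC⟩ := (h1.2.fderiv (𝕜 := ℝ)).exists_bound_of_continuous
    (h1.1.continuous_fderiv (by simp))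
  refine ⟨C, (norm_nonneg _).trans (hC 0), fun R hR z => ?_⟩
  have e : cutoff R = fun z => cutoff 1 (R⁻¹ • z) := by ext z; simp [cutoff]
  rw [e, fderiv_comp_smul, norm_smul, norm_inv, Real.norm_of_nonneg hR.le, div_eq_inv_mul]
  gcongr
  exact hC _

lemma fderiv_cutoff_eq_zero {R : ℝ} (hR : 0 < R) {z : ℂ} (hz : ‖z‖ < R ∨ 2 * R < ‖z‖) :
    fderiv ℝ (cutoff R) z = 0 := by
  rcases hz with hz | hz
  · have : cutoff R =ᶠ[𝓝 z] fun _ => 1 := by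
      filter_upwards [(isOpen_lt continuous_norm continuous_const).mem_nhds hz] with w hw
      exact cutoff_eq_one hR (le_of_lt hw)
    rw [this.fderiv_eq]; simp
  · have : cutoff R =ᶠ[𝓝 z] fun _ => 0 := by
      filter_upwards [(isOpen_lt continuous_const continuous_norm).mem_nhds hz] with w hw
      exact cutoff_eq_zero hR (le_of_lt hw)
    rw [this.fderiv_eq]; simp

/-! ### The Beurling transform on `L^r` -/

/-- The a priori estimate `‖∂u‖_r ≤ C ‖∂̄u‖_r` for test functions. -/
def BeurlingBound (r : ℝ≥0∞) (C : ℝ≥0) : Prop :=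
  ∀ u : ℂ → ℂ, IsTest u → eLpNorm (dz u) r ≤ C * eLpNorm (dzb u) r

/-- `F` is the Beurling transform of `f` in `L^r`, that is, `(f, F)` is a limit in `L^r × L^r` of
pairs `(∂̄u, ∂u)` with test functions `u`. -/
structure IsBeurling (r : ℝ≥0∞) (f F : ℂ → ℂ) : Prop where
  memLp_left : MemLp f r
  memLp_right : MemLp F r
  exists_seq : ∃ u : ℕ → ℂ → ℂ, (∀ n, IsTest (u n)) ∧
    Tendsto (fun n => eLpNorm (dzb (u n) - f) r) atTop (𝓝 0) ∧
    Tendsto (fun n => eLpNorm (dz (u n) - F) r) atTop (𝓝 0)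

lemma exists_beurlingBound_of_le_two {r : ℝ≥0∞} (hr : 1 < r) (hr2 : r ≤ 2) :
    ∃ C, BeurlingBound r C := by
  have hrt : r ≠ ⊤ := (hr2.trans_lt (by simp)).ne
  have h1 : 1 < r.toReal := by
    rw [← ENNReal.toReal_one]; exact (ENNReal.toReal_lt_toReal (by simp) hrt).2 hr
  have h2 : r.toReal ≤ 2 := by
    rw [← ENNReal.toReal_ofNat]; exact (ENNReal.toReal_le_toReal hrt (by simp)).2 hr2
  obtain ⟨C, hC⟩ := exists_lintegral_dz_le h1 h2
  have h0 : r ≠ 0 := (zero_lt_one.trans hr).ne'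
  refine ⟨C ^ (1 / r.toReal), fun u hu => ?_⟩
  rw [eLpNorm_eq_lintegral_rpow_enorm_toReal h0 hrt, eLpNorm_eq_lintegral_rpow_enorm_toReal h0 hrt,
    ENNReal.coe_rpow_of_nonneg _ (by positivity), ← ENNReal.mul_rpow_of_nonneg _ _ (by positivity)]
  exact ENNReal.rpow_le_rpow (hC u hu) (by positivity)

section cutoff

variable {f : ℂ → ℂ} (hf : IsTest f)

include hf

lemma isTest_cutoff_mul_cauchyTransform {R : ℝ} (hR : 0 < R) :
    IsTest fun z => cutoff R z * cauchyTransform f z :=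
  (isTest_cutoff hR).mul_smooth (contDiff_cauchyTransform hf)

lemma dzb_cutoff_mul_cauchyTransform {R : ℝ} (hR : 0 < R) (z : ℂ) :
    dzb (fun z => cutoff R z * cauchyTransform f z) z
      = dzb (cutoff R) z * cauchyTransform f z + cutoff R z * f z := by
  rw [dzb_mul ((isTest_cutoff hR).differentiable z)
    ((contDiff_cauchyTransform hf).differentiable (by simp) z), dzb_cauchyTransform hf]

lemma dz_cutoff_mul_cauchyTransform {R : ℝ} (hR : 0 < R) (z : ℂ) :
    dz (fun z => cutoff R z * cauchyTransform f z) z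
      = dz (cutoff R) z * cauchyTransform f z + cutoff R z * dz (cauchyTransform f) z := by
  rw [dz_mul ((isTest_cutoff hR).differentiable z)
    ((contDiff_cauchyTransform hf).differentiable (by simp) z)]

/-- The error is `∂̄χ_R` times the Cauchy transform, each of which is `O(1 / R)`. -/
lemma exists_norm_dzb_cutoff_mul_sub_le : ∃ A C : ℝ, 0 < A ∧ 0 ≤ C ∧ ∀ R, A ≤ R → ∀ z,
    ‖dzb (fun z => cutoff R z * cauchyTransform f z) z - f z‖
      ≤ (Metric.closedBall (0 : ℂ) (2 * R)).indicator (fun _ => C / R ^ 2) z := by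
  obtain ⟨A, C, hA, hC, hAC⟩ := exists_norm_cauchyTransform_le hf
  obtain ⟨D, hD, hDR⟩ := exists_norm_fderiv_cutoff_le
  obtain ⟨ρ, hρ, hρ0⟩ := hf.exists_radius
  refine ⟨max A ρ, D * C, by positivity, by positivity, fun R hR z => ?_⟩
  have hRA : A ≤ R := (le_max_left _ _).trans hR
  have hR0 : 0 < R := hA.trans_le hRA
  have e : cutoff R z * f z = f z := by
    by_cases hz : ‖z‖ ≤ R
    · rw [cutoff_eq_one hR0 hz, one_mul]
    · rw [hρ0 z (((le_max_right _ _).trans hR).trans_lt (not_le.1 hz)), mul_zero]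
  rw [dzb_cutoff_mul_cauchyTransform hf hR0, e, add_sub_cancel_right, norm_mul]
  by_cases h : ‖z‖ < R ∨ 2 * R < ‖z‖
  · have := norm_dzb_le (f := cutoff R) (z := z)
    rw [fderiv_cutoff_eq_zero hR0 h, norm_zero] at this
    rw [le_antisymm this (norm_nonneg _), zero_mul]
    exact Set.indicator_nonneg (fun _ _ => by positivity) _
  · push Not at h
    rw [Set.indicator_of_mem (by simpa using h.2)]
    calc ‖dzb (cutoff R) z‖ * ‖cauchyTransform f z‖ ≤ D / R * (C / R) := by
          refine mul_le_mul (norm_dzb_le.trans (hDR R hR0 z)) ?_ (norm_nonneg _) (by positivity)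
          refine (hAC z (hRA.trans h.1)).trans ?_
          gcongr; exact h.1
      _ = D * C / R ^ 2 := by ring

/-- The error is `O(R⁻²)` on a disc of area `O(R²)`; this is where `r > 1` is needed. -/
lemma tendsto_eLpNorm_dzb_cutoff_mul {r : ℝ≥0∞} (hr : 1 < r) :
    Tendsto (fun n : ℕ => eLpNorm
      (dzb (fun z => cutoff (n + 1) z * cauchyTransform f z) - f) r) atTop (𝓝 0) := by
  obtain ⟨A, C, hA, hC, h⟩ := exists_norm_dzb_cutoff_mul_sub_le hf
  have hs : 1 / r.toReal < 1 := by
    rcases eq_or_ne r ⊤ with rfl | hrt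
    · simp
    have : 1 < r.toReal := by
      rw [← ENNReal.toReal_one]; exact (ENNReal.toReal_lt_toReal (by simp) hrt).2 hr
    rw [div_lt_one (by linarith)]; exact this
  set s := 1 / r.toReal with hs_def
  have hs0 : 0 ≤ s := by positivity
  have hpi := Real.pi_pos
  have hlim : Tendsto (fun R : ℝ => ENNReal.ofReal (C * (4 * Real.pi) ^ s * R ^ (-(2 - 2 * s))))
      atTop (𝓝 0) := by
    have := (tendsto_rpow_neg_atTop (by linarith : 0 < 2 - 2 * s)).const_mul (C * (4 * Real.pi) ^ s)
    rw [mul_zero] at this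
    simpa [Function.comp_def] using (ENNReal.continuous_ofReal.tendsto _).comp this
  have hN : Tendsto (fun n : ℕ => (n : ℝ) + 1) atTop atTop :=
    tendsto_atTop_add_const_right _ _ tendsto_natCast_atTop_atTop
  refine tendsto_of_tendsto_of_tendsto_of_le_of_le' tendsto_const_nhds (hlim.comp hN)
    (Eventually.of_forall fun _ => zero_le) ?_
  filter_upwards [hN.eventually_ge_atTop A] with n hn
  set R : ℝ := (n : ℝ) + 1
  have hR : 0 < R := by positivity
  refine (eLpNorm_mono_real (fun z => h R hn z)).trans ?_
  refine (eLpNorm_indicator_const_le (C / R ^ 2) r).trans ?_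
  have hv : volume (Metric.closedBall (0 : ℂ) (2 * R)) = ENNReal.ofReal (4 * Real.pi * R ^ 2) := by
    rw [Complex.volume_closedBall, ← ENNReal.ofReal_pow (by positivity), ENNReal.coe_nnreal_eq,
      NNReal.coe_real_pi, ← ENNReal.ofReal_mul (by positivity)]
    congr 1; ring
  rw [hv, ← hs_def, ENNReal.ofReal_rpow_of_nonneg (by positivity) hs0,
    Real.enorm_of_nonneg (by positivity), ← ENNReal.ofReal_mul (by positivity)]
  refine le_of_eq ?_
  simp only [Function.comp]
  congr 1
  rw [Real.mul_rpow (by positivity) (by positivity), neg_sub, Real.rpow_sub hR, Real.rpow_two,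
    ← Real.rpow_natCast R 2, ← Real.rpow_mul hR.le]
  push_cast
  ring

omit hf in
lemma eventually_dz_cutoff_mul_eq (U : ℂ → ℂ) (z : ℂ) :
    ∀ᶠ n : ℕ in atTop, dz (fun z => cutoff (n + 1) z * U z) z = dz U z := by
  have hN : Tendsto (fun n : ℕ => (n : ℝ) + 1) atTop atTop :=
    tendsto_atTop_add_const_right _ _ tendsto_natCast_atTop_atTop
  filter_upwards [hN.eventually_gt_atTop ‖z‖] with n hn
  refine dz_eq_of_eventuallyEq ?_
  filter_upwards [(isOpen_lt continuous_norm continuous_const).mem_nhds hn] with w hw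
  rw [cutoff_eq_one (by positivity) (le_of_lt hw), one_mul]

end cutoff

section theory

variable {r s : ℝ≥0∞} {f F g G : ℂ → ℂ} {C : ℝ≥0}

lemma exists_isTest_eLpNorm_dzb_sub_le (hr : 1 < r) (hr' : r ≠ ⊤) (hf : MemLp f r) {ε : ℝ}
    (hε : 0 < ε) : ∃ u, IsTest u ∧ eLpNorm (dzb u - f) r ≤ ENNReal.ofReal ε := by
  obtain ⟨g, hgc, hgs, hg⟩ := hf.exist_eLpNorm_sub_le hr' hr.le (half_pos hε)
  have hgt : IsTest g := ⟨hgs, hgc⟩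
  obtain ⟨n, hn⟩ := ((ENNReal.tendsto_atTop_zero.1 (tendsto_eLpNorm_dzb_cutoff_mul hgt hr))
    (ENNReal.ofReal (ε / 2)) (by simpa using hε))
  have hu := isTest_cutoff_mul_cauchyTransform hgt (by positivity : (0 : ℝ) < n + 1)
  refine ⟨_, hu, ?_⟩
  have e : dzb (fun z => cutoff (n + 1) z * cauchyTransform g z) - f
      = (dzb (fun z => cutoff (n + 1) z * cauchyTransform g z) - g) - (f - g) := by abel
  rw [e]
  refine (eLpNorm_sub_le (((isTest_dzb hu).memLp r).sub (hgt.memLp r)).1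
    (hf.sub (hgt.memLp r)).1 hr.le).trans ?_
  rw [← add_halves ε, ENNReal.ofReal_add (by positivity) (by positivity)]
  exact add_le_add (hn n le_rfl) hg

lemma dz_pi_sub {u v : ℂ → ℂ} (hu : IsTest u) (hv : IsTest v) :
    dz (fun z => u z - v z) = dz u - dz v := by
  ext z; rw [dz_sub (hu.differentiable z) (hv.differentiable z), Pi.sub_apply]

lemma dzb_pi_sub {u v : ℂ → ℂ} (hu : IsTest u) (hv : IsTest v) :
    dzb (fun z => u z - v z) = dzb u - dzb v := by
  ext z; rw [dzb_sub (hu.differentiable z) (hv.differentiable z), Pi.sub_apply]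

lemma BeurlingBound.eLpNorm_dz_sub_le (hB : BeurlingBound r C) (hr : 1 ≤ r) {u v : ℂ → ℂ}
    (hu : IsTest u) (hv : IsTest v) (hf : MemLp f r) : eLpNorm (dz u - dz v) r
      ≤ C * (eLpNorm (dzb u - f) r + eLpNorm (dzb v - f) r) := by
  rw [← dz_pi_sub hu hv]
  refine (hB _ (hu.sub hv)).trans ?_
  rw [dzb_pi_sub hu hv]
  gcongr
  rw [show dzb u - dzb v = (dzb u - f) - (dzb v - f) by abel]
  exact eLpNorm_sub_le (((isTest_dzb hu).memLp r).sub hf).1 (((isTest_dzb hv).memLp r).sub hf).1 hr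

lemma BeurlingBound.exists_isBeurling (hB : BeurlingBound r C) (hr : 1 < r) (hr' : r ≠ ⊤)
    (hf : MemLp f r) : ∃ F, IsBeurling r f F := by
  have hpos (n : ℕ) : (0 : ℝ) < (1 / 2) ^ n := by positivity
  choose u hu hun using fun n : ℕ => exists_isTest_eLpNorm_dzb_sub_le hr hr' hf (hpos n)
  have hlim : Tendsto (fun n : ℕ => ENNReal.ofReal ((1 / 2) ^ n)) atTop (𝓝 0) := by
    rw [← ENNReal.ofReal_zero]
    exact (ENNReal.continuous_ofReal.tendsto _).comp
      (tendsto_pow_atTop_nhds_zero_of_lt_one (by norm_num) (by norm_num))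
  have hB' : ∑' n : ℕ, ENNReal.ofReal ((2 * C + 1) * (1 / 2) ^ n) ≠ ⊤ := by
    have hs : Summable fun n : ℕ => (2 * (C : ℝ) + 1) * (1 / 2) ^ n :=
      summable_geometric_two.mul_left _
    rw [← ENNReal.ofReal_tsum_of_nonneg (fun n => by positivity) hs]
    exact ENNReal.ofReal_ne_top
  have hcau (N n m : ℕ) (hn : N ≤ n) (hm : N ≤ m) : eLpNorm (dz (u n) - dz (u m)) r
      < ENNReal.ofReal ((2 * C + 1) * (1 / 2) ^ N) := by
    have hmono (k : ℕ) (hk : N ≤ k) : ENNReal.ofReal ((1 / 2) ^ k) ≤ ENNReal.ofReal ((1 / 2) ^ N) :=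
      ENNReal.ofReal_le_ofReal (pow_le_pow_of_le_one (by norm_num) (by norm_num) hk)
    refine lt_of_le_of_lt (b := ENNReal.ofReal (2 * C * (1 / 2) ^ N)) ?_
      ((ENNReal.ofReal_lt_ofReal_iff (by positivity)).2 (by linarith [hpos N]))
    refine (hB.eLpNorm_dz_sub_le hr.le (hu n) (hu m) hf).trans ?_
    have e : ENNReal.ofReal (2 * C * (1 / 2) ^ N)
        = C * (ENNReal.ofReal ((1 / 2) ^ N) + ENNReal.ofReal ((1 / 2) ^ N)) := by
      rw [← two_mul, mul_assoc, ENNReal.ofReal_mul (by norm_num), ENNReal.ofReal_mul (by positivity),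
        ENNReal.ofReal_coe_nnreal, ENNReal.ofReal_ofNat]
      ring
    rw [e]
    gcongr
    · exact (hun n).trans (hmono n hn)
    · exact (hun m).trans (hmono m hm)
  obtain ⟨F, hF, hFl⟩ := Lp.cauchy_complete_eLpNorm hr.le (f := fun n => dz (u n))
    (fun n => (isTest_dz (hu n)).memLp r) hB' hcau
  exact ⟨F, hf, hF, u, hu, tendsto_of_tendsto_of_tendsto_of_le_of_le tendsto_const_nhds hlim
    (fun _ => zero_le) hun, hFl⟩

lemma IsBeurling.tendsto_dz (hfF : IsBeurling r f F) (hB : BeurlingBound r C) (hr : 1 ≤ r)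
    {u : ℕ → ℂ → ℂ} (hu : ∀ n, IsTest (u n))
    (huf : Tendsto (fun n => eLpNorm (dzb (u n) - f) r) atTop (𝓝 0)) :
    Tendsto (fun n => eLpNorm (dz (u n) - F) r) atTop (𝓝 0) := by
  obtain ⟨hf, hF, v, hv, hv1, hv2⟩ := hfF
  have hlim : Tendsto (fun n => C * (eLpNorm (dzb (u n) - f) r + eLpNorm (dzb (v n) - f) r)
      + eLpNorm (dz (v n) - F) r) atTop (𝓝 0) := by
    simpa using (ENNReal.Tendsto.const_mul (a := (C : ℝ≥0∞)) (huf.add hv1)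
      (Or.inr ENNReal.coe_ne_top)).add hv2
  refine tendsto_of_tendsto_of_tendsto_of_le_of_le tendsto_const_nhds hlim (fun _ => zero_le)
    fun n => ?_
  rw [show dz (u n) - F = (dz (u n) - dz (v n)) + (dz (v n) - F) by abel]
  refine (eLpNorm_add_le (((isTest_dz (hu n)).memLp r).sub ((isTest_dz (hv n)).memLp r)).1
    (((isTest_dz (hv n)).memLp r).sub hF).1 hr).trans ?_
  gcongr
  exact hB.eLpNorm_dz_sub_le hr (hu n) (hv n) hf

lemma IsBeurling.eLpNorm_le (hfF : IsBeurling r f F) (hB : BeurlingBound r C) (hr : 1 ≤ r) :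
    eLpNorm F r ≤ C * eLpNorm f r := by
  obtain ⟨hf, hF, v, hv, hv1, hv2⟩ := hfF
  have hlim : Tendsto (fun n => C * (eLpNorm (dzb (v n) - f) r + eLpNorm f r)
      + eLpNorm (dz (v n) - F) r) atTop (𝓝 (C * eLpNorm f r)) := by
    have h := (ENNReal.Tendsto.const_mul (a := (C : ℝ≥0∞)) (hv1.add_const (eLpNorm f r))
      (Or.inr ENNReal.coe_ne_top)).add hv2
    rwa [zero_add, add_zero] at h
  refine ge_of_tendsto hlim (Eventually.of_forall fun n => ?_)
  have m1 := (isTest_dz (hv n)).memLp r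
  have m2 := (isTest_dzb (hv n)).memLp r
  have h1 : eLpNorm F r ≤ eLpNorm (dz (v n)) r + eLpNorm (dz (v n) - F) r := by
    have := eLpNorm_sub_le m1.1 (m1.sub hF).1 hr
    rwa [sub_sub_cancel] at this
  have h2 : eLpNorm (dzb (v n)) r ≤ eLpNorm (dzb (v n) - f) r + eLpNorm f r := by
    have := eLpNorm_add_le (m2.sub hf).1 hf.1 hr
    rwa [sub_add_cancel] at this
  exact h1.trans (add_le_add_left ((hB _ (hv n)).trans (mul_le_mul_right h2 _)) _)

lemma IsBeurling.congr_right (hfF : IsBeurling r f F) (h : F =ᵐ[volume] G) : IsBeurling r f G := by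
  obtain ⟨hf, hF, v, hv, hv1, hv2⟩ := hfF
  refine ⟨hf, (memLp_congr_ae h).1 hF, v, hv, hv1, hv2.congr fun n => eLpNorm_congr_ae ?_⟩
  filter_upwards [h] with z hz
  rw [Pi.sub_apply, Pi.sub_apply, hz]

lemma IsTest.isBeurling {u : ℂ → ℂ} (hu : IsTest u) : IsBeurling r (dzb u) (dz u) :=
  ⟨(isTest_dzb hu).memLp r, (isTest_dz hu).memLp r, fun _ => u, fun _ => hu, by simp, by simp⟩

lemma isBeurling_dz_cauchyTransform (hB : BeurlingBound r C) (hr : 1 < r) (hr' : r ≠ ⊤)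
    (hf : IsTest f) : IsBeurling r f (dz (cauchyTransform f)) := by
  obtain ⟨F, hF⟩ := hB.exists_isBeurling hr hr' (hf.memLp r)
  refine hF.congr_right ?_
  have hu (n : ℕ) := isTest_cutoff_mul_cauchyTransform hf (by positivity : (0 : ℝ) < n + 1)
  have h := hF.tendsto_dz hB hr.le hu (tendsto_eLpNorm_dzb_cutoff_mul hf hr)
  obtain ⟨ns, hns, hae⟩ := (tendstoInMeasure_of_tendsto_eLpNorm (zero_lt_one.trans hr).ne'
    (fun n => ((isTest_dz (hu n)).memLp r).1) hF.memLp_right.1 h).exists_seq_tendsto_ae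
  filter_upwards [hae] with z hz
  refine tendsto_nhds_unique hz (tendsto_const_nhds.congr' ?_)
  filter_upwards [hns.tendsto_atTop.eventually (eventually_dz_cutoff_mul_eq (cauchyTransform f) z)]
    with n hn
  exact hn.symm

lemma IsBeurling.conj (hfF : IsBeurling r f F) : IsBeurling r (fun z => starRingEnd ℂ (F z))
    (fun z => starRingEnd ℂ (f z)) := by
  obtain ⟨hf, hF, v, hv, hv1, hv2⟩ := hfF
  have hc {g : ℂ → ℂ} (hg : MemLp g r) : MemLp (fun z => starRingEnd ℂ (g z)) r :=
    hg.of_le (Complex.continuous_conj.comp_aestronglyMeasurable hg.1)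
      (Eventually.of_forall fun z => by rw [Complex.norm_conj])
  refine ⟨hc hF, hc hf, fun n z => starRingEnd ℂ (v n z), fun n => (hv n).conj,
    hv2.congr fun n => eLpNorm_congr_norm_ae (Eventually.of_forall fun z => ?_),
    hv1.congr fun n => eLpNorm_congr_norm_ae (Eventually.of_forall fun z => ?_)⟩
  · rw [Pi.sub_apply, Pi.sub_apply, dzb_conj ((hv n).differentiable z), ← map_sub, Complex.norm_conj]
  · rw [Pi.sub_apply, Pi.sub_apply, dz_conj ((hv n).differentiable z), ← map_sub, Complex.norm_conj]

/-- The Beurling transform is symmetric for the bilinear pairing. -/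
lemma IsBeurling.integral_mul_comm [r.HolderConjugate s] (hfF : IsBeurling r f F)
    (hgG : IsBeurling s g G) : ∫ z, F z * g z = ∫ z, f z * G z := by
  obtain ⟨hf, hF, u, hu, hu1, hu2⟩ := hfF
  obtain ⟨hg, hG, v, hv, hv1, hv2⟩ := hgG
  have t1 := tendsto_integral_mul (fun n => (isTest_dz (hu n)).memLp r)
    (fun n => (isTest_dzb (hv n)).memLp s) hF hg hu2 hv1
  have t2 := tendsto_integral_mul (fun n => (isTest_dzb (hu n)).memLp r)
    (fun n => (isTest_dz (hv n)).memLp s) hf hG hu1 hv2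
  simp_rw [integral_dz_mul_dzb (hu _) (hv _)] at t1
  exact tendsto_nhds_unique t1 t2

end theory

/-! ### Existence of the principal value -/

section conjugate

variable (r s : ℝ≥0∞) [h : r.HolderConjugate s]

lemma one_lt_conj_of_ne_top (hr : r ≠ ⊤) : 1 < s :=
  (ENNReal.HolderConjugate.lt_top_iff_one_lt r s).1 hr.lt_top

lemma conj_ne_top_of_one_lt (hr : 1 < r) : s ≠ ⊤ := by
  have : s.HolderConjugate r := ENNReal.HolderTriple.symm
  exact ((ENNReal.HolderConjugate.lt_top_iff_one_lt s r).2 hr).ne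

lemma conj_le_two_of_two_le (hr : 2 ≤ r) : s ≤ 2 := by
  have h1 := ENNReal.HolderConjugate.inv_add_inv_eq_one r s
  have h2 : r⁻¹ ≤ 2⁻¹ := ENNReal.inv_le_inv.2 hr
  by_contra hs
  have h3 : s⁻¹ < 2⁻¹ := ENNReal.inv_lt_inv.2 (not_le.1 hs)
  have h4 := ENNReal.add_lt_add_of_le_of_lt (by simpa using (ENNReal.HolderConjugate.ne_zero r s))
    h2 h3
  rw [h1, ENNReal.inv_two_add_inv_two] at h4
  exact lt_irrefl _ h4

end conjugate

/-- The `L^r` boundedness of the Beurling transform, `1 < r < ∞`; exponents above `2` are reduced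
to the conjugate exponent by symmetry. -/
theorem exists_beurlingBound {r : ℝ≥0∞} (hr : 1 < r) (hr' : r ≠ ⊤) : ∃ C, BeurlingBound r C := by
  rcases le_total r 2 with h2 | h2
  · exact exists_beurlingBound_of_le_two hr h2
  obtain ⟨s, hc⟩ : ∃ s, r.HolderConjugate s := ⟨_, .conjExponent hr.le⟩
  have hs := one_lt_conj_of_ne_top r s hr'
  have hs' := conj_ne_top_of_one_lt r s hr
  obtain ⟨C, hC⟩ := exists_beurlingBound_of_le_two hs (conj_le_two_of_two_le r s h2)
  refine ⟨C, fun u hu => eLpNorm_le_of_forall_pairing_le (q := s) ((isTest_dz hu).memLp r) hr hr'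
    fun g hg => ?_⟩
  obtain ⟨G, hG⟩ := hC.exists_isBeurling hs hs' hg
  rw [(hu.isBeurling (r := r)).integral_mul_comm hG]
  refine (enorm_integral_mul_le (p := r) (q := s) ((isTest_dzb hu).memLp r).1 hG.memLp_right.1).trans ?_
  rw [mul_comm (C : ℝ≥0∞), mul_assoc]
  exact mul_le_mul_right (hG.eLpNorm_le hC hs.le) _

lemma memLp_indicator_one_div_sub_sq {s : ℝ≥0∞} (hs : 1 < s) (hs' : s ≠ ⊤) {ε : ℝ} (hε : 0 < ε)
    (z : ℂ) : MemLp ({y : ℂ | ε < ‖z - y‖}.indicator fun y => 1 / (z - y) ^ 2) s := by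
  have hS : 1 < s.toReal := by
    rw [← ENNReal.toReal_one]; exact (ENNReal.toReal_lt_toReal (by simp) hs').2 hs
  have h1 : MemLp (fun w : ℂ => (1 + ‖w‖) ^ (-2 : ℝ)) s := by
    rw [← integrable_norm_rpow_iff (Measurable.aestronglyMeasurable (by fun_prop)) (zero_lt_one.trans hs).ne' hs']
    have := integrable_one_add_norm (E := ℂ) (μ := volume) (r := 2 * s.toReal)
      (by rw [finrank_real_complex]; push_cast; linarith)
    refine this.congr (Eventually.of_forall fun w => ?_)
    simp only
    rw [Real.norm_of_nonneg (by positivity), ← Real.rpow_mul (by positivity)]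
    congr 1; ring
  have h2 := (h1.comp_measurePreserving
    (Measure.measurePreserving_sub_left (volume : Measure ℂ) z)).const_mul ((1 / ε + 1) ^ 2)
  refine h2.of_le ?_ (Eventually.of_forall fun y => ?_)
  · refine Measurable.aestronglyMeasurable (Measurable.indicator (by fun_prop) ?_)
    exact measurableSet_lt measurable_const (by fun_prop)
  · simp only [Function.comp]
    by_cases hy : ε < ‖z - y‖
    · rw [Set.indicator_of_mem (by exact hy)]
      have h0 : 0 < ‖z - y‖ := hε.trans hy
      rw [Real.norm_of_nonneg (by positivity), norm_div, norm_one, norm_pow, Real.rpow_neg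
        (by positivity), Real.rpow_two, ← div_eq_mul_inv, ← div_pow, one_div, ← inv_pow]
      gcongr
      rw [inv_eq_one_div, div_le_div_iff₀ h0 (by positivity), one_mul, add_mul, one_mul]
      gcongr
      rw [one_div, ← div_eq_inv_mul, one_le_div hε]; exact hy.le
    · rw [Set.indicator_of_notMem (by exact hy), norm_zero]; positivity

section theory

variable {r : ℝ≥0∞} {f F : ℂ → ℂ}

lemma truncBeurling_eq_integral_mul (ε : ℝ) (f : ℂ → ℂ) (z : ℂ) : truncBeurling ε f z
    = -(1 / (Real.pi : ℂ)) *
      ∫ y, f y * {y : ℂ | ε < ‖z - y‖}.indicator (fun y => 1 / (z - y) ^ 2) y := by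
  rw [truncBeurling, ← integral_indicator (measurableSet_lt measurable_const (by fun_prop))]
  congr 2; ext y
  by_cases hy : ε < ‖z - y‖
  · rw [Set.indicator_of_mem (by exact hy), Set.indicator_of_mem (by exact hy)]; ring
  · rw [Set.indicator_of_notMem (by exact hy), Set.indicator_of_notMem (by exact hy), mul_zero]

lemma ballAvg_eq_integral_mul (F : ℂ → ℂ) (z : ℂ) (ε : ℝ) : ballAvg F z ε
    = 1 / ((Real.pi : ℂ) * (ε : ℂ) ^ 2) *
      ∫ w, F w * (Metric.closedBall z ε).indicator (fun _ => 1) w := by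
  rw [ballAvg, ← integral_indicator measurableSet_closedBall]
  congr 2; ext y
  by_cases hy : y ∈ Metric.closedBall z ε
  · rw [Set.indicator_of_mem hy, Set.indicator_of_mem hy, mul_one]
  · rw [Set.indicator_of_notMem hy, Set.indicator_of_notMem hy, mul_zero]

/-- The truncated Beurling transform of `f ∈ L^r` is the mean of the Beurling transform `F` over the
disc that is cut out. -/
lemma IsBeurling.truncBeurling_eq (hfF : IsBeurling r f F) (hr : 1 < r) (hr' : r ≠ ⊤) {ε : ℝ}
    (hε : 0 < ε) (z : ℂ) : truncBeurling ε f z = ballAvg F z ε := by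
  obtain ⟨s, hc⟩ : ∃ s, r.HolderConjugate s := ⟨_, .conjExponent hr.le⟩
  have hs := one_lt_conj_of_ne_top r s hr'
  have hs' := conj_ne_top_of_one_lt r s hr
  obtain ⟨hf, hF, u, hu, hu1, hu2⟩ := hfF
  have m1 := memLp_indicator_one_div_sub_sq hs hs' hε z
  have m2 : MemLp ((Metric.closedBall z ε).indicator fun _ => (1 : ℂ)) s :=
    memLp_indicator_const _ measurableSet_closedBall _ (Or.inr measure_closedBall_lt_top.ne)
  have t1 := (tendsto_integral_mul (fun n => (isTest_dzb (hu n)).memLp r) (fun _ => m1) hf m1 hu1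
    (by simp)).const_mul (-(1 / (Real.pi : ℂ)))
  have t2 := (tendsto_integral_mul (fun n => (isTest_dz (hu n)).memLp r) (fun _ => m2) hF m2 hu2
    (by simp)).const_mul (1 / ((Real.pi : ℂ) * (ε : ℂ) ^ 2))
  simp_rw [← truncBeurling_eq_integral_mul, truncBeurling_dzb (hu _) z hε] at t1
  simp_rw [← ballAvg_eq_integral_mul] at t2
  exact tendsto_nhds_unique t1 t2

lemma ae_tendsto_ballAvg (hF : LocallyIntegrable F) :
    ∀ᵐ z, Tendsto (ballAvg F z) (𝓝[>] 0) (𝓝 (F z)) := by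
  filter_upwards [(Besicovitch.vitaliFamily (volume : Measure ℂ)).ae_tendsto_average hF] with z hz
  refine (hz.comp (Besicovitch.tendsto_filterAt volume z)).congr' ?_
  filter_upwards [self_mem_nhdsWithin] with ε (hε : 0 < ε)
  exact (ballAvg_eq_average F z hε).symm

lemma IsBeurling.ae_tendsto (hfF : IsBeurling r f F) (hr : 1 < r) (hr' : r ≠ ⊤) :
    ∀ᵐ z, Tendsto (fun ε : ℝ => truncBeurling ε f z) (𝓝[>] 0) (𝓝 (F z)) := by
  filter_upwards [ae_tendsto_ballAvg (hfF.memLp_right.locallyIntegrable hr.le)] with z hz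
  refine hz.congr' ?_
  filter_upwards [self_mem_nhdsWithin] with ε (hε : 0 < ε)
  exact (hfF.truncBeurling_eq hr hr' hε z).symm

lemma IsBeurling.ae_beurlingExistsAt (hfF : IsBeurling r f F) (hr : 1 < r) (hr' : r ≠ ⊤) :
    ∀ᵐ z, BeurlingExistsAt f z := by
  filter_upwards [hfF.ae_tendsto hr hr'] with z hz
  exact ⟨_, hz⟩

lemma IsBeurling.ae_beurling_eq (hfF : IsBeurling r f F) (hr : 1 < r) (hr' : r ≠ ⊤) :
    beurling f =ᵐ[volume] F := by
  filter_upwards [hfF.ae_tendsto hr hr'] with z hz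
  exact hz.limUnder_eq

end theory

/-! ### The polarised Jacobian -/

/-- The homogeneous Sobolev norm of a complex valued function in terms of Wirtinger derivatives. -/
noncomputable def wirtingerNorm (q : ℝ≥0∞) (U : ℂ → ℂ) : ℝ :=
  lpNorm (dz U) q volume + lpNorm (dzb U) q volume

/-- The bilinear form `∂U ∂̄V - ∂̄U ∂V`. The Jacobian of `U` is its value at `V = Ū`. -/
noncomputable def polarJacobian (U V : ℂ → ℂ) (z : ℂ) : ℂ := dz U z * dzb V z - dzb U z * dz V z

/-- The Jacobian `|∂U|² - |∂̄U|²` of `U`, as a complex number. -/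
noncomputable def complexJacobian (U : ℂ → ℂ) (z : ℂ) : ℂ :=
  dz U z * starRingEnd ℂ (dz U z) - dzb U z * starRingEnd ℂ (dzb U z)

section wirtingerNorm

variable {q : ℝ≥0∞} {U V : ℂ → ℂ}

lemma wirtingerNorm_nonneg : 0 ≤ wirtingerNorm q U := add_nonneg lpNorm_nonneg lpNorm_nonneg

lemma wirtingerNorm_add_le (hq : 1 ≤ q) (hU : IsTest U) (hV : IsTest V) :
    wirtingerNorm q (fun z => U z + V z) ≤ wirtingerNorm q U + wirtingerNorm q V := by
  have e1 : dz (fun z => U z + V z) = dz U + dz V := by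
    ext z; rw [dz_add (hU.differentiable z) (hV.differentiable z), Pi.add_apply]
  have e2 : dzb (fun z => U z + V z) = dzb U + dzb V := by
    ext z; rw [dzb_add (hU.differentiable z) (hV.differentiable z), Pi.add_apply]
  have h1 := lpNorm_add_le (g := dz V) ((isTest_dz hU).memLp q) hq
  have h2 := lpNorm_add_le (g := dzb V) ((isTest_dzb hU).memLp q) hq
  simp only [wirtingerNorm, e1, e2]
  linarith

lemma wirtingerNorm_const_mul (c : ℂ) (hU : IsTest U) :
    wirtingerNorm q (fun z => c * U z) = ‖c‖ * wirtingerNorm q U := by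
  have e1 : dz (fun z => c * U z) = c • dz U := by
    ext z; rw [dz_const_mul c (hU.differentiable z)]; rfl
  have e2 : dzb (fun z => c * U z) = c • dzb U := by
    ext z; rw [dzb_const_mul c (hU.differentiable z)]; rfl
  simp only [wirtingerNorm, e1, e2, lpNorm_const_smul, mul_add, coe_nnnorm]

lemma wirtingerNorm_conj (hU : IsTest U) :
    wirtingerNorm q (fun z => starRingEnd ℂ (U z)) = wirtingerNorm q U := by
  have e1 : dz (fun z => starRingEnd ℂ (U z)) = starRingEnd (ℂ → ℂ) (dzb U) := by
    ext z; rw [dz_conj (hU.differentiable z)]; rfl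
  have e2 : dzb (fun z => starRingEnd ℂ (U z)) = starRingEnd (ℂ → ℂ) (dz U) := by
    ext z; rw [dzb_conj (hU.differentiable z)]; rfl
  rw [wirtingerNorm, e1, e2, lpNorm_conj, lpNorm_conj, add_comm, wirtingerNorm]

lemma lpNorm_comp_measurePreserving {T : ℂ → ℂ} (hT : MeasurePreserving T) {f : ℂ → ℂ}
    (hf : AEStronglyMeasurable f) : lpNorm (fun z => f (T z)) q volume = lpNorm f q volume := by
  have h := eLpNorm_comp_measurePreserving (p := q) hf hT
  rw [← toReal_eLpNorm hf, ← h, toReal_eLpNorm (hf.comp_measurePreserving hT), Function.comp_def]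

lemma wirtingerNorm_comp_add (hU : IsTest U) (a : ℂ) :
    wirtingerNorm q (fun z => U (z + a)) = wirtingerNorm q U := by
  have e1 : dz (fun z => U (z + a)) = fun z => dz U (z + a) := by ext z; rw [dz_comp_add]
  have e2 : dzb (fun z => U (z + a)) = fun z => dzb U (z + a) := by ext z; rw [dzb_comp_add]
  rw [wirtingerNorm, e1, e2, wirtingerNorm,
    lpNorm_comp_measurePreserving (measurePreserving_add_right _ a) (isTest_dz hU).continuous.aestronglyMeasurable,
    lpNorm_comp_measurePreserving (measurePreserving_add_right _ a) (isTest_dzb hU).continuous.aestronglyMeasurable]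

lemma wirtingerNorm_comp_sub_left (hU : IsTest U) (a : ℂ) :
    wirtingerNorm q (fun z => U (a - z)) = wirtingerNorm q U := by
  have e1 : dz (fun z => U (a - z)) = -fun z => dz U (a - z) := by
    ext z; rw [dz_comp_sub_left a (hU.differentiable _)]; rfl
  have e2 : dzb (fun z => U (a - z)) = -fun z => dzb U (a - z) := by
    ext z; rw [dzb_comp_sub_left a (hU.differentiable _)]; rfl
  rw [wirtingerNorm, e1, e2, wirtingerNorm, lpNorm_neg, lpNorm_neg,
    lpNorm_comp_measurePreserving (Measure.measurePreserving_sub_left _ a) (isTest_dz hU).continuous.aestronglyMeasurable,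
    lpNorm_comp_measurePreserving (Measure.measurePreserving_sub_left _ a) (isTest_dzb hU).continuous.aestronglyMeasurable]

end wirtingerNorm

section polarJacobian

variable {U V : ℂ → ℂ}

lemma isTest_polarJacobian (hU : IsTest U) (hV : IsTest V) : IsTest (polarJacobian U V) :=
  ((isTest_dz hU).mul_smooth (isTest_dzb hV).1).sub ((isTest_dzb hU).mul_smooth (isTest_dz hV).1)

lemma isTest_complexJacobian (hU : IsTest U) : IsTest (complexJacobian U) :=
  ((isTest_dz hU).mul_smooth (isTest_dz hU).conj.1).sub
    ((isTest_dzb hU).mul_smooth (isTest_dzb hU).conj.1)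

lemma polarJacobian_comp_add (a z : ℂ) :
    polarJacobian (fun z => U (z + a)) (fun z => V (z + a)) z = polarJacobian U V (z + a) := by
  simp only [polarJacobian, dz_comp_add, dzb_comp_add]

lemma polarJacobian_comp_sub_left (hU : IsTest U) (hV : IsTest V) (a z : ℂ) :
    polarJacobian (fun z => U (a - z)) (fun z => V (a - z)) z = polarJacobian U V (a - z) := by
  simp only [polarJacobian, dz_comp_sub_left a (hU.differentiable _),
    dzb_comp_sub_left a (hU.differentiable _), dz_comp_sub_left a (hV.differentiable _),
    dzb_comp_sub_left a (hV.differentiable _)]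
  ring

lemma complexJacobian_add_const_mul_conj (hU : IsTest U) (hV : IsTest V) (c z : ℂ) :
    complexJacobian (fun z => U z + c * starRingEnd ℂ (V z)) z
      = (dz U z + c * starRingEnd ℂ (dzb V z)) *
          (starRingEnd ℂ (dz U z) + starRingEnd ℂ c * dzb V z)
        - (dzb U z + c * starRingEnd ℂ (dz V z)) *
          (starRingEnd ℂ (dzb U z) + starRingEnd ℂ c * dz V z) := by
  have h1 := hU.differentiable z
  have h2 := hV.differentiable z
  have h3 := hV.conj.differentiable z
  have h4 := (hV.conj.const_mul c).differentiable z
  rw [complexJacobian, dz_add h1 h4, dzb_add h1 h4, dz_const_mul c h3, dzb_const_mul c h3,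
    dz_conj h2, dzb_conj h2]
  simp only [map_add, map_mul, conj_conj]

/-- Polarisation of the Hermitian form whose diagonal is the Jacobian, applied to `U` and `V̄`. -/
lemma four_mul_polarJacobian (hU : IsTest U) (hV : IsTest V) (z : ℂ) :
    4 * polarJacobian U V z
      = complexJacobian (fun z => U z + 1 * starRingEnd ℂ (V z)) z
        + I * complexJacobian (fun z => U z + I * starRingEnd ℂ (V z)) z
        + -1 * complexJacobian (fun z => U z + -1 * starRingEnd ℂ (V z)) z
        + -I * complexJacobian (fun z => U z + -I * starRingEnd ℂ (V z)) z := by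
  simp only [complexJacobian_add_const_mul_conj hU hV, map_one, map_neg, conj_I, polarJacobian]
  linear_combination (2 * (dz U z * dzb V z - dzb U z * dz V z)
    - 2 * (starRingEnd ℂ (dzb V z) * starRingEnd ℂ (dz U z)
      - starRingEnd ℂ (dz V z) * starRingEnd ℂ (dzb U z))) * I_sq

end polarJacobian

lemma integrable_mul_isTest {b g : ℂ → ℂ} (hb : LocallyIntegrable b) (hg : IsTest g) :
    Integrable fun z => b z * g z := by
  have := hb.integrable_smul_left_of_hasCompactSupport hg.continuous hg.2
  simpa [mul_comm] using this

/-- Optimising over the scaling parameter turns a bound by a square of a sum into one by a product. -/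
lemma le_four_mul_of_forall_le_sq {x M a c : ℝ} (hM : 0 ≤ M) (ha : 0 ≤ a) (hc : 0 ≤ c)
    (h : ∀ t : ℝ, 0 < t → x ≤ M * (t * a + t⁻¹ * c) ^ 2) : x ≤ 4 * M * a * c := by
  have key (η : ℝ) (hη : 0 < η) : x ≤ 4 * M * (a + η) * (c + η) := by
    set t := √((c + η) / (a + η)) with ht
    have ht0 : 0 < t := Real.sqrt_pos.2 (by positivity)
    have ht2 : t ^ 2 = (c + η) / (a + η) := Real.sq_sqrt (by positivity)
    calc x ≤ M * (t * a + t⁻¹ * c) ^ 2 := h t ht0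
      _ ≤ M * (t * (a + η) + t⁻¹ * (c + η)) ^ 2 := by gcongr <;> linarith
      _ = 4 * M * (a + η) * (c + η) := by
        have e : (t * (a + η) + t⁻¹ * (c + η)) ^ 2
            = t ^ 2 * (a + η) ^ 2 + 2 * (a + η) * (c + η) + (t ^ 2)⁻¹ * (c + η) ^ 2 := by
          field_simp; ring
        rw [e, ht2]; field_simp; ring
  have hlim : Tendsto (fun η : ℝ => 4 * M * (a + η) * (c + η)) (𝓝[>] 0)
      (𝓝 (4 * M * (a + 0) * (c + 0))) :=
    (Continuous.tendsto (by fun_prop) 0).mono_left nhdsWithin_le_nhds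
  rw [add_zero, add_zero] at hlim
  exact ge_of_tendsto hlim (by filter_upwards [self_mem_nhdsWithin] with η hη using key η hη)

/-- Polarisation: a bound for the integrals of `b` against Jacobians implies a bound for the
integrals against the polarised Jacobian. -/
lemma norm_integral_polarJacobian_le {q : ℝ≥0∞} (hq : 1 ≤ q) {b : ℂ → ℂ}
    (hb : LocallyIntegrable b) {M : ℝ} (hM : 0 ≤ M)
    (h : ∀ U, IsTest U → ‖∫ z, b z * complexJacobian U z‖ ≤ M * wirtingerNorm q U ^ 2) :
    ∀ U V, IsTest U → IsTest V →
      ‖∫ z, b z * polarJacobian U V z‖ ≤ 4 * M * wirtingerNorm q U * wirtingerNorm q V := by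
  have h1 : ∀ U V, IsTest U → IsTest V → ‖∫ z, b z * polarJacobian U V z‖
      ≤ M * (wirtingerNorm q U + wirtingerNorm q V) ^ 2 := by
    intro U V hU hV
    have ht (c : ℂ) : IsTest fun z => U z + c * starRingEnd ℂ (V z) := hU.add (hV.conj.const_mul c)
    have hc (c : ℂ) (hc : ‖c‖ = 1) :
        ‖∫ z, b z * complexJacobian (fun z => U z + c * starRingEnd ℂ (V z)) z‖
          ≤ M * (wirtingerNorm q U + wirtingerNorm q V) ^ 2 := by
      refine (h _ (ht c)).trans ?_
      gcongr
      · exact wirtingerNorm_nonneg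
      refine (wirtingerNorm_add_le hq hU (hV.conj.const_mul c)).trans (le_of_eq ?_)
      rw [wirtingerNorm_const_mul c hV.conj, hc, one_mul, wirtingerNorm_conj hV]
    have hi (c : ℂ) := integrable_mul_isTest hb (isTest_complexJacobian (ht c))
    have e : 4 * ∫ z, b z * polarJacobian U V z
        = (∫ z, b z * complexJacobian (fun z => U z + 1 * starRingEnd ℂ (V z)) z)
          + I * (∫ z, b z * complexJacobian (fun z => U z + I * starRingEnd ℂ (V z)) z)
          + -1 * (∫ z, b z * complexJacobian (fun z => U z + -1 * starRingEnd ℂ (V z)) z)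
          + -I * (∫ z, b z * complexJacobian (fun z => U z + -I * starRingEnd ℂ (V z)) z) := by
      rw [← integral_const_mul, ← integral_const_mul, ← integral_const_mul, ← integral_const_mul,
        ← integral_add (hi 1) ((hi I).const_mul _),
        ← integral_add (by exact (hi 1).add ((hi I).const_mul _)) ((hi (-1)).const_mul _),
        ← integral_add (by exact ((hi 1).add ((hi I).const_mul _)).add ((hi (-1)).const_mul _))
          ((hi (-I)).const_mul _)]
      congr 1; ext z
      linear_combination b z * four_mul_polarJacobian hU hV z
    have h4 : ‖(4 : ℂ) * ∫ z, b z * polarJacobian U V z‖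
        ≤ 4 * (M * (wirtingerNorm q U + wirtingerNorm q V) ^ 2) := by
      rw [e]
      refine (norm_add_le _ _).trans ?_
      have := norm_add₃_le
        (a := ∫ z, b z * complexJacobian (fun z => U z + 1 * starRingEnd ℂ (V z)) z)
        (b := I * (∫ z, b z * complexJacobian (fun z => U z + I * starRingEnd ℂ (V z)) z))
        (c := -1 * (∫ z, b z * complexJacobian (fun z => U z + -1 * starRingEnd ℂ (V z)) z))
      have h5 := hc 1 (by simp)
      have h6 := hc I (by simp)
      have h7 := hc (-1) (by simp)
      have h8 := hc (-I) (by simp)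
      rw [norm_mul, norm_mul, norm_neg, norm_one, norm_I, one_mul, one_mul] at this
      rw [norm_mul (-I), norm_neg, norm_I, one_mul]
      linarith
    rw [norm_mul, Complex.norm_ofNat] at h4
    linarith
  intro U V hU hV
  refine le_four_mul_of_forall_le_sq hM wirtingerNorm_nonneg wirtingerNorm_nonneg fun t ht => ?_
  have hU' := hU.const_mul (t : ℂ)
  have hV' := hV.const_mul ((t⁻¹ : ℝ) : ℂ)
  have h2 := h1 _ _ hU' hV'
  rw [wirtingerNorm_const_mul _ hU, wirtingerNorm_const_mul _ hV, norm_real, norm_real,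
    Real.norm_of_nonneg ht.le, Real.norm_of_nonneg (inv_nonneg.2 ht.le)] at h2
  refine le_trans (le_of_eq ?_) h2
  congr 2; ext z
  simp only [polarJacobian, dz_const_mul _ (hU.differentiable z),
    dzb_const_mul _ (hU.differentiable z), dz_const_mul _ (hV.differentiable z),
    dzb_const_mul _ (hV.differentiable z)]
  have : (t : ℂ) ≠ 0 := by exact_mod_cast ht.ne'
  push_cast; field_simp

/-! ### From the polarised Jacobian to the commutator form -/

/-- The density of the commutator form: `∫ b (S v · h - v · S h)` is the pairing of `b` with this
function, `S` being realised as `∂` of the Cauchy transform. -/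
noncomputable def commutatorDensity (v h : ℂ → ℂ) (z : ℂ) : ℂ :=
  dz (cauchyTransform v) z * h z - v z * dz (cauchyTransform h) z

lemma isTest_commutatorDensity {v h : ℂ → ℂ} (hv : IsTest v) (hh : IsTest h) :
    IsTest (commutatorDensity v h) :=
  (hh.smooth_mul (contDiff_dz (contDiff_cauchyTransform hv))).sub
    (hv.mul_smooth (contDiff_dz (contDiff_cauchyTransform hh)))

/-- On the annulus where the cutoff varies, `v` and `h` vanish and the terms quadratic in the
derivatives of the cutoff cancel, which leaves `O(R⁻⁴)`. -/
lemma exists_norm_polarJacobian_cutoff_sub_le {v h : ℂ → ℂ} (hv : IsTest v) (hh : IsTest h) : ∃ A K : ℝ,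
    0 < A ∧ 0 ≤ K ∧ ∀ R, A ≤ R → ∀ z,
      ‖polarJacobian (fun z => cutoff R z * cauchyTransform v z)
          (fun z => cutoff R z * cauchyTransform h z) z - commutatorDensity v h z‖
        ≤ (Metric.closedBall (0 : ℂ) (2 * R)).indicator (fun _ => K / R ^ 4) z := by
  obtain ⟨A1, C1, hA1, hC1, h1⟩ := exists_norm_cauchyTransform_le hv
  obtain ⟨A2, C2, hA2, hC2, h2⟩ := exists_norm_cauchyTransform_le hh
  obtain ⟨A3, C3, hA3, hC3, h3⟩ := exists_norm_dz_cauchyTransform_le hv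
  obtain ⟨A4, C4, hA4, hC4, h4⟩ := exists_norm_dz_cauchyTransform_le hh
  obtain ⟨ρ1, hρ1, hv0⟩ := hv.exists_radius
  obtain ⟨ρ2, hρ2, hh0⟩ := hh.exists_radius
  obtain ⟨E, hE, hER⟩ := exists_norm_fderiv_cutoff_le
  refine ⟨A1 + A2 + A3 + A4 + ρ1 + ρ2, E * (C3 * C2 + C1 * C4), by positivity, by positivity,
    fun R hR z => ?_⟩
  have hR0 : 0 < R := by linarith
  have hind : 0 ≤ (Metric.closedBall (0 : ℂ) (2 * R)).indicator
      (fun _ => E * (C3 * C2 + C1 * C4) / R ^ 4) z :=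
    Set.indicator_nonneg (fun _ _ => by positivity) _
  have hd (hz : ‖z‖ < R ∨ 2 * R < ‖z‖) : dz (cutoff R) z = 0 ∧ dzb (cutoff R) z = 0 := by
    have := fderiv_cutoff_eq_zero hR0 hz
    constructor <;> simp [dz, dzb, this]
  rw [polarJacobian, dz_cutoff_mul_cauchyTransform hv hR0, dz_cutoff_mul_cauchyTransform hh hR0,
    dzb_cutoff_mul_cauchyTransform hv hR0, dzb_cutoff_mul_cauchyTransform hh hR0, commutatorDensity]
  rcases lt_or_ge ‖z‖ R with hz | hz
  · rw [(hd (Or.inl hz)).1, (hd (Or.inl hz)).2, cutoff_eq_one hR0 hz.le]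
    simpa using hind
  have hvz : v z = 0 := hv0 z (by linarith)
  have hhz : h z = 0 := hh0 z (by linarith)
  rcases lt_or_ge (2 * R) ‖z‖ with hz2 | hz2
  · rw [(hd (Or.inr hz2)).1, (hd (Or.inr hz2)).2, cutoff_eq_zero hR0 hz2.le, hvz, hhz]
    simpa using hind
  rw [Set.indicator_of_mem (by simpa using hz2), hvz, hhz]
  set U := cauchyTransform v
  set V := cauchyTransform h
  have e : (dz (cutoff R) z * U z + cutoff R z * dz U z) * (dzb (cutoff R) z * V z + cutoff R z * 0)
      - (dzb (cutoff R) z * U z + cutoff R z * 0) * (dz (cutoff R) z * V z + cutoff R z * dz V z)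
      - (dz U z * 0 - 0 * dz V z)
      = cutoff R z * dzb (cutoff R) z * (dz U z * V z - U z * dz V z) := by ring
  have hz0 : 0 < ‖z‖ := by linarith
  have b1 : ‖U z‖ ≤ C1 / R := (h1 z (by linarith)).trans (by gcongr)
  have b2 : ‖V z‖ ≤ C2 / R := (h2 z (by linarith)).trans (by gcongr)
  have b3 : ‖dz U z‖ ≤ C3 / R ^ 2 := (h3 z (by linarith)).trans (by gcongr)
  have b4 : ‖dz V z‖ ≤ C4 / R ^ 2 := (h4 z (by linarith)).trans (by gcongr)
  rw [e, norm_mul, norm_mul]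
  calc ‖cutoff R z‖ * ‖dzb (cutoff R) z‖ * ‖dz U z * V z - U z * dz V z‖
      ≤ 1 * (E / R) * (C3 / R ^ 2 * (C2 / R) + C1 / R * (C4 / R ^ 2)) := by
        gcongr
        · exact norm_cutoff_le z
        · exact norm_dzb_le.trans (hER R hR0 z)
        · refine (norm_sub_le _ _).trans ?_
          rw [norm_mul, norm_mul]
          gcongr
    _ = E * (C3 * C2 + C1 * C4) / R ^ 4 := by field_simp

lemma lpNorm_le_mul_of_eLpNorm_le {q : ℝ≥0∞} {f g : ℂ → ℂ} {C : ℝ≥0} (hf : MemLp f q)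
    (hg : MemLp g q) (h : eLpNorm f q ≤ C * eLpNorm g q) :
    lpNorm f q volume ≤ C * lpNorm g q volume := by
  rw [← toReal_eLpNorm hf.1, ← toReal_eLpNorm hg.1]
  have := ENNReal.toReal_mono (ENNReal.mul_ne_top ENNReal.coe_ne_top hg.2.ne) h
  simpa using this

lemma BeurlingBound.wirtingerNorm_le {q : ℝ≥0∞} {C : ℝ≥0} (hB : BeurlingBound q C) {U : ℂ → ℂ}
    (hU : IsTest U) : wirtingerNorm q U ≤ (1 + C) * lpNorm (dzb U) q volume := by
  have := lpNorm_le_mul_of_eLpNorm_le ((isTest_dz hU).memLp q) ((isTest_dzb hU).memLp q) (hB U hU)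
  rw [wirtingerNorm]; linarith

lemma exists_tendsto_wirtingerNorm_cutoff_le {q : ℝ≥0∞} {C : ℝ≥0} (hB : BeurlingBound q C)
    (hq : 1 < q) {v : ℂ → ℂ} (hv : IsTest v) : ∃ N : ℕ → ℝ,
      Tendsto N atTop (𝓝 ((1 + C) * lpNorm v q volume)) ∧ ∀ n : ℕ,
        wirtingerNorm q (fun z => cutoff (n + 1) z * cauchyTransform v z) ≤ N n := by
  have hu (n : ℕ) := isTest_cutoff_mul_cauchyTransform hv (by positivity : (0 : ℝ) < n + 1)
  have ht := (ENNReal.tendsto_toReal ENNReal.zero_ne_top).comp (tendsto_eLpNorm_dzb_cutoff_mul hv hq)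
  refine ⟨_, (ht.add_const (lpNorm v q volume)).const_mul (1 + (C : ℝ)) |>.trans
    (le_of_eq (by simp)), fun n => ?_⟩
  refine (hB.wirtingerNorm_le (hu n)).trans ?_
  simp only [Function.comp]
  gcongr
  rw [toReal_eLpNorm (((isTest_dzb (hu n)).memLp q).sub (hv.memLp q)).1]
  have := lpNorm_add_le (g := v) (((isTest_dzb (hu n)).memLp q).sub (hv.memLp q)) hq.le
  rwa [sub_add_cancel] at this

/-- The commutator form is bounded for symbols of linear growth. For these the error committed by
cutting off the Cauchy transforms at radius `R` is `O(1 / R)`. -/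
lemma norm_integral_commutatorDensity_le_of_growth {q : ℝ≥0∞} {C : ℝ≥0} (hB : BeurlingBound q C)
    (hq : 1 < q) {b : ℂ → ℂ} (hb : Continuous b) {B : ℝ} (hgrow : ∀ z, ‖b z‖ ≤ B * (1 + ‖z‖))
    {L : ℝ} (hL : 0 ≤ L) (hbL : ∀ U V, IsTest U → IsTest V →
      ‖∫ z, b z * polarJacobian U V z‖ ≤ L * wirtingerNorm q U * wirtingerNorm q V)
    {v h : ℂ → ℂ} (hv : IsTest v) (hh : IsTest h) :
    ‖∫ z, b z * commutatorDensity v h z‖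
      ≤ L * ((1 + C) * lpNorm v q volume) * ((1 + C) * lpNorm h q volume) := by
  obtain ⟨N1, hN1, hN1'⟩ := exists_tendsto_wirtingerNorm_cutoff_le hB hq hv
  obtain ⟨N2, hN2, hN2'⟩ := exists_tendsto_wirtingerNorm_cutoff_le hB hq hh
  obtain ⟨A, K, hA, hK, hAK⟩ := exists_norm_polarJacobian_cutoff_sub_le hv hh
  have hu (n : ℕ) := isTest_cutoff_mul_cauchyTransform hv (by positivity : (0 : ℝ) < n + 1)
  have hw (n : ℕ) := isTest_cutoff_mul_cauchyTransform hh (by positivity : (0 : ℝ) < n + 1)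
  have hB0 : 0 ≤ B := by simpa using (norm_nonneg _).trans (hgrow 0)
  have hpi := Real.pi_pos
  have hNt : Tendsto (fun n : ℕ => (n : ℝ) + 1) atTop atTop :=
    tendsto_atTop_add_const_right _ _ tendsto_natCast_atTop_atTop
  have hbl := hb.locallyIntegrable (μ := (volume : Measure ℂ))
  set P : ℕ → ℂ → ℂ := fun n => polarJacobian (fun z => cutoff (n + 1) z * cauchyTransform v z)
    (fun z => cutoff (n + 1) z * cauchyTransform h z) with hP
  have hPt (n) : IsTest (P n) := isTest_polarJacobian (hu n) (hw n)
  have hD := isTest_commutatorDensity hv hh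
  have hlim : Tendsto (fun n : ℕ => ∫ z, b z * P n z) atTop
      (𝓝 (∫ z, b z * commutatorDensity v h z)) := by
    rw [tendsto_iff_norm_sub_tendsto_zero]
    have h0 : Tendsto (fun R : ℝ => 12 * Real.pi * B * K * R⁻¹) atTop (𝓝 0) := by
      simpa using tendsto_inv_atTop_zero.const_mul (12 * Real.pi * B * K)
    refine squeeze_zero' (Eventually.of_forall fun _ => norm_nonneg _) ?_ (h0.comp hNt)
    filter_upwards [hNt.eventually_ge_atTop A] with n hn
    set R : ℝ := (n : ℝ) + 1 with hR
    have hR1 : 1 ≤ R := by rw [hR]; linarith [Nat.cast_nonneg (α := ℝ) n]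
    rw [← integral_sub (integrable_mul_isTest hbl (hPt n)) (integrable_mul_isTest hbl hD)]
    have hbd (z : ℂ) : ‖b z * P n z - b z * commutatorDensity v h z‖
        ≤ (Metric.closedBall (0 : ℂ) (2 * R)).indicator (fun _ => 3 * B * K / R ^ 3) z := by
      have h1 := hAK R hn z
      rw [← mul_sub, norm_mul]
      by_cases hz : z ∈ Metric.closedBall (0 : ℂ) (2 * R)
      · rw [Set.indicator_of_mem hz] at h1 ⊢
        have hz' : ‖z‖ ≤ 2 * R := by simpa using hz
        calc ‖b z‖ * ‖P n z - commutatorDensity v h z‖ ≤ (B * (3 * R)) * (K / R ^ 4) := by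
              refine mul_le_mul ((hgrow z).trans ?_) h1 (norm_nonneg _) (by positivity)
              gcongr; linarith
          _ = 3 * B * K / R ^ 3 := by field_simp
      · rw [Set.indicator_of_notMem hz] at h1 ⊢
        rw [le_antisymm h1 (norm_nonneg _), mul_zero]
    refine (norm_integral_le_of_norm_le ?_ (Eventually.of_forall hbd)).trans ?_
    · exact (integrableOn_const measure_closedBall_lt_top.ne).integrable_indicator measurableSet_closedBall
    · have hv : volume.real (Metric.closedBall (0 : ℂ) (2 * R)) = 4 * Real.pi * R ^ 2 := by
        rw [Measure.real, Complex.volume_closedBall]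
        simp [ENNReal.toReal_ofReal (by linarith : 0 ≤ R)]; ring
      rw [integral_indicator measurableSet_closedBall, setIntegral_const, hv]
      simp only [smul_eq_mul, Function.comp]
      apply le_of_eq; field_simp; ring
  refine le_of_tendsto_of_tendsto hlim.norm ((hN1.const_mul L).mul hN2)
    (Eventually.of_forall fun n => ?_)
  refine (hbL _ _ (hu n) (hw n)).trans ?_
  have w1 := wirtingerNorm_nonneg (q := q) (U := fun z => cutoff (n + 1) z * cauchyTransform v z)
  have w2 := wirtingerNorm_nonneg (q := q) (U := fun z => cutoff (n + 1) z * cauchyTransform h z)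
  exact mul_le_mul (mul_le_mul_of_nonneg_left (hN1' n) hL) (hN2' n) w2
    (mul_nonneg hL (w1.trans (hN1' n)))

/-! ### Mollification of the symbol -/

/-- The convolution `ρ * b`. -/
noncomputable def mollify (ρ b : ℂ → ℂ) (x : ℂ) : ℂ := ∫ y, ρ y * b (x - y)

section mollify

open scoped Convolution

variable {ρ b : ℂ → ℂ} (hρ : IsTest ρ) (hb : LocallyIntegrable b)

lemma mollify_eq_convolution (ρ b : ℂ → ℂ) :
    mollify ρ b = ρ ⋆[ContinuousLinearMap.mul ℝ ℂ] b := rfl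

include hρ hb

lemma contDiff_mollify : ContDiff ℝ ∞ (mollify ρ b) :=
  hρ.2.contDiff_convolution_left (ContinuousLinearMap.mul ℝ ℂ) hρ.1 hb

lemma fderiv_mollify (x v : ℂ) :
    fderiv ℝ (mollify ρ b) x v = mollify (fun y => fderiv ℝ ρ y v) b x := by
  have h := hρ.2.hasFDerivAt_convolution_left (ContinuousLinearMap.mul ℝ ℂ)
    (hρ.1.of_le (by norm_cast)) hb x
  rw [mollify_eq_convolution, h.fderiv]
  rw [convolution_def, ContinuousLinearMap.integral_apply]
  · rfl
  · exact (hρ.2.fderiv (𝕜 := ℝ)).convolutionExists_left _ (hρ.1.continuous_fderiv (by simp)) hb x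

lemma integrable_mollify_integrand (x : ℂ) : Integrable fun y => ρ y * b (x - y) :=
  (hρ.2.convolutionExists_left (ContinuousLinearMap.mul ℝ ℂ) hρ.continuous hb) x

lemma dz_mollify (x : ℂ) : dz (mollify ρ b) x = mollify (dz ρ) b x := by
  have i (v : ℂ) := integrable_mollify_integrand (hρ.fderiv_apply v) hb x
  rw [dz, fderiv_mollify hρ hb, fderiv_mollify hρ hb]
  simp only [mollify]
  rw [← integral_const_mul, ← integral_sub (i 1) ((i I).const_mul I), ← integral_div]
  congr 1; ext y; simp only [dz]; ring

lemma dzb_mollify (x : ℂ) : dzb (mollify ρ b) x = mollify (dzb ρ) b x := by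
  have i (v : ℂ) := integrable_mollify_integrand (hρ.fderiv_apply v) hb x
  rw [dzb, fderiv_mollify hρ hb, fderiv_mollify hρ hb]
  simp only [mollify]
  rw [← integral_const_mul, ← integral_add (i 1) ((i I).const_mul I), ← integral_div]
  congr 1; ext y; simp only [dzb]; ring

lemma integral_mollify_mul {G : ℂ → ℂ} (hG : IsTest G) :
    ∫ x, mollify ρ b x * G x = ∫ y, ρ y * ∫ x, b x * G (x + y) := by
  obtain ⟨r1, hr1, hρ0⟩ := hρ.exists_radius
  obtain ⟨r2, hr2, hG0⟩ := hG.exists_radius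
  obtain ⟨M, hM0, hM⟩ := hG.exists_bound
  set b' := (Metric.closedBall (0 : ℂ) (r1 + r2)).indicator b with hb'
  have hb'i : Integrable b' := (hb.integrableOn_isCompact
    (isCompact_closedBall _ _)).integrable_indicator measurableSet_closedBall
  have key (x y : ℂ) : ρ y * b (x - y) * G x = ρ y * b' (x - y) * G x := by
    by_cases hx : G x = 0
    · simp [hx]
    by_cases hy : ρ y = 0
    · simp [hy]
    rw [hb', Set.indicator_of_mem]
    have h1 : ‖x‖ ≤ r2 := by by_contra h; exact hx (hG0 x (not_le.1 h))
    have h2 : ‖y‖ ≤ r1 := by by_contra h; exact hy (hρ0 y (not_le.1 h))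
    have := norm_sub_le x y
    rw [mem_closedBall_zero_iff]; linarith
  have hint : Integrable (fun p : ℂ × ℂ => ρ p.2 * b (p.1 - p.2) * G p.1)
      ((volume : Measure ℂ).prod volume) := by
    simp_rw [key]
    refine (Integrable.convolution_integrand (ContinuousLinearMap.mul ℝ ℂ) hρ.integrable
      hb'i).mul_bdd (c := M) ?_ (Eventually.of_forall fun p => hM _)
    exact (hG.continuous.comp continuous_fst).aestronglyMeasurable
  simp_rw [mollify, ← integral_mul_const]
  rw [integral_integral_swap hint]
  congr 1; ext y
  rw [← integral_const_mul, ← integral_add_right_eq_self _ y]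
  simp only [add_sub_cancel_right, mul_assoc]

end mollify

lemma mollify_eq_integral_mul (g b : ℂ → ℂ) (x : ℂ) : mollify g b x = ∫ t, b t * g (x - t) := by
  rw [mollify, ← integral_sub_left_eq_self _ volume x]
  simp only [sub_sub_cancel, mul_comm]

section bilinear

variable {q : ℝ≥0∞} {ρ b : ℂ → ℂ} {L : ℝ} (hρ : IsTest ρ) (hb : LocallyIntegrable b)
  (hbL : ∀ U V, IsTest U → IsTest V →
    ‖∫ z, b z * polarJacobian U V z‖ ≤ L * wirtingerNorm q U * wirtingerNorm q V)

include hρ hb hbL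

lemma norm_integral_mollify_polarJacobian_le (hρ1 : ∫ y, ‖ρ y‖ = 1) {U V : ℂ → ℂ} (hU : IsTest U)
    (hV : IsTest V) :
    ‖∫ z, mollify ρ b z * polarJacobian U V z‖ ≤ L * wirtingerNorm q U * wirtingerNorm q V := by
  rw [integral_mollify_mul hρ hb (isTest_polarJacobian hU hV)]
  have h (y : ℂ) : ‖∫ x, b x * polarJacobian U V (x + y)‖
      ≤ L * wirtingerNorm q U * wirtingerNorm q V := by
    have := hbL _ _ (hU.comp_add y) (hV.comp_add y)
    simp_rw [polarJacobian_comp_add] at this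
    rwa [wirtingerNorm_comp_add hU, wirtingerNorm_comp_add hV] at this
  calc ‖∫ y, ρ y * ∫ x, b x * polarJacobian U V (x + y)‖
      ≤ ∫ y, ‖ρ y‖ * (L * wirtingerNorm q U * wirtingerNorm q V) := by
        refine norm_integral_le_of_norm_le (hρ.integrable.norm.mul_const _)
          (Eventually.of_forall fun y => ?_)
        rw [norm_mul]
        exact mul_le_mul_of_nonneg_left (h y) (norm_nonneg _)
    _ = L * wirtingerNorm q U * wirtingerNorm q V := by rw [integral_mul_const, hρ1, one_mul]

omit hρ hb in
/-- The value at `x` is the pairing of `b` with a reflected and translated polarised Jacobian. -/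
lemma norm_mollify_polarJacobian_le {U V : ℂ → ℂ} (hU : IsTest U) (hV : IsTest V) (x : ℂ) :
    ‖mollify (polarJacobian U V) b x‖ ≤ L * wirtingerNorm q U * wirtingerNorm q V := by
  have := hbL _ _ (hU.comp_sub_left x) (hV.comp_sub_left x)
  simp_rw [polarJacobian_comp_sub_left hU hV] at this
  rwa [wirtingerNorm_comp_sub_left hU, wirtingerNorm_comp_sub_left hV,
    ← mollify_eq_integral_mul] at this

omit hb hbL in
/-- Derivatives of test functions are Jacobians, the second component being a coordinate function
near the support. -/
lemma exists_polarJacobian_eq_dz : ∃ V W : ℂ → ℂ, IsTest V ∧ IsTest W ∧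
    polarJacobian ρ V = dz ρ ∧ polarJacobian W ρ = dzb ρ := by
  obtain ⟨r, hr, hr0⟩ := hρ.exists_radius
  have hR : 0 < r + 1 := by linarith
  have hV : IsTest fun z => cutoff (r + 1) z * starRingEnd ℂ z :=
    (isTest_cutoff hR).mul_smooth (Complex.conjCLE : ℂ →L[ℝ] ℂ).contDiff
  have hW : IsTest fun z => cutoff (r + 1) z * z := (isTest_cutoff hR).mul_smooth contDiff_id
  have hρd {z : ℂ} (hz : r + 1 ≤ ‖z‖) : dz ρ z = 0 ∧ dzb ρ z = 0 := by
    have : ρ =ᶠ[𝓝 z] fun _ => 0 := by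
      filter_upwards [(isOpen_lt continuous_const continuous_norm).mem_nhds
        (by linarith : r < ‖z‖)] with w hw using hr0 w hw
    constructor <;> simp [dz, dzb, this.fderiv_eq]
  have hid (z : ℂ) : dz (fun w => w) z = 1 ∧ dzb (fun w => w) z = 0 := by
    constructor <;> simp [dz, dzb]
  have hev {z : ℂ} (hz : ‖z‖ < r + 1) (g : ℂ → ℂ) :
      (fun z => cutoff (r + 1) z * g z) =ᶠ[𝓝 z] g := by
    filter_upwards [(isOpen_lt continuous_norm continuous_const).mem_nhds hz] with w hw
    rw [cutoff_eq_one hR (le_of_lt hw), one_mul]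
  refine ⟨_, _, hV, hW, funext fun z => ?_, funext fun z => ?_⟩
  · rw [polarJacobian]
    rcases lt_or_ge ‖z‖ (r + 1) with hz | hz
    · rw [dzb_eq_of_eventuallyEq (hev hz _), dz_eq_of_eventuallyEq (hev hz _),
        dzb_conj (f := fun w => w) differentiableAt_fun_id,
        dz_conj (f := fun w => w) differentiableAt_fun_id, (hid z).1, (hid z).2]
      simp
    · rw [(hρd hz).1, (hρd hz).2]; ring
  · rw [polarJacobian]
    rcases lt_or_ge ‖z‖ (r + 1) with hz | hz
    · rw [dzb_eq_of_eventuallyEq (hev hz _), dz_eq_of_eventuallyEq (hev hz _), (hid z).1, (hid z).2]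
      ring
    · rw [(hρd hz).1, (hρd hz).2]; ring

/-- The mollified symbol has bounded gradient, hence linear growth. -/
lemma exists_norm_mollify_le : ∃ B, ∀ z, ‖mollify ρ b z‖ ≤ B * (1 + ‖z‖) := by
  obtain ⟨V, W, hV, hW, e1, e2⟩ := exists_polarJacobian_eq_dz hρ
  set c1 := L * wirtingerNorm q ρ * wirtingerNorm q V
  set c2 := L * wirtingerNorm q W * wirtingerNorm q ρ
  have h1 (x : ℂ) : ‖dz (mollify ρ b) x‖ ≤ c1 := by
    rw [dz_mollify hρ hb, ← e1]; exact norm_mollify_polarJacobian_le hbL hρ hV x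
  have h2 (x : ℂ) : ‖dzb (mollify ρ b) x‖ ≤ c2 := by
    rw [dzb_mollify hρ hb, ← e2]; exact norm_mollify_polarJacobian_le hbL hW hρ x
  have hc1 := (norm_nonneg _).trans (h1 0)
  have hc2 := (norm_nonneg _).trans (h2 0)
  have hd (x : ℂ) : ‖fderiv ℝ (mollify ρ b) x‖ ≤ 2 * (c1 + c2) := by
    refine ContinuousLinearMap.opNorm_le_bound _ (by positivity) fun v => ?_
    have e : fderiv ℝ (mollify ρ b) x v
        = v.re * fderiv ℝ (mollify ρ b) x 1 + v.im * fderiv ℝ (mollify ρ b) x I := by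
      have : v = v.re • (1 : ℂ) + v.im • I := by
        simp [real_smul, re_add_im]
      conv_lhs => rw [this]
      rw [map_add, map_smul, map_smul, real_smul, real_smul]
    rw [e, fderiv_one_eq, fderiv_I_eq]
    have b1 := norm_add_le (dz (mollify ρ b) x) (dzb (mollify ρ b) x)
    have b2 := norm_sub_le (dz (mollify ρ b) x) (dzb (mollify ρ b) x)
    refine (norm_add_le _ _).trans ?_
    rw [norm_mul, norm_mul, norm_mul, norm_I, one_mul, norm_real, norm_real, Real.norm_eq_abs,
      Real.norm_eq_abs]
    have r1 := abs_re_le_norm v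
    have r2 := abs_im_le_norm v
    calc |v.re| * ‖dz (mollify ρ b) x + dzb (mollify ρ b) x‖
          + |v.im| * ‖dz (mollify ρ b) x - dzb (mollify ρ b) x‖
        ≤ ‖v‖ * (c1 + c2) + ‖v‖ * (c1 + c2) := by
          gcongr
          · exact b1.trans (add_le_add (h1 x) (h2 x))
          · exact b2.trans (add_le_add (h1 x) (h2 x))
      _ = 2 * (c1 + c2) * ‖v‖ := by ring
  refine ⟨‖mollify ρ b 0‖ + 2 * (c1 + c2), fun z => ?_⟩
  have h3 := (convex_univ (𝕜 := ℝ) (E := ℂ)).norm_image_sub_le_of_norm_fderiv_le (𝕜 := ℝ)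
    (fun x _ => (contDiff_mollify hρ hb).differentiable (by simp) x) (fun x _ => hd x)
    (Set.mem_univ 0) (Set.mem_univ z)
  have h4 := norm_le_norm_add_norm_sub' (mollify ρ b z) (mollify ρ b 0)
  rw [sub_zero] at h3
  nlinarith [norm_nonneg (mollify ρ b 0), norm_nonneg z,
    mul_nonneg (norm_nonneg (mollify ρ b 0)) (norm_nonneg z)]

end bilinear

/-- The key estimate: a symbol whose integrals against polarised Jacobians are bounded gives rise to
a bounded commutator form. The estimate for mollified symbols is uniform in the mollifier. -/
theorem norm_integral_commutatorDensity_le {q : ℝ≥0∞} {C : ℝ≥0} (hB : BeurlingBound q C)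
    (hq : 1 < q) {b : ℂ → ℂ} (hb : LocallyIntegrable b) {L : ℝ} (hL : 0 ≤ L)
    (hbL : ∀ U V, IsTest U → IsTest V →
      ‖∫ z, b z * polarJacobian U V z‖ ≤ L * wirtingerNorm q U * wirtingerNorm q V)
    {v h : ℂ → ℂ} (hv : IsTest v) (hh : IsTest h) :
    ‖∫ z, b z * commutatorDensity v h z‖
      ≤ L * ((1 + C) * lpNorm v q volume) * ((1 + C) * lpNorm h q volume) := by
  set X := L * ((1 + C) * lpNorm v q volume) * ((1 + C) * lpNorm h q volume) with hX
  set D := commutatorDensity v h with hD_def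
  have hD : IsTest D := isTest_commutatorDensity hv hh
  have hDn : IsTest fun w => D (0 - w) := hD.comp_sub_left 0
  set Φ : ℂ → ℂ := fun y => ∫ x, b x * D (x - y) with hΦ
  have hΦc : Continuous Φ := by
    have := hDn.2.continuous_convolution_right (ContinuousLinearMap.mul ℝ ℂ) hb hDn.continuous
    refine this.congr fun y => ?_
    rw [convolution_def, hΦ]
    congr 1; ext x
    simp
  -- `Φ` is the form of the translated symbol; its averages are the forms of mollified symbols
  have key (φ : ContDiffBump (0 : ℂ)) :
      ‖∫ y, ((φ.normed volume y : ℝ) : ℂ) * Φ (0 - y)‖ ≤ X := by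
    have hρ : IsTest fun y => ((φ.normed volume y : ℝ) : ℂ) :=
      IsTest.ofReal ⟨φ.contDiff_normed, φ.hasCompactSupport_normed⟩
    have hρ1 : ∫ y, ‖((φ.normed volume y : ℝ) : ℂ)‖ = 1 := by
      rw [← φ.integral_normed (μ := volume)]
      congr 1; ext y
      rw [norm_real, Real.norm_of_nonneg (φ.nonneg_normed y)]
    have h1 := integral_mollify_mul hρ hb hD
    obtain ⟨B, hBz⟩ := exists_norm_mollify_le hρ hb hbL
    have h2 := norm_integral_commutatorDensity_le_of_growth hB hq
      (contDiff_mollify hρ hb).continuous hBz hL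
      (fun U V hU hV => norm_integral_mollify_polarJacobian_le hρ hb hbL hρ1 hU hV) hv hh
    rw [h1] at h2
    refine le_trans (le_of_eq ?_) h2
    congr 2; ext y
    simp only [hΦ, zero_sub, sub_neg_eq_add]
  have e0 : ∫ z, b z * D z = Φ 0 := by simp [hΦ]
  rw [e0]
  refine le_of_forall_pos_le_add fun η hη => ?_
  obtain ⟨δ, hδ, hδη⟩ := Metric.continuousAt_iff.1 hΦc.continuousAt η hη
  set φ : ContDiffBump (0 : ℂ) := ⟨δ / 2, δ, by positivity, by linarith⟩ with hφ
  have h3 := φ.dist_normed_convolution_le (μ := volume) (g := Φ) (x₀ := 0) (ε := η)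
    hΦc.aestronglyMeasurable (fun x hx => (hδη (by simpa [hφ] using hx)).le)
  rw [convolution_def] at h3
  have h4 : ‖∫ y, (ContinuousLinearMap.lsmul ℝ ℝ) (φ.normed volume y) (Φ (0 - y))‖ ≤ X := by
    refine le_trans (le_of_eq ?_) (key φ)
    congr 2
  rw [dist_comm, dist_eq_norm] at h3
  have h5 := norm_le_norm_add_norm_sub' (Φ 0)
    (∫ y, (ContinuousLinearMap.lsmul ℝ ℝ) (φ.normed volume y) (Φ (0 - y)))
  linarith

/-! ### The commutator as a distribution -/

/-- The kernel `w⁻²` off the disc of radius `ε`, and zero on it. -/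
noncomputable def truncKernel (ε : ℝ) : ℂ → ℂ := {w : ℂ | ε < ‖w‖}.indicator fun w => 1 / w ^ 2

lemma truncKernel_neg (ε : ℝ) (w : ℂ) : truncKernel ε (-w) = truncKernel ε w := by
  by_cases hw : ε < ‖w‖
  · rw [truncKernel, Set.indicator_of_mem (by simpa using hw), Set.indicator_of_mem (by exact hw)]
    simp
  · rw [truncKernel, Set.indicator_of_notMem (by simpa using hw),
      Set.indicator_of_notMem (by exact hw)]

lemma measurable_truncKernel (ε : ℝ) : Measurable (truncKernel ε) :=
  Measurable.indicator (by fun_prop) (measurableSet_lt measurable_const measurable_norm)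

lemma norm_truncKernel_le {ε : ℝ} (hε : 0 < ε) (w : ℂ) : ‖truncKernel ε w‖ ≤ 1 / ε ^ 2 := by
  by_cases hw : ε < ‖w‖
  · rw [truncKernel, Set.indicator_of_mem (by exact hw), norm_div, norm_one, norm_pow]
    gcongr
  · rw [truncKernel, Set.indicator_of_notMem (by exact hw), norm_zero]; positivity

lemma truncBeurling_eq_integral_truncKernel (ε : ℝ) (f : ℂ → ℂ) (z : ℂ) :
    truncBeurling ε f z = -(1 / (Real.pi : ℂ)) * ∫ y, f y * truncKernel ε (z - y) := by
  rw [truncBeurling_eq_integral_mul]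
  rfl

lemma measurable_truncBeurling (ε : ℝ) {f : ℂ → ℂ} (hf : Continuous f) :
    Measurable (truncBeurling ε f) := by
  have : StronglyMeasurable fun z => ∫ y, f y * truncKernel ε (z - y) := by
    refine StronglyMeasurable.integral_prod_right (f := fun z y => f y * truncKernel ε (z - y)) ?_
    exact (hf.comp continuous_snd).stronglyMeasurable.mul
      ((measurable_truncKernel ε).comp (by fun_prop : Measurable fun p : ℂ × ℂ =>
        p.1 - p.2)).stronglyMeasurable
  have e : truncBeurling ε f = fun z => -(1 / (Real.pi : ℂ)) * ∫ y, f y * truncKernel ε (z - y) :=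
    funext fun z => truncBeurling_eq_integral_truncKernel ε f z
  rw [e]
  exact measurable_const.mul this.measurable

/-- Truncated Beurling transforms are symmetric for the bilinear pairing. -/
lemma integral_truncBeurling_mul {ε : ℝ} (hε : 0 < ε) {f g : ℂ → ℂ} (hf : Integrable f)
    (hg : Integrable g) : Integrable (fun z => truncBeurling ε f z * g z) ∧
      ∫ z, truncBeurling ε f z * g z = ∫ z, f z * truncBeurling ε g z := by
  have hint : Integrable (fun p : ℂ × ℂ => f p.2 * truncKernel ε (p.1 - p.2) * g p.1)
      ((volume : Measure ℂ).prod volume) := by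
    have := (hg.mul_prod hf).mul_bdd (c := 1 / ε ^ 2)
      (f := fun p : ℂ × ℂ => g p.1 * f p.2) (g := fun p => truncKernel ε (p.1 - p.2))
      ((measurable_truncKernel ε).comp (by fun_prop)).aestronglyMeasurable
      (Eventually.of_forall fun p => norm_truncKernel_le hε _)
    refine this.congr (Eventually.of_forall fun p => ?_)
    simp only; ring
  have e1 (z : ℂ) : truncBeurling ε f z * g z
      = -(1 / (Real.pi : ℂ)) * ∫ y, f y * truncKernel ε (z - y) * g z := by
    rw [truncBeurling_eq_integral_truncKernel, integral_mul_const, mul_assoc]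
  have e2 (y : ℂ) : f y * truncBeurling ε g y
      = -(1 / (Real.pi : ℂ)) * ∫ z, f y * truncKernel ε (z - y) * g z := by
    rw [truncBeurling_eq_integral_truncKernel, mul_left_comm, ← integral_const_mul]
    congr 2; ext z
    rw [← truncKernel_neg ε (y - z), neg_sub]; ring
  simp_rw [e1, e2]
  refine ⟨hint.integral_prod_left.const_mul _, ?_⟩
  rw [integral_const_mul, integral_const_mul, integral_integral_swap hint]

lemma norm_ballAvg_le {F : ℂ → ℂ} {z : ℂ} {ε S : ℝ} (hε : 0 < ε)
    (hS : ∀ w ∈ Metric.closedBall z ε, ‖F w‖ ≤ S) : ‖ballAvg F z ε‖ ≤ S := by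
  have hv : volume.real (Metric.closedBall z ε) = Real.pi * ε ^ 2 := by
    rw [Measure.real, Complex.volume_closedBall]; simp [hε.le, mul_comm]
  have hpos : 0 < Real.pi * ε ^ 2 := by have := Real.pi_pos; positivity
  have h2 := norm_setIntegral_le_of_norm_le_const (μ := volume) measure_closedBall_lt_top hS
  rw [ballAvg, norm_mul, ← ofReal_pow, ← ofReal_mul, norm_div, norm_real,
    Real.norm_of_nonneg hpos.le, norm_one, one_div, inv_mul_le_iff₀ hpos, ← hv, mul_comm]
  exact h2

/-- For a test function the averages are those of the smooth function `∂` of its Cauchy transform. -/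
lemma truncBeurling_isTest {f : ℂ → ℂ} (hf : IsTest f) {ε : ℝ} (hε : 0 < ε) (z : ℂ) :
    truncBeurling ε f z = ballAvg (dz (cauchyTransform f)) z ε := by
  obtain ⟨C, hC⟩ := exists_beurlingBound (r := 2) (by norm_num) (by norm_num)
  exact (isBeurling_dz_cauchyTransform hC (by norm_num) (by norm_num) hf).truncBeurling_eq
    (by norm_num) (by norm_num) hε z

lemma tendsto_integral_mul_truncBeurling {f g : ℂ → ℂ} (hf : IsTest f) (hg : Integrable g) {R : ℝ}
    (hR : ∀ z, R < ‖z‖ → g z = 0) :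
    Tendsto (fun ε : ℝ => ∫ z, g z * truncBeurling ε f z) (𝓝[>] 0)
      (𝓝 (∫ z, g z * dz (cauchyTransform f) z)) := by
  have hc := (contDiff_dz (contDiff_cauchyTransform hf)).continuous
  obtain ⟨S, hS⟩ := (isCompact_closedBall (0 : ℂ) (R + 1)).exists_bound_of_continuousOn
    hc.continuousOn
  refine tendsto_integral_filter_of_dominated_convergence (fun z => ‖g z‖ * S) ?_ ?_
    (hg.norm.mul_const S) ?_
  · exact Eventually.of_forall fun ε =>
      hg.1.mul (measurable_truncBeurling ε hf.continuous).aestronglyMeasurable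
  · filter_upwards [Ioc_mem_nhdsGT one_pos] with ε hε
    refine Eventually.of_forall fun z => ?_
    rcases lt_or_ge R ‖z‖ with hz | hz
    · rw [hR z hz]; simp
    rw [norm_mul, truncBeurling_isTest hf hε.1]
    refine mul_le_mul_of_nonneg_left (norm_ballAvg_le hε.1 fun w hw => hS w ?_) (norm_nonneg _)
    have h1 := norm_le_norm_add_norm_sub' w z
    have h2 : ‖w - z‖ ≤ ε := by simpa [dist_eq_norm] using hw
    rw [mem_closedBall_zero_iff]
    linarith [hε.2]
  · refine Eventually.of_forall fun z => ((tendsto_ballAvg hc z).congr' ?_).const_mul _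
    filter_upwards [self_mem_nhdsWithin] with ε (hε : 0 < ε)
    exact (truncBeurling_isTest hf hε z).symm

/-- The distributional commutator, tested against `φ`. -/
lemma tendsto_distribCommutator {b v φ : ℂ → ℂ} (hb : LocallyIntegrable b) (hv : IsTest v)
    (hφ : IsTest φ) : Tendsto (fun ε : ℝ => ∫ z, (b z * truncBeurling ε v z
        - truncBeurling ε (fun y => b y * v y) z) * φ z) (𝓝[>] 0)
      (𝓝 (∫ z, b z * commutatorDensity v φ z)) := by
  obtain ⟨R1, -, h1⟩ := hφ.exists_radius
  obtain ⟨R2, -, h2⟩ := hv.exists_radius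
  have ibφ := integrable_mul_isTest hb hφ
  have ibv := integrable_mul_isTest hb hv
  have t1 := tendsto_integral_mul_truncBeurling hv ibφ (R := R1) fun z hz => by rw [h1 z hz, mul_zero]
  have t2 := tendsto_integral_mul_truncBeurling hφ ibv (R := R2) fun z hz => by rw [h2 z hz, mul_zero]
  have e : ∫ z, b z * commutatorDensity v φ z = (∫ z, b z * φ z * dz (cauchyTransform v) z)
      - ∫ z, b z * v z * dz (cauchyTransform φ) z := by
    have i1 := integrable_mul_isTest hb (hφ.mul_smooth (contDiff_dz (contDiff_cauchyTransform hv)))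
    have i2 := integrable_mul_isTest hb (hv.mul_smooth (contDiff_dz (contDiff_cauchyTransform hφ)))
    simp_rw [← mul_assoc] at i1 i2
    rw [← integral_sub i1 i2]
    congr 1; ext z; rw [commutatorDensity]; ring
  rw [e]
  refine (t1.sub t2).congr' ?_
  filter_upwards [self_mem_nhdsWithin] with ε (hε : 0 < ε)
  obtain ⟨j1, e1⟩ := integral_truncBeurling_mul hε hv.integrable ibφ
  obtain ⟨j2, e2⟩ := integral_truncBeurling_mul hε ibv hφ.integrable
  rw [← e2]
  have e3 (z : ℂ) : b z * φ z * truncBeurling ε v z = truncBeurling ε v z * (b z * φ z) :=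
    mul_comm _ _
  simp_rw [e3]
  rw [← integral_sub j1 j2]
  congr 1; ext z; ring

lemma isDistribCommutator_iff {b v w : ℂ → ℂ} (hb : LocallyIntegrable b) (hv : IsTest v) :
    IsDistribCommutator b v w ↔
      ∀ φ, IsTest φ → ∫ z, w z * φ z = ∫ z, b z * commutatorDensity v φ z := by
  refine ⟨fun h φ hφ => tendsto_nhds_unique (h φ hφ) (tendsto_distribCommutator hb hv hφ),
    fun h φ hφ => ?_⟩
  rw [h φ hφ]
  exact tendsto_distribCommutator hb hv hφ

/-! ### Representation of bounded functionals on `L^q` -/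

/-- Clarkson's inequality for complex numbers. -/
lemma norm_half_add_rpow_add_norm_half_sub_rpow_le {Q : ℝ} (hQ : 2 ≤ Q) (a b : ℂ) :
    ‖1 / 2 * (a + b)‖ ^ Q + ‖1 / 2 * (a - b)‖ ^ Q ≤ (‖a‖ ^ Q + ‖b‖ ^ Q) / 2 := by
  have hs : 1 ≤ Q / 2 := by linarith
  have hsq (x : ℂ) : ‖x‖ ^ Q = (‖x‖ ^ 2) ^ (Q / 2) := by
    rw [← Real.rpow_natCast, ← Real.rpow_mul (norm_nonneg _)]
    congr 1; push_cast; ring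
  have hpar : ‖1 / 2 * (a + b)‖ ^ 2 + ‖1 / 2 * (a - b)‖ ^ 2
      = (1 / 2 : ℝ) • ‖a‖ ^ 2 + (1 / 2 : ℝ) • ‖b‖ ^ 2 := by
    have h := parallelogram_law_with_norm ℝ a b
    rw [norm_mul, norm_mul, mul_pow, mul_pow, norm_div, norm_one, Complex.norm_ofNat, smul_eq_mul,
      smul_eq_mul]
    linarith
  rw [hsq, hsq, hsq a, hsq b]
  refine (Real.add_rpow_le_rpow_add (by positivity) (by positivity) hs).trans ?_
  rw [hpar]
  refine ((convexOn_rpow hs).2 (Set.mem_Ici.2 (by positivity)) (Set.mem_Ici.2 (by positivity))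
    (by norm_num) (by norm_num) (by norm_num)).trans (le_of_eq ?_)
  simp only [smul_eq_mul]; ring

section representation

variable {q : ℝ≥0∞} {f g : ℂ → ℂ}

lemma lpNorm_rpow (hq : 1 ≤ q) (hq' : q ≠ ⊤) (hf : MemLp f q) :
    lpNorm f q volume ^ q.toReal = ∫ z, ‖f z‖ ^ q.toReal := by
  have h0 : q ≠ 0 := (zero_lt_one.trans_le hq).ne'
  have h1 : q.toReal ≠ 0 := (ENNReal.toReal_pos h0 hq').ne'
  rw [lpNorm_eq_integral_norm_rpow_toReal h0 hq' hf.1, ← Real.rpow_mul (by positivity),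
    inv_mul_cancel₀ h1, Real.rpow_one]

lemma lpNorm_const_mul (c : ℂ) (f : ℂ → ℂ) :
    lpNorm (fun z => c * f z) q volume = ‖c‖ * lpNorm f q volume := by
  rw [← coe_nnnorm, ← lpNorm_const_smul]; rfl

lemma clarkson_lpNorm (hq : 2 ≤ q) (hq' : q ≠ ⊤) (hf : MemLp f q) (hg : MemLp g q) :
    lpNorm (fun z => 1 / 2 * (f z + g z)) q volume ^ q.toReal
      + lpNorm (fun z => 1 / 2 * (f z - g z)) q volume ^ q.toReal
      ≤ (lpNorm f q volume ^ q.toReal + lpNorm g q volume ^ q.toReal) / 2 := by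
  have hq1 : 1 ≤ q := le_trans (by norm_num) hq
  have hQ : 2 ≤ q.toReal := by
    rw [← ENNReal.toReal_ofNat]; exact (ENNReal.toReal_le_toReal (by simp) hq').2 hq
  have h0 : q ≠ 0 := (zero_lt_one.trans_le hq1).ne'
  have m1 : MemLp (fun z => 1 / 2 * (f z + g z)) q := (hf.add hg).const_mul (1 / 2)
  have m2 : MemLp (fun z => 1 / 2 * (f z - g z)) q := (hf.sub hg).const_mul (1 / 2)
  have i {F : ℂ → ℂ} (hF : MemLp F q) : Integrable fun z => ‖F z‖ ^ q.toReal :=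
    hF.integrable_norm_rpow h0 hq'
  rw [lpNorm_rpow hq1 hq' m1, lpNorm_rpow hq1 hq' m2, lpNorm_rpow hq1 hq' hf, lpNorm_rpow hq1 hq' hg,
    ← integral_add (i m1) (i m2), ← integral_add (i hf) (i hg), ← integral_div]
  exact integral_mono ((i m1).add (i m2)) (((i hf).add (i hg)).div_const 2) fun z =>
    norm_half_add_rpow_add_norm_half_sub_rpow_le hQ _ _

/-- The directional derivative of `‖f‖_q ^ q`. -/
lemma hasDerivAt_integral_norm_rpow (hq : 1 < q) (hq' : q ≠ ⊤) (hf : MemLp f q) (hg : MemLp g q) :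
    HasDerivAt (fun t : ℝ => ∫ z, ‖f z + t * g z‖ ^ q.toReal)
      (q.toReal * (∫ z, dualPower q.toReal f z * g z).re) 0 := by
  have h0 : q ≠ 0 := (zero_lt_one.trans hq).ne'
  have hQ : 1 < q.toReal := by
    rw [← ENNReal.toReal_one]; exact (ENNReal.toReal_lt_toReal (by simp) hq').2 hq
  set Q := q.toReal with hQ_def
  have hbi : Integrable fun z => Q * (‖f z‖ + ‖g z‖) ^ Q := by
    have := (hf.norm.add hg.norm).integrable_norm_rpow h0 hq'
    refine (this.const_mul Q).congr (Eventually.of_forall fun z => ?_)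
    simp only [Pi.add_apply]
    rw [Real.norm_of_nonneg (by positivity)]
  have hpt (z : ℂ) (t : ℝ) : HasDerivAt (fun t : ℝ => ‖f z + t * g z‖ ^ Q)
      (Q * ‖f z + t * g z‖ ^ (Q - 2) * inner ℝ (f z + t * g z) (g z)) t := by
    have h1 : HasDerivAt (fun t : ℝ => f z + t * g z) (g z) t := by
      simpa using ((hasDerivAt_id t).ofReal_comp.mul_const (g z)).const_add (f z)
    have h2 := (hasFDerivAt_norm_rpow (f z + t * g z) hQ).comp_hasDerivAt t h1
    refine h2.congr_deriv ?_
    rw [smul_apply, smul_eq_mul, innerSL_apply_apply]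
  have hbd (x y : ℂ) : ‖Q * ‖x‖ ^ (Q - 2) * inner ℝ x y‖ ≤ Q * (‖x‖ ^ (Q - 1) * ‖y‖) := by
    rw [norm_mul, norm_mul, Real.norm_of_nonneg (by linarith : 0 ≤ Q),
      Real.norm_of_nonneg (by positivity : 0 ≤ ‖x‖ ^ (Q - 2)), mul_assoc]
    refine mul_le_mul_of_nonneg_left ?_ (by linarith)
    rcases eq_or_ne x 0 with rfl | hx
    · simp [Real.zero_rpow (by linarith : Q - 1 ≠ 0)]
    have e : ‖x‖ ^ (Q - 1) = ‖x‖ ^ (Q - 2) * ‖x‖ := by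
      rw [← Real.rpow_add_one (norm_ne_zero_iff.2 hx)]; congr 1; ring
    rw [e, mul_assoc]
    exact mul_le_mul_of_nonneg_left (norm_inner_le_norm x y) (by positivity)
  have hd := hasDerivAt_integral_of_dominated_loc_of_deriv_le (μ := (volume : Measure ℂ)) (𝕜 := ℝ)
    (F := fun t z => ‖f z + t * g z‖ ^ Q) (x₀ := 0) (s := Metric.ball 0 1)
    (F' := fun t z => Q * ‖f z + t * g z‖ ^ (Q - 2) * inner ℝ (f z + t * g z) (g z))
    (bound := fun z => Q * (‖f z‖ + ‖g z‖) ^ Q) (Metric.ball_mem_nhds _ one_pos)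
    (Eventually.of_forall fun t => ?_) ?_ ?_ (Eventually.of_forall fun z t ht => ?_) hbi
    (Eventually.of_forall fun z t _ => hpt z t)
  · refine hd.2.congr_deriv ?_
    have hc : q.HolderConjugate q.conjExponent := .conjExponent hq.le
    have hdual := (dualPower_spec (q := q.conjExponent) hf hq hq').1
    have hsymm : q.conjExponent.HolderConjugate q := ENNReal.HolderTriple.symm
    have hint : Integrable fun z => dualPower Q f z * g z := integrable_mul_of_memLp hdual hg
    have hre : (∫ z, dualPower Q f z * g z).re = ∫ z, (dualPower Q f z * g z).re := by
      have := integral_re hint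
      exact this.symm
    rw [hre, ← integral_const_mul]
    congr 1; ext z
    simp only [ofReal_zero, zero_mul, add_zero, dualPower]
    rw [mul_assoc, mul_assoc, re_ofReal_mul, Complex.inner]
    ring_nf
  · have := hf.1.add (hg.1.const_mul (t : ℂ))
    exact (this.norm.aemeasurable.pow_const Q).aestronglyMeasurable
  · simp only [ofReal_zero, zero_mul, add_zero]
    exact hf.integrable_norm_rpow h0 hq'
  · simp only [ofReal_zero, zero_mul, add_zero]
    exact ((hf.1.norm.aemeasurable.pow_const (Q - 2)).const_mul Q).aestronglyMeasurable.mul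
      (hf.1.inner hg.1)
  · refine (hbd _ _).trans (mul_le_mul_of_nonneg_left ?_ (by linarith))
    have ht1 : |t| ≤ 1 := by
      have := Metric.mem_ball.1 ht
      rw [Real.dist_eq, sub_zero] at this; exact this.le
    have h1 : ‖f z + t * g z‖ ≤ ‖f z‖ + ‖g z‖ := by
      refine (norm_add_le _ _).trans ?_
      rw [norm_mul, norm_real, Real.norm_eq_abs]
      nlinarith [norm_nonneg (g z)]
    rcases eq_or_lt_of_le (by positivity : 0 ≤ ‖f z‖ + ‖g z‖) with h2 | h2
    · have : ‖g z‖ = 0 := by linarith [norm_nonneg (f z), norm_nonneg (g z)]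
      rw [this, mul_zero]; positivity
    · calc ‖f z + t * g z‖ ^ (Q - 1) * ‖g z‖ ≤ (‖f z‖ + ‖g z‖) ^ (Q - 1) * (‖f z‖ + ‖g z‖) := by
            refine mul_le_mul (Real.rpow_le_rpow (norm_nonneg _) h1 (by linarith)) ?_
              (norm_nonneg _) (by positivity)
            linarith [norm_nonneg (f z)]
        _ = (‖f z‖ + ‖g z‖) ^ Q := by
            rw [← Real.rpow_add_one h2.ne']; congr 1; ring

/-- The `L^s` norm can be computed by pairing with test functions. -/
lemma eLpNorm_le_of_forall_isTest {s : ℝ≥0∞} [hsq : s.HolderConjugate q] (hs : 1 < s) (hs' : s ≠ ⊤)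
    {w : ℂ → ℂ} (hw : MemLp w s) {M : ℝ≥0∞} (hM : M ≠ ⊤)
    (h : ∀ g, IsTest g → ‖∫ z, w z * g z‖ₑ ≤ M * eLpNorm g q) : eLpNorm w s ≤ M := by
  have hq := one_lt_conj_of_ne_top s q hs'
  have hq' := conj_ne_top_of_one_lt s q hs
  refine eLpNorm_le_of_forall_pairing_le (q := q) hw hs hs' fun g hg => ?_
  refine ENNReal.le_of_forall_pos_le_add fun η hη hlt => ?_
  -- a test function `g'` with `‖g - g'‖_q ≤ δ`, where `δ (‖w‖_s + M) ≤ η`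
  set c := eLpNorm w s + M with hc
  have hct : c ≠ ⊤ := ENNReal.add_ne_top.2 ⟨hw.2.ne, hM⟩
  set δ : ℝ := η / (c.toReal + 1) with hδ
  have hδ0 : 0 < δ := by positivity
  obtain ⟨g', hgc, hgs, hgg⟩ := hg.exist_eLpNorm_sub_le hq' hq.le hδ0
  have hg' : IsTest g' := ⟨hgs, hgc⟩
  have mg' := hg'.memLp q
  have e : ∫ z, w z * g z = (∫ z, w z * g' z) + ∫ z, w z * (g - g') z := by
    rw [← integral_add (integrable_mul_of_memLp hw mg') (integrable_mul_of_memLp hw (hg.sub mg'))]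
    congr 1; ext z; simp only [Pi.sub_apply]; ring
  have h1 : eLpNorm g' q ≤ eLpNorm g q + ENNReal.ofReal δ := by
    have := eLpNorm_sub_le hg.1 (hg.sub mg').1 hq.le
    rw [sub_sub_cancel] at this
    exact this.trans (by gcongr)
  have h2 : ‖∫ z, w z * g z‖ₑ ≤ M * eLpNorm g' q + eLpNorm w s * eLpNorm (g - g') q := by
    rw [e]
    exact (enorm_add_le _ _).trans (add_le_add (h g' hg')
      (enorm_integral_mul_le hw.1 (hg.sub mg').1))
  have h3 : M * eLpNorm g' q + eLpNorm w s * eLpNorm (g - g') q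
      ≤ M * (eLpNorm g q + ENNReal.ofReal δ) + eLpNorm w s * ENNReal.ofReal δ :=
    add_le_add (mul_le_mul_right h1 _) (mul_le_mul_right hgg _)
  have h4 : M * (eLpNorm g q + ENNReal.ofReal δ) + eLpNorm w s * ENNReal.ofReal δ
      = M * eLpNorm g q + c * ENNReal.ofReal δ := by rw [hc]; ring
  have h5 : c * ENNReal.ofReal δ ≤ η := by
    rw [← ENNReal.ofReal_toReal hct, ← ENNReal.ofReal_mul ENNReal.toReal_nonneg,
      ← ENNReal.ofReal_coe_nnreal]
    refine ENNReal.ofReal_le_ofReal ?_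
    rw [hδ, mul_div_assoc', div_le_iff₀ (by positivity)]
    nlinarith [ENNReal.toReal_nonneg (a := c), NNReal.coe_nonneg η]
  exact (h2.trans h3).trans (h4.le.trans (add_le_add_right h5 _))

end representation

section representation

variable {q s : ℝ≥0∞}

lemma tendsto_lpNorm_of_tendsto_sub (hq : 1 ≤ q) {h : ℕ → ℂ → ℂ} {f : ℂ → ℂ}
    (hh : ∀ n, MemLp (h n) q) (hf : MemLp f q)
    (ht : Tendsto (fun n => eLpNorm (h n - f) q) atTop (𝓝 0)) :
    Tendsto (fun n => lpNorm (h n) q volume) atTop (𝓝 (lpNorm f q volume)) := by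
  have ht' : Tendsto (fun n => lpNorm (h n - f) q volume) atTop (𝓝 0) := by
    have := (ENNReal.tendsto_toReal ENNReal.zero_ne_top).comp ht
    refine this.congr fun n => ?_
    exact toReal_eLpNorm ((hh n).sub hf).1
  rw [tendsto_iff_norm_sub_tendsto_zero]
  refine squeeze_zero (fun n => norm_nonneg _) (fun n => ?_) ht'
  rw [Real.norm_eq_abs, abs_le]
  have h1 := lpNorm_le_lpNorm_add_lpNorm_sub' (f := h n) hf hq (μ := volume)
  have h2 := lpNorm_le_lpNorm_add_lpNorm_sub (f := f) (hh n) hq (μ := volume)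
  constructor <;> linarith

/-- A functional on test functions that is bounded in `L^q`, `2 ≤ q < ∞`, is given by a function in
the dual space. The function is `|f|^{q - 2} f̄`, where `f` minimises `‖f‖^q / q - Re ℓ(f)`; the
minimiser exists by Clarkson's inequality. -/
theorem exists_memLp_forall_integral_mul_eq [hsq : s.HolderConjugate q] (hq : 2 ≤ q) (hq' : q ≠ ⊤)
    {ℓ : (ℂ → ℂ) → ℂ} (hadd : ∀ g h, IsTest g → IsTest h → ℓ (fun z => g z + h z) = ℓ g + ℓ h)
    (hsmul : ∀ (c : ℂ) g, IsTest g → ℓ (fun z => c * g z) = c * ℓ g) {L : ℝ} (hL : 0 ≤ L)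
    (hbd : ∀ g, IsTest g → ‖ℓ g‖ ≤ L * lpNorm g q volume) :
    ∃ w : ℂ → ℂ, MemLp w s ∧ eLpNorm w s ≤ ENNReal.ofReal L ∧
      ∀ g, IsTest g → ∫ z, w z * g z = ℓ g := by
  have hq1 : 1 < q := lt_of_lt_of_le (by norm_num) hq
  have hqs : q.HolderConjugate s := ENNReal.HolderTriple.symm
  have hs := one_lt_conj_of_ne_top q s hq'
  have hs' := conj_ne_top_of_one_lt q s hq1
  have hQ : 1 < q.toReal := by
    rw [← ENNReal.toReal_one]; exact (ENNReal.toReal_lt_toReal (by simp) hq').2 hq1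
  set Q := q.toReal with hQ_def
  have hQ0 : 0 < Q := by linarith
  have hconj : Q.HolderConjugate s.toReal := ENNReal.HolderConjugate.toReal hQ
  set N : (ℂ → ℂ) → ℝ := fun f => lpNorm f q volume with hN
  have hN0 (f) : 0 ≤ N f := lpNorm_nonneg
  set E : (ℂ → ℂ) → ℝ := fun h => N h ^ Q / Q - (ℓ h).re with hE
  have hElow (h) (hh : IsTest h) : -(L ^ s.toReal / s.toReal) ≤ E h := by
    have h1 := Real.young_inequality_of_nonneg (hN0 h) hL hconj
    have h2 := (re_le_norm (ℓ h)).trans (hbd h hh)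
    simp only [hE]
    have : L * lpNorm h q volume = N h * L := mul_comm _ _
    linarith
  set m := sInf (E '' {h | IsTest h}) with hm
  have hbdd : BddBelow (E '' {h | IsTest h}) := by
    refine ⟨-(L ^ s.toReal / s.toReal), ?_⟩
    rintro _ ⟨h, hh, rfl⟩
    exact hElow h hh
  have hne : (E '' {h | IsTest h}).Nonempty := by
    refine ⟨_, fun _ => 0, ⟨contDiff_const, HasCompactSupport.zero⟩, rfl⟩
  have hmE (h) (hh : IsTest h) : m ≤ E h := csInf_le hbdd ⟨h, hh, rfl⟩
  -- a minimising sequence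
  set ε : ℕ → ℝ := fun n => ((1 / 2) ^ (n + 2)) ^ Q / Q with hε
  have hε0 (n) : 0 < ε n := by positivity
  have hεanti {n k : ℕ} (h : n ≤ k) : ε k ≤ ε n := by
    simp only [hε]
    refine div_le_div_of_nonneg_right (Real.rpow_le_rpow (by positivity) ?_ hQ0.le) hQ0.le
    exact pow_le_pow_of_le_one (by norm_num) (by norm_num) (by omega)
  have hex (n : ℕ) : ∃ h, IsTest h ∧ E h < m + ε n := by
    obtain ⟨_, ⟨h, hh, rfl⟩, hlt⟩ := exists_lt_of_csInf_lt hne (lt_add_of_pos_right m (hε0 n))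
    exact ⟨h, hh, hlt⟩
  choose h hh hhE using hex
  have hmem (n) : MemLp (h n) q := (hh n).memLp q
  -- Clarkson's inequality makes it a Cauchy sequence
  have hcau (M n k : ℕ) (hn : M ≤ n) (hk : M ≤ k) :
      eLpNorm (h n - h k) q < ENNReal.ofReal ((1 / 2) ^ M) := by
    have t1 : IsTest fun z => 1 / 2 * (h n z + h k z) := ((hh n).add (hh k)).const_mul (1 / 2)
    have hcl := clarkson_lpNorm hq hq' (hmem n) (hmem k)
    have hl : ℓ (fun z => 1 / 2 * (h n z + h k z)) = 1 / 2 * (ℓ (h n) + ℓ (h k)) := by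
      rw [hsmul _ _ ((hh n).add (hh k)), hadd _ _ (hh n) (hh k)]
    have h1 := hmE _ t1
    simp only [hE, hl] at h1
    have hre : (1 / 2 * (ℓ (h n) + ℓ (h k))).re = ((ℓ (h n)).re + (ℓ (h k)).re) / 2 := by
      rw [show (1 / 2 : ℂ) = ((1 / 2 : ℝ) : ℂ) by push_cast; ring, re_ofReal_mul, add_re]; ring
    rw [hre] at h1
    have h2 := (hhE n).trans_le (add_le_add_right (hεanti hn) m)
    have h3 := (hhE k).trans_le (add_le_add_right (hεanti hk) m)
    simp only [hE] at h2 h3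
    have h4 : N (fun z => 1 / 2 * (h n z - h k z)) ^ Q / Q < ε M := by
      have : (N (fun z => 1 / 2 * (h n z + h k z)) ^ Q + N (fun z => 1 / 2 * (h n z - h k z)) ^ Q) / Q
          ≤ ((N (h n) ^ Q + N (h k) ^ Q) / 2) / Q := div_le_div_of_nonneg_right hcl hQ0.le
      rw [add_div] at this
      have e : ((N (h n) ^ Q + N (h k) ^ Q) / 2) / Q = (N (h n) ^ Q / Q + N (h k) ^ Q / Q) / 2 := by ring
      linarith
    simp only [hε] at h4
    rw [div_lt_div_iff_of_pos_right hQ0] at h4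
    have h5 := (Real.rpow_lt_rpow_iff (hN0 _) (by positivity) hQ0).1 h4
    have h6 : N (fun z => 1 / 2 * (h n z - h k z)) = 1 / 2 * N (h n - h k) := by
      simp only [hN]
      rw [lpNorm_const_mul, norm_div, norm_one, Complex.norm_ofNat]; rfl
    rw [h6] at h5
    rw [← ofReal_lpNorm ((hmem n).sub (hmem k))]
    refine (ENNReal.ofReal_lt_ofReal_iff (by positivity)).2 ?_
    have h7 : ((1 : ℝ) / 2) ^ (M + 2) = (1 / 2) ^ M / 4 := by rw [pow_add]; ring
    rw [h7] at h5
    have h8 : (0 : ℝ) < (1 / 2) ^ M := by positivity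
    change N (h n - h k) < _
    linarith
  have hsum : ∑' n : ℕ, ENNReal.ofReal ((1 / 2) ^ n) ≠ ⊤ := by
    rw [← ENNReal.ofReal_tsum_of_nonneg (fun n => by positivity) summable_geometric_two]
    exact ENNReal.ofReal_ne_top
  obtain ⟨f, hf, hfl⟩ := Lp.cauchy_complete_eLpNorm hq1.le hmem hsum hcau
  have hεlim : Tendsto ε atTop (𝓝 0) := by
    have h1 : Tendsto (fun n : ℕ => ((1 : ℝ) / 2) ^ (n + 2)) atTop (𝓝 0) :=
      (tendsto_pow_atTop_nhds_zero_of_lt_one (by norm_num) (by norm_num)).comp (tendsto_add_atTop_nat 2)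
    have h2 := (h1.rpow_const (p := Q) (Or.inr hQ0.le)).div_const Q
    rwa [Real.zero_rpow hQ0.ne', zero_div] at h2
  have hElim : Tendsto (fun n => E (h n)) atTop (𝓝 m) :=
    tendsto_of_tendsto_of_tendsto_of_le_of_le tendsto_const_nhds
      (by simpa using hεlim.const_add m) (fun n => hmE _ (hh n)) fun n => (hhE n).le
  -- the variational inequality for the limit
  have hvar (g) (hg : IsTest g) (t : ℝ) :
      N f ^ Q / Q ≤ N (fun z => f z + t * g z) ^ Q / Q - t * (ℓ g).re := by
    have htg : IsTest fun z => (t : ℂ) * g z := hg.const_mul t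
    have hft : MemLp (fun z => f z + t * g z) q := hf.add (htg.memLp q)
    have hht (n) : IsTest fun z => h n z + t * g z := (hh n).add htg
    have l1 := tendsto_lpNorm_of_tendsto_sub hq1.le hmem hf hfl
    have l2 := tendsto_lpNorm_of_tendsto_sub hq1.le (fun n => (hht n).memLp q) hft (by
      refine hfl.congr fun n => ?_
      congr 1; ext z; simp only [Pi.sub_apply]; ring)
    have l3 := (l1.rpow_const (p := Q) (Or.inr hQ0.le)).div_const Q
    have l4 := (l2.rpow_const (p := Q) (Or.inr hQ0.le)).div_const Q
    have hle (n) : m ≤ E (h n) + (N (fun z => h n z + t * g z) ^ Q / Q - N (h n) ^ Q / Q)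
        - t * (ℓ g).re := by
      have h1 := hmE _ (hht n)
      simp only [hE] at h1 ⊢
      rw [hadd _ _ (hh n) htg, hsmul _ _ hg, add_re, re_ofReal_mul] at h1
      linarith
    have := ge_of_tendsto ((hElim.add (l4.sub l3)).sub_const (t * (ℓ g).re))
      (Eventually.of_forall hle)
    simp only [hN]
    linarith
  set w := dualPower Q f with hw
  have hwm : MemLp w s := (dualPower_spec (q := s) hf hq1 hq').1
  have hrep (g) (hg : IsTest g) : (∫ z, w z * g z).re = (ℓ g).re := by
    have hd := ((hasDerivAt_integral_norm_rpow hq1 hq' hf (hg.memLp q)).div_const Q).sub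
      ((hasDerivAt_id (0 : ℝ)).mul_const (ℓ g).re)
    have hmin : IsLocalMin (fun t : ℝ => (∫ z, ‖f z + t * g z‖ ^ Q) / Q - t * (ℓ g).re) 0 := by
      refine Eventually.of_forall fun t => ?_
      have h1 := hvar g hg t
      simp only [hN] at h1
      have hft : MemLp (fun z => f z + t * g z) q := hf.add ((hg.const_mul t).memLp q)
      rw [lpNorm_rpow hq1.le hq' hf, lpNorm_rpow hq1.le hq' hft] at h1
      simpa using h1
    have h0 := hmin.hasDerivAt_eq_zero hd
    rw [mul_div_cancel_left₀ _ hQ0.ne', one_mul] at h0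
    linarith
  have hrep' (g) (hg : IsTest g) : ∫ z, w z * g z = ℓ g := by
    refine Complex.ext (hrep g hg) ?_
    have h1 := hrep _ (hg.const_mul I)
    rw [hsmul _ _ hg] at h1
    have e : ∫ z, w z * (I * g z) = I * ∫ z, w z * g z := by
      rw [← integral_const_mul]; congr 1; ext z; ring
    rw [e] at h1
    simpa using h1
  refine ⟨w, hwm, ?_, hrep'⟩
  -- the norm bound follows from the representation, test functions being dense
  refine eLpNorm_le_of_forall_isTest (q := q) hs hs' hwm ENNReal.ofReal_ne_top fun g hg => ?_
  rw [hrep' g hg, ← ofReal_norm, ← ofReal_lpNorm (hg.memLp q), ← ENNReal.ofReal_mul hL]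
  exact ENNReal.ofReal_le_ofReal (hbd g hg)

end representation

/-! ### Weak derivatives and Sobolev fields -/

lemma hasWeakPartial_weakPartial {j : Fin 2} {f : ℂ → ℝ} (h : ∃ g, HasWeakPartial j f g) :
    HasWeakPartial j f (weakPartial j f) := by
  rw [weakPartial, dif_pos h]; exact h.choose_spec

lemma HasWeakPartial.weakPartial_ae_eq {j : Fin 2} {f g : ℂ → ℝ} (h : HasWeakPartial j f g) :
    weakPartial j f =ᵐ[volume] g := by
  have h' := hasWeakPartial_weakPartial ⟨g, h⟩
  refine ae_eq_of_integral_contDiff_smul_eq h'.2.1 h.2.1 fun φ hφ hc => ?_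
  have e1 := h'.2.2 φ ⟨hφ, hc⟩
  have e2 := h.2.2 φ ⟨hφ, hc⟩
  simp_rw [smul_eq_mul, mul_comm (φ _)]
  linarith

lemma IsTest.hasWeakPartial {f : ℂ → ℝ} (hf : IsTest f) (j : Fin 2) :
    HasWeakPartial j f fun z => fderiv ℝ f z (dir j) := by
  refine ⟨hf.integrable.locallyIntegrable, (hf.fderiv_apply _).integrable.locallyIntegrable,
    fun φ hφ => ?_⟩
  have h := integral_mul_fderiv_test hf.ofReal.1 hφ.ofReal (dir j)
  have e {k : ℂ → ℝ} (hk : IsTest k) (z : ℂ) :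
      fderiv ℝ (fun z => (k z : ℂ)) z (dir j) = (fderiv ℝ k z (dir j) : ℂ) := by
    have := (ofRealCLM.hasFDerivAt.comp z (hk.differentiable z).hasFDerivAt).fderiv
    change fderiv ℝ (ofRealCLM ∘ k) z (dir j) = _
    rw [this]; rfl
  simp_rw [e hf, e hφ, ← ofReal_mul] at h
  have h' : ((∫ z, f z * fderiv ℝ φ z (dir j) : ℝ) : ℂ)
      = ((-∫ z, fderiv ℝ f z (dir j) * φ z : ℝ) : ℂ) := by
    rw [ofReal_neg, ← integral_complex_ofReal, ← integral_complex_ofReal]; exact h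
  exact ofReal_injective h'

lemma locallyIntegrable_ofReal {k : ℂ → ℝ} (hk : LocallyIntegrable k) :
    LocallyIntegrable fun z => (k z : ℂ) := fun x => by
  obtain ⟨s, hs, hi⟩ := hk x
  exact ⟨s, hs, Integrable.ofReal hi⟩

/-- The defining identity of weak derivatives holds for complex-valued test functions as well. -/
lemma HasWeakPartial.integral_mul_fderiv {j : Fin 2} {f g : ℂ → ℝ} (h : HasWeakPartial j f g)
    {φ : ℂ → ℂ} (hφ : IsTest φ) :
    ∫ z, (f z : ℂ) * fderiv ℝ φ z (dir j) = -∫ z, (g z : ℂ) * φ z := by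
  have i1 := integrable_mul_isTest (locallyIntegrable_ofReal h.1) (hφ.fderiv_apply (dir j))
  have i2 := integrable_mul_isTest (locallyIntegrable_ofReal h.2.1) hφ
  have tr : IsTest fun z => (φ z).re := hφ.clm_comp reCLM
  have ti : IsTest fun z => (φ z).im := hφ.clm_comp imCLM
  have dr (z : ℂ) : fderiv ℝ (fun z => (φ z).re) z (dir j) = (fderiv ℝ φ z (dir j)).re := by
    have := (reCLM.hasFDerivAt.comp z (hφ.differentiable z).hasFDerivAt).fderiv
    change fderiv ℝ (reCLM ∘ φ) z (dir j) = _
    rw [this]; rfl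
  have di (z : ℂ) : fderiv ℝ (fun z => (φ z).im) z (dir j) = (fderiv ℝ φ z (dir j)).im := by
    have := (imCLM.hasFDerivAt.comp z (hφ.differentiable z).hasFDerivAt).fderiv
    change fderiv ℝ (imCLM ∘ φ) z (dir j) = _
    rw [this]; rfl
  have er := h.2.2 _ tr
  have ei := h.2.2 _ ti
  simp_rw [dr] at er
  simp_rw [di] at ei
  apply Complex.ext
  · have a1 : (∫ z, (f z : ℂ) * fderiv ℝ φ z (dir j)).re = ∫ z, f z * (fderiv ℝ φ z (dir j)).re := by
      rw [← reCLM_apply, ← reCLM.integral_comp_comm i1]; simp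
    have a2 : (∫ z, (g z : ℂ) * φ z).re = ∫ z, g z * (φ z).re := by
      rw [← reCLM_apply, ← reCLM.integral_comp_comm i2]; simp
    rw [neg_re, a1, a2, er]
  · have a1 : (∫ z, (f z : ℂ) * fderiv ℝ φ z (dir j)).im = ∫ z, f z * (fderiv ℝ φ z (dir j)).im := by
      rw [← imCLM_apply, ← imCLM.integral_comp_comm i1]; simp
    have a2 : (∫ z, (g z : ℂ) * φ z).im = ∫ z, g z * (φ z).im := by
      rw [← imCLM_apply, ← imCLM.integral_comp_comm i2]; simp
    rw [neg_im, a1, a2, ei]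

/-- The weak derivative `∂_z` of the field `u₁ + i u₂`. -/
noncomputable def weakDz (u : Fin 2 → ℂ → ℝ) (z : ℂ) : ℂ :=
  ((weakPartial 0 (u 0) z + I * weakPartial 0 (u 1) z)
    - I * (weakPartial 1 (u 0) z + I * weakPartial 1 (u 1) z)) / 2

/-- The weak derivative `∂_{z̄}` of the field `u₁ + i u₂`. -/
noncomputable def weakDzb (u : Fin 2 → ℂ → ℝ) (z : ℂ) : ℂ :=
  ((weakPartial 0 (u 0) z + I * weakPartial 0 (u 1) z)
    + I * (weakPartial 1 (u 0) z + I * weakPartial 1 (u 1) z)) / 2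

lemma normSq_weakDz (u : Fin 2 → ℂ → ℝ) (z : ℂ) : normSq (weakDz u z)
    = ((weakPartial 0 (u 0) z + weakPartial 1 (u 1) z) ^ 2
      + (weakPartial 0 (u 1) z - weakPartial 1 (u 0) z) ^ 2) / 4 := by
  rw [weakDz, normSq_apply]; simp; ring

lemma normSq_weakDzb (u : Fin 2 → ℂ → ℝ) (z : ℂ) : normSq (weakDzb u z)
    = ((weakPartial 0 (u 0) z - weakPartial 1 (u 1) z) ^ 2
      + (weakPartial 0 (u 1) z + weakPartial 1 (u 0) z) ^ 2) / 4 := by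
  rw [weakDzb, normSq_apply]; simp; ring

lemma ofReal_jacobian (u : Fin 2 → ℂ → ℝ) (z : ℂ) : (jacobian u z : ℂ)
    = weakDz u z * starRingEnd ℂ (weakDz u z) - weakDzb u z * starRingEnd ℂ (weakDzb u z) := by
  rw [mul_conj, mul_conj, normSq_weakDz, normSq_weakDzb, jacobian, Matrix.det_fin_two,
    ← ofReal_sub]
  congr 1; simp only [Matrix.of_apply]; ring

lemma sum_weakPartial_sq (u : Fin 2 → ℂ → ℝ) (z : ℂ) : ∑ i, ∑ j, weakPartial j (u i) z ^ 2
    = 2 * (‖weakDz u z‖ ^ 2 + ‖weakDzb u z‖ ^ 2) := by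
  rw [← normSq_eq_norm_sq, ← normSq_eq_norm_sq, normSq_weakDz, normSq_weakDzb]
  simp only [Fin.sum_univ_two]; ring

section sobolev

variable {q : ℝ≥0∞} {u : Fin 2 → ℂ → ℝ}

lemma memLp_weakDz (hu : u ∈ homSobolev q) : MemLp (weakDz u) q := by
  have m (i j) : MemLp (fun z => (weakPartial j (u i) z : ℂ)) q := (hu i j).2.ofReal
  have := (((m 0 0).add ((m 1 0).const_mul I)).sub
    (((m 0 1).add ((m 1 1).const_mul I)).const_mul I)).const_mul (1 / 2)
  refine this.congr_norm ?_ (Eventually.of_forall fun z => ?_)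
  · have e : weakDz u = fun z => (1 / 2) * ((weakPartial 0 (u 0) z + I * weakPartial 0 (u 1) z)
      - I * (weakPartial 1 (u 0) z + I * weakPartial 1 (u 1) z)) := by
      ext z; rw [weakDz]; ring
    rw [e]; exact this.1
  · congr 1; rw [weakDz]; simp only [Pi.sub_apply, Pi.add_apply]; ring

lemma memLp_weakDzb (hu : u ∈ homSobolev q) : MemLp (weakDzb u) q := by
  have m (i j) : MemLp (fun z => (weakPartial j (u i) z : ℂ)) q := (hu i j).2.ofReal
  have := (((m 0 0).add ((m 1 0).const_mul I)).add
    (((m 0 1).add ((m 1 1).const_mul I)).const_mul I)).const_mul (1 / 2)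
  refine this.congr_norm ?_ (Eventually.of_forall fun z => ?_)
  · have e : weakDzb u = fun z => (1 / 2) * ((weakPartial 0 (u 0) z + I * weakPartial 0 (u 1) z)
      + I * (weakPartial 1 (u 0) z + I * weakPartial 1 (u 1) z)) := by
      ext z; rw [weakDzb]; ring
    rw [e]; exact this.1
  · congr 1; rw [weakDzb]; simp only [Pi.add_apply]; ring

lemma eLpNorm_weakDz_le : eLpNorm (weakDz u) q ≤ homSobolevNorm q u := by
  refine eLpNorm_mono_real fun z => ?_
  rw [sum_weakPartial_sq]
  refine Real.le_sqrt_of_sq_le ?_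
  nlinarith [sq_nonneg ‖weakDz u z‖, sq_nonneg ‖weakDzb u z‖]

lemma eLpNorm_weakDzb_le : eLpNorm (weakDzb u) q ≤ homSobolevNorm q u := by
  refine eLpNorm_mono_real fun z => ?_
  rw [sum_weakPartial_sq]
  refine Real.le_sqrt_of_sq_le ?_
  nlinarith [sq_nonneg ‖weakDz u z‖, sq_nonneg ‖weakDzb u z‖]

lemma homSobolevNorm_le (hq : 1 ≤ q) (h1 : AEStronglyMeasurable (weakDz u))
    (h2 : AEStronglyMeasurable (weakDzb u)) :
    homSobolevNorm q u ≤ 2 * (eLpNorm (weakDz u) q + eLpNorm (weakDzb u) q) := by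
  have h : homSobolevNorm q u ≤ eLpNorm ((2 : ℝ) • fun z => ‖weakDz u z‖ + ‖weakDzb u z‖) q := by
    refine eLpNorm_mono_real fun z => ?_
    rw [sum_weakPartial_sq, Real.norm_of_nonneg (Real.sqrt_nonneg _)]
    refine Real.sqrt_le_iff.2 ⟨by simp only [Pi.smul_apply, smul_eq_mul]; positivity, ?_⟩
    simp only [Pi.smul_apply, smul_eq_mul]
    nlinarith [norm_nonneg (weakDz u z), norm_nonneg (weakDzb u z),
      mul_nonneg (norm_nonneg (weakDz u z)) (norm_nonneg (weakDzb u z))]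
  refine h.trans ?_
  rw [eLpNorm_const_smul]
  have e : ‖(2 : ℝ)‖ₑ = 2 := by
    rw [← ofReal_norm]; norm_num
  rw [e]
  refine mul_le_mul_right ((eLpNorm_add_le h1.norm h2.norm hq).trans ?_) _
  rw [eLpNorm_norm, eLpNorm_norm]

/-- Passing from `∂̄` to `∂` under the integral, for the weak derivatives of a Sobolev field. -/
lemma integral_weakDz_mul_dzb (hu : ∀ i j, ∃ g, HasWeakPartial j (u i) g) {φ : ℂ → ℂ}
    (hφ : IsTest φ) : ∫ z, weakDz u z * dzb φ z = ∫ z, weakDzb u z * dz φ z := by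
  have W (i j) := hasWeakPartial_weakPartial (hu i j)
  have hI (i j k) := integrable_mul_isTest (locallyIntegrable_ofReal (W i j).2.1) (hφ.fderiv_apply (dir k))
  -- both sides are combinations of `∫ ∂ⱼU ∂ₖφ`, which is symmetric in `j` and `k`
  set D : Fin 2 → ℂ → ℂ := fun j z => weakPartial j (u 0) z + I * weakPartial j (u 1) z with hD
  have hDI (j k) : Integrable fun z => D j z * fderiv ℝ φ z (dir k) := by
    refine ((hI 0 j k).add ((hI 1 j k).const_mul I)).congr (Eventually.of_forall fun z => ?_)
    simp only [hD, Pi.add_apply]; ring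
  have hDe (j k) : ∫ z, D j z * fderiv ℝ φ z (dir k)
      = (∫ z, (weakPartial j (u 0) z : ℂ) * fderiv ℝ φ z (dir k))
        + I * ∫ z, (weakPartial j (u 1) z : ℂ) * fderiv ℝ φ z (dir k) := by
    rw [← integral_const_mul, ← integral_add (hI 0 j k) ((hI 1 j k).const_mul I)]
    congr 1; ext z; simp only [hD]; ring
  have hs (i) : ∫ z, (weakPartial 0 (u i) z : ℂ) * fderiv ℝ φ z (dir 1)
      = ∫ z, (weakPartial 1 (u i) z : ℂ) * fderiv ℝ φ z (dir 0) := by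
    rw [← neg_inj, ← (W i 0).integral_mul_fderiv (hφ.fderiv_apply (dir 1)),
      ← (W i 1).integral_mul_fderiv (hφ.fderiv_apply (dir 0))]
    congr 1; ext z
    rw [fderiv_fderiv_apply hφ.1, fderiv_fderiv_apply hφ.1,
      (hφ.1.contDiffAt.isSymmSndFDerivAt (by simp; norm_cast)) (dir 0) (dir 1)]
  have hsymm : ∫ z, D 0 z * fderiv ℝ φ z (dir 1) = ∫ z, D 1 z * fderiv ℝ φ z (dir 0) := by
    rw [hDe, hDe, hs, hs]
  have hII : I * I = -1 := I_mul_I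
  have hL : ∫ z, weakDz u z * dzb φ z = 1 / 4 * ((∫ z, D 0 z * fderiv ℝ φ z (dir 0))
      + I * (∫ z, D 0 z * fderiv ℝ φ z (dir 1)) - I * (∫ z, D 1 z * fderiv ℝ φ z (dir 0))
      + ∫ z, D 1 z * fderiv ℝ φ z (dir 1)) := by
    rw [← integral_const_mul, ← integral_const_mul,
      ← integral_add (hDI 0 0) ((hDI 0 1).const_mul I),
      ← integral_sub (by exact (hDI 0 0).add ((hDI 0 1).const_mul I)) ((hDI 1 0).const_mul I),
      ← integral_add (by exact ((hDI 0 0).add ((hDI 0 1).const_mul I)).sub ((hDI 1 0).const_mul I))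
        (hDI 1 1), ← integral_const_mul]
    congr 1; ext z
    change (D 0 z - I * D 1 z) / 2 * ((fderiv ℝ φ z (dir 0) + I * fderiv ℝ φ z (dir 1)) / 2) = _
    linear_combination (-D 1 z * fderiv ℝ φ z (dir 1) / 4) * hII
  have hR : ∫ z, weakDzb u z * dz φ z = 1 / 4 * ((∫ z, D 0 z * fderiv ℝ φ z (dir 0))
      - I * (∫ z, D 0 z * fderiv ℝ φ z (dir 1)) + I * (∫ z, D 1 z * fderiv ℝ φ z (dir 0))
      + ∫ z, D 1 z * fderiv ℝ φ z (dir 1)) := by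
    rw [← integral_const_mul, ← integral_const_mul,
      ← integral_sub (hDI 0 0) ((hDI 0 1).const_mul I),
      ← integral_add (by exact (hDI 0 0).sub ((hDI 0 1).const_mul I)) ((hDI 1 0).const_mul I),
      ← integral_add (by exact ((hDI 0 0).sub ((hDI 0 1).const_mul I)).add ((hDI 1 0).const_mul I))
        (hDI 1 1), ← integral_const_mul]
    congr 1; ext z
    change (D 0 z + I * D 1 z) / 2 * ((fderiv ℝ φ z (dir 0) - I * fderiv ℝ φ z (dir 1)) / 2) = _
    linear_combination (-D 1 z * fderiv ℝ φ z (dir 1) / 4) * hII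
  rw [hL, hR, hsymm]; ring

/-- A Liouville-type uniqueness statement: a pair in `L^r × L^r` that satisfies the equation
`∂̄F = ∂f` in the sense of distributions is related by the Beurling transform. -/
lemma isBeurling_of_forall_isTest {r : ℝ≥0∞} (hr : 1 < r) (hr' : r ≠ ⊤) {f F : ℂ → ℂ}
    (hf : MemLp f r) (hF : MemLp F r)
    (h : ∀ φ, IsTest φ → ∫ z, F z * dzb φ z = ∫ z, f z * dz φ z) : IsBeurling r f F := by
  obtain ⟨s, hrs⟩ : ∃ s, r.HolderConjugate s := ⟨_, .conjExponent hr.le⟩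
  have hs := one_lt_conj_of_ne_top r s hr'
  have hs' := conj_ne_top_of_one_lt r s hr
  obtain ⟨C, hC⟩ := exists_beurlingBound hr hr'
  obtain ⟨C', hC'⟩ := exists_beurlingBound hs hs'
  obtain ⟨F', hF'⟩ := hC.exists_isBeurling hr hr' hf
  have hG := hF.sub hF'.memLp_right
  have h0 : eLpNorm (F - F') r ≤ 0 := by
    refine eLpNorm_le_of_forall_pairing_le (q := s) hG hr hr' fun g hg => ?_
    -- the derivatives `∂̄φ` of test functions are dense in the dual space
    obtain ⟨G, -, hg, v, hv, hvg, -⟩ := (hC'.exists_isBeurling hs hs' hg)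
    have t := tendsto_integral_mul (l := atTop) (fun _ : ℕ => hG)
      (fun n => (isTest_dzb (hv n)).memLp s) hG ‹MemLp g s› (by simp) hvg
    have hz (n) : ∫ z, (F - F') z * dzb (v n) z = 0 := by
      have i1 := integrable_mul_of_memLp hF ((isTest_dzb (hv n)).memLp s)
      have i2 := integrable_mul_of_memLp hF'.memLp_right ((isTest_dzb (hv n)).memLp s)
      have e := hF'.integral_mul_comm (hv n).isBeurling (s := s)
      simp_rw [Pi.sub_apply, sub_mul]
      rw [integral_sub i1 i2, e, h _ (hv n), sub_self]
    simp_rw [hz] at t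
    rw [tendsto_nhds_unique t tendsto_const_nhds]; simp
  have h1 : F - F' =ᵐ[volume] 0 :=
    (eLpNorm_eq_zero_iff hG.1 (zero_lt_one.trans hr).ne').1 (le_antisymm h0 zero_le)
  refine hF'.congr_right ?_
  filter_upwards [h1] with z hz
  exact (sub_eq_zero.1 hz).symm

lemma isBeurling_weakDzb (hq : 1 < q) (hq' : q ≠ ⊤) (hu : u ∈ homSobolev q) :
    IsBeurling q (weakDzb u) (weakDz u) :=
  isBeurling_of_forall_isTest hq hq' (memLp_weakDzb hu) (memLp_weakDz hu) fun _ hφ =>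
    integral_weakDz_mul_dzb (fun i j => (hu i j).1) hφ

end sobolev

/-! ### Test fields -/

/-- The complex-valued function `u₁ + i u₂` of a real vector field. -/
def complexField (u : Fin 2 → ℂ → ℝ) (z : ℂ) : ℂ := u 0 z + I * u 1 z

section test

variable {q : ℝ≥0∞} {u : Fin 2 → ℂ → ℝ}

lemma isTest_complexField (hu : u ∈ testFields) : IsTest (complexField u) :=
  (hu 0).ofReal.add ((hu 1).ofReal.const_mul I)

lemma mem_homSobolev_of_mem_testFields (hu : u ∈ testFields) : u ∈ homSobolev q := fun i j =>
  ⟨⟨_, (hu i).hasWeakPartial j⟩,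
    (memLp_congr_ae ((hu i).hasWeakPartial j).weakPartial_ae_eq).2 (((hu i).fderiv_apply _).memLp q)⟩

lemma fderiv_complexField (hu : u ∈ testFields) (z v : ℂ) : fderiv ℝ (complexField u) z v
    = fderiv ℝ (u 0) z v + I * fderiv ℝ (u 1) z v := by
  have h (i) := ofRealCLM.hasFDerivAt.comp z ((hu i).differentiable z).hasFDerivAt
  have := ((h 0).add ((h 1).const_mul I)).fderiv
  change fderiv ℝ (ofRealCLM ∘ u 0 + fun y => I * (ofRealCLM ∘ u 1) y) z v = _
  rw [this]; simp

lemma weakDz_ae_eq (hu : u ∈ testFields) : weakDz u =ᵐ[volume] dz (complexField u) := by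
  have h (i j) := ((hu i).hasWeakPartial j).weakPartial_ae_eq
  filter_upwards [h 0 0, h 0 1, h 1 0, h 1 1] with z h00 h01 h10 h11
  rw [weakDz, dz, fderiv_complexField hu, fderiv_complexField hu, h00, h01, h10, h11]; rfl

lemma weakDzb_ae_eq (hu : u ∈ testFields) : weakDzb u =ᵐ[volume] dzb (complexField u) := by
  have h (i j) := ((hu i).hasWeakPartial j).weakPartial_ae_eq
  filter_upwards [h 0 0, h 0 1, h 1 0, h 1 1] with z h00 h01 h10 h11
  rw [weakDzb, dzb, fderiv_complexField hu, fderiv_complexField hu, h00, h01, h10, h11]; rfl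

lemma integral_mul_jacobian (b : ℂ → ℂ) (hu : u ∈ testFields) :
    ∫ z, b z * (jacobian u z : ℂ) = ∫ z, b z * complexJacobian (complexField u) z := by
  refine integral_congr_ae ?_
  filter_upwards [weakDz_ae_eq hu, weakDzb_ae_eq hu] with z h1 h2
  rw [ofReal_jacobian, h1, h2, complexJacobian]

/-- Every complex-valued test function comes from a test field. -/
lemma IsTest.exists_complexField_eq {U : ℂ → ℂ} (hU : IsTest U) :
    ∃ u ∈ testFields, complexField u = U := by
  refine ⟨![fun z => (U z).re, fun z => (U z).im], fun i => ?_, ?_⟩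
  · fin_cases i
    · exact hU.clm_comp reCLM
    · exact hU.clm_comp imCLM
  · ext z; simp [complexField, mul_comm I, re_add_im]

/-- By homogeneity the supremum over the unit ball controls the integral against every Jacobian. -/
lemma norm_integral_complexJacobian_le (hq : 1 ≤ q) {D : Set (Fin 2 → ℂ → ℝ)}
    (hD : testFields ⊆ D) {b : ℂ → ℂ} (hM : jacobianSup q D b ≠ ⊤) {U : ℂ → ℂ} (hU : IsTest U) :
    ‖∫ z, b z * complexJacobian U z‖ ≤ 4 * (jacobianSup q D b).toReal * wirtingerNorm q U ^ 2 := by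
  set M := (jacobianSup q D b).toReal with hM_def
  set N := wirtingerNorm q U with hN_def
  have hN : 0 ≤ N := wirtingerNorm_nonneg
  have key (t : ℝ) (ht : 2 * N < t) : ‖∫ z, b z * complexJacobian U z‖ ≤ M * t ^ 2 := by
    have ht0 : 0 < t := by linarith
    have hV : IsTest fun z => ((t⁻¹ : ℝ) : ℂ) * U z := hU.const_mul _
    obtain ⟨u, hu, huV⟩ := hV.exists_complexField_eq
    have hn : homSobolevNorm q u ≤ 1 := by
      refine (homSobolevNorm_le hq (memLp_weakDz (q := q) (mem_homSobolev_of_mem_testFields hu)).1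
        (memLp_weakDzb (q := q) (mem_homSobolev_of_mem_testFields hu)).1).trans ?_
      rw [eLpNorm_congr_ae (weakDz_ae_eq hu), eLpNorm_congr_ae (weakDzb_ae_eq hu), huV,
        ← ofReal_lpNorm ((isTest_dz hV).memLp q), ← ofReal_lpNorm ((isTest_dzb hV).memLp q),
        ← ENNReal.ofReal_add lpNorm_nonneg lpNorm_nonneg,
        show (2 : ℝ≥0∞) = ENNReal.ofReal 2 by simp, ← ENNReal.ofReal_mul (by norm_num)]
      refine ENNReal.ofReal_le_one.2 ?_
      change 2 * wirtingerNorm q _ ≤ 1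
      rw [wirtingerNorm_const_mul _ hU, norm_real, Real.norm_of_nonneg (by positivity),
        ← mul_assoc, mul_comm 2, mul_assoc, inv_mul_le_iff₀ ht0]
      linarith
    have h1 : ‖∫ z, b z * (jacobian u z : ℂ)‖ₑ ≤ jacobianSup q D b :=
      le_iSup₂ (f := fun u _ => ‖∫ z, b z * (jacobian u z : ℂ)‖ₑ) u
        ⟨hD hu, mem_homSobolev_of_mem_testFields hu, hn⟩
    have h2 := ENNReal.toReal_mono hM h1
    rw [toReal_enorm, integral_mul_jacobian b hu, huV] at h2
    have e : ∫ z, b z * complexJacobian (fun z => ((t⁻¹ : ℝ) : ℂ) * U z) z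
        = ((t⁻¹ ^ 2 : ℝ) : ℂ) * ∫ z, b z * complexJacobian U z := by
      rw [← integral_const_mul]
      congr 1; ext z
      rw [complexJacobian, complexJacobian, dz_const_mul _ (hU.differentiable z),
        dzb_const_mul _ (hU.differentiable z), map_mul, map_mul, conj_ofReal]
      push_cast; ring
    rw [e, norm_mul, norm_real, Real.norm_of_nonneg (by positivity), inv_pow,
      inv_mul_le_iff₀ (by positivity)] at h2
    linarith
  have hlim : Tendsto (fun t : ℝ => M * t ^ 2) (𝓝[>] (2 * N)) (𝓝 (M * (2 * N) ^ 2)) :=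
    (Continuous.tendsto (by fun_prop) _).mono_left nhdsWithin_le_nhds
  have := ge_of_tendsto hlim (by filter_upwards [self_mem_nhdsWithin] with t ht using key t ht)
  linarith

end test

/-! ### The commutator for `b` in the dual of `L^p` -/

section lp

variable {P R q s : ℝ≥0∞} {b v h F G H : ℂ → ℂ} {C : ℝ≥0}

lemma tendsto_eLpNorm_mul_sub [hPqs : P.HolderTriple q s] (hb : MemLp b P) {f : ℕ → ℂ → ℂ}
    (hf : ∀ n, MemLp (f n) q) (hF : MemLp F q)
    (ht : Tendsto (fun n => eLpNorm (f n - F) q) atTop (𝓝 0)) :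
    Tendsto (fun n => eLpNorm ((fun z => b z * f n z) - fun z => b z * F z) s) atTop (𝓝 0) := by
  have hbt : eLpNorm b P ≠ ⊤ := hb.eLpNorm_ne_top
  have h1 : Tendsto (fun n => eLpNorm b P * eLpNorm (f n - F) q) atTop (𝓝 (eLpNorm b P * 0)) :=
    ENNReal.Tendsto.const_mul ht (Or.inr hbt)
  rw [mul_zero] at h1
  have hle (n) : eLpNorm ((fun z => b z * f n z) - fun z => b z * F z) s
      ≤ eLpNorm b P * eLpNorm (f n - F) q := by
    have e : ((fun z => b z * f n z) - fun z => b z * F z) = b • (f n - F) := by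
      ext z; simp only [Pi.sub_apply, Pi.smul_apply', smul_eq_mul]; ring
    rw [e]
    exact eLpNorm_smul_le_mul_eLpNorm ((hf n).sub hF).1 hb.1
  exact tendsto_of_tendsto_of_tendsto_of_le_of_le tendsto_const_nhds h1 (fun _ => zero_le) hle

lemma commutator_ae_eq (hq : 1 < q) (hq' : q ≠ ⊤) (hs : 1 < s) (hs' : s ≠ ⊤)
    (hv : IsBeurling q v F) (hbv : IsBeurling s (fun y => b y * v y) G) :
    commutator b v =ᵐ[volume] fun z => b z * F z - G z := by
  filter_upwards [hv.ae_beurling_eq hq hq', hbv.ae_beurling_eq hs hs'] with z h1 h2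
  rw [commutator, h1, h2]

/-- The pairing of the commutator with `h`, after moving the second Beurling transform to `h`. -/
lemma integral_commutator_mul [hPqs : P.HolderTriple q s] [hsq : s.HolderConjugate q]
    (hq : 1 < q) (hq' : q ≠ ⊤) (hb : MemLp b P) (hv : IsBeurling q v F) (hh : IsBeurling q h H) :
    MemLp (commutator b v) s ∧ ∫ z, commutator b v z * h z
      = (∫ z, b z * F z * h z) - ∫ z, b z * v z * H z := by
  have hqs : q.HolderConjugate s := ENNReal.HolderTriple.symm
  have hs := one_lt_conj_of_ne_top q s hq'
  have hs' := conj_ne_top_of_one_lt q s hq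
  obtain ⟨C, hC⟩ := exists_beurlingBound hs hs'
  have mbv : MemLp (fun z => b z * v z) s := hv.memLp_left.mul' hb
  have mbF : MemLp (fun z => b z * F z) s := hv.memLp_right.mul' hb
  obtain ⟨G, hG⟩ := hC.exists_isBeurling hs hs' mbv
  have hae := commutator_ae_eq hq hq' hs hs' hv hG
  refine ⟨(memLp_congr_ae hae).2 (mbF.sub hG.memLp_right), ?_⟩
  rw [← hG.integral_mul_comm hh, ← integral_sub (integrable_mul_of_memLp mbF hh.memLp_left)
    (integrable_mul_of_memLp hG.memLp_right hh.memLp_left)]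
  refine integral_congr_ae ?_
  filter_upwards [hae] with z hz
  rw [hz]; ring

/-- The bound for the polarised Jacobian of test functions extends to `L^q` by density. -/
lemma enorm_integral_commutator_mul_le [hPqs : P.HolderTriple q s] [hsq : s.HolderConjugate q]
    (hq : 1 < q) (hq' : q ≠ ⊤) (hB : BeurlingBound q C) (hb : MemLp b P)
    (hv : IsBeurling q v F) (hh : IsBeurling q h H)
    {L : ℝ} (hL : 0 ≤ L) (hbL : ∀ U V, IsTest U → IsTest V →
      ‖∫ z, b z * polarJacobian U V z‖ ≤ L * wirtingerNorm q U * wirtingerNorm q V) :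
    ‖∫ z, commutator b v z * h z‖ₑ
      ≤ ENNReal.ofReal (L * (1 + C) ^ 2) * eLpNorm v q * eLpNorm h q := by
  rw [(integral_commutator_mul (s := s) hq hq' hb hv hh).2]
  obtain ⟨mv, mF, u, hu, hu1, hu2⟩ := hv
  obtain ⟨mh, mH, x, hx, hx1, hx2⟩ := hh
  have m1 (n) := (isTest_dz (hu n)).memLp q
  have m2 (n) := (isTest_dzb (hu n)).memLp q
  have m3 (n) := (isTest_dz (hx n)).memLp q
  have m4 (n) := (isTest_dzb (hx n)).memLp q
  have mb {f : ℂ → ℂ} (hf : MemLp f q) : MemLp (fun z => b z * f z) s := hf.mul' hb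
  have t1 := tendsto_integral_mul (fun n => mb (m1 n)) m4 (mb mF) mh
    (tendsto_eLpNorm_mul_sub hb m1 mF hu2) hx1
  have t2 := tendsto_integral_mul (fun n => mb (m2 n)) m3 (mb mv) mH
    (tendsto_eLpNorm_mul_sub hb m2 mv hu1) hx2
  have e (n) : (∫ z, b z * dz (u n) z * dzb (x n) z) - ∫ z, b z * dzb (u n) z * dz (x n) z
      = ∫ z, b z * polarJacobian (u n) (x n) z := by
    rw [← integral_sub (integrable_mul_of_memLp (mb (m1 n)) (m4 n))
      (integrable_mul_of_memLp (mb (m2 n)) (m3 n))]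
    congr 1; ext z; rw [polarJacobian]; ring
  have t := (t1.sub t2).norm
  simp_rw [e] at t
  have l1 := (tendsto_lpNorm_of_tendsto_sub hq.le m2 mv hu1).const_mul (1 + (C : ℝ))
  have l2 := (tendsto_lpNorm_of_tendsto_sub hq.le m4 mh hx1).const_mul (1 + (C : ℝ))
  have key := le_of_tendsto_of_tendsto t ((l1.const_mul L).mul l2)
    (Eventually.of_forall fun n => (hbL _ _ (hu n) (hx n)).trans (by
      have w1 := hB.wirtingerNorm_le (hu n)
      have w2 := hB.wirtingerNorm_le (hx n)
      have p1 : 0 ≤ wirtingerNorm q (u n) := wirtingerNorm_nonneg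
      have p2 : 0 ≤ wirtingerNorm q (x n) := wirtingerNorm_nonneg
      exact mul_le_mul (mul_le_mul_of_nonneg_left w1 hL) w2 p2 (mul_nonneg hL (p1.trans w1))))
  rw [← ofReal_norm, ← ofReal_lpNorm mv, ← ofReal_lpNorm mh,
    ← ENNReal.ofReal_mul (by positivity),
    ← ENNReal.ofReal_mul (mul_nonneg (by positivity) lpNorm_nonneg)]
  refine ENNReal.ofReal_le_ofReal (key.trans_eq ?_)
  ring

lemma integrable_mul_jacobian [hqqR : q.HolderTriple q R] [hRP : R.HolderConjugate P]
    (hb : MemLp b P) {u : Fin 2 → ℂ → ℝ} (hu : u ∈ homSobolev q) :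
    Integrable fun z => b z * (jacobian u z : ℂ) := by
  have hPR : P.HolderConjugate R := ENNReal.HolderTriple.symm
  have hc {g : ℂ → ℂ} (hg : MemLp g q) : MemLp (fun z => starRingEnd ℂ (g z)) q :=
    hg.of_le (Complex.continuous_conj.comp_aestronglyMeasurable hg.1)
      (Eventually.of_forall fun z => by rw [Complex.norm_conj])
  have m1 : MemLp (fun z => weakDz u z * starRingEnd ℂ (weakDz u z)) R :=
    (hc (memLp_weakDz hu)).mul' (memLp_weakDz hu)
  have m2 : MemLp (fun z => weakDzb u z * starRingEnd ℂ (weakDzb u z)) R :=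
    (hc (memLp_weakDzb hu)).mul' (memLp_weakDzb hu)
  simp_rw [ofReal_jacobian]
  exact integrable_mul_of_memLp hb (m1.sub m2)

/-- The integral of `b` against the Jacobian of `U = u₁ + i u₂` is the pairing of `[b, S] ∂̄U` with
the conjugate of `∂U`, and both derivatives are in the unit ball. -/
lemma jacobianSup_le_commutatorNorm [hPqs : P.HolderTriple q s] [hsq : s.HolderConjugate q]
    (hq : 1 < q) (hq' : q ≠ ⊤) (hb : MemLp b P) :
    jacobianSup q Set.univ b ≤ commutatorNorm q s b := by
  refine iSup₂_le fun u hu => ?_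
  obtain ⟨-, hu, hn⟩ := hu
  have hB := isBeurling_weakDzb hq hq' hu
  obtain ⟨mw, e⟩ := integral_commutator_mul (s := s) hq hq' hb hB hB.conj
  have hqs : q.HolderConjugate s := ENNReal.HolderTriple.symm
  have i1 := integrable_mul_of_memLp (p := s) (q := q)
    (hB.memLp_right.mul' hb : MemLp (fun z => b z * weakDz u z) s) hB.conj.memLp_left
  have i2 := integrable_mul_of_memLp (p := s) (q := q)
    (hB.memLp_left.mul' hb : MemLp (fun z => b z * weakDzb u z) s) hB.conj.memLp_right
  have hJ : ∫ z, b z * (jacobian u z : ℂ)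
      = ∫ z, commutator b (weakDzb u) z * starRingEnd ℂ (weakDz u z) := by
    rw [e, ← integral_sub i1 i2]
    congr 1; ext z; rw [ofReal_jacobian]; ring
  have n1 : eLpNorm (weakDzb u) q ≤ 1 := eLpNorm_weakDzb_le.trans hn
  have n2 : eLpNorm (fun z => starRingEnd ℂ (weakDz u z)) q ≤ 1 := by
    refine le_trans (le_of_eq ?_) (eLpNorm_weakDz_le.trans hn)
    exact eLpNorm_congr_norm_ae (Eventually.of_forall fun z => Complex.norm_conj _)
  rw [hJ]
  have h1 := enorm_integral_mul_le (p := s) (q := q) mw.1 hB.conj.memLp_left.1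
  have h2 : eLpNorm (commutator b (weakDzb u)) s ≤ commutatorNorm q s b :=
    le_iSup₂ (f := fun v _ => eLpNorm (commutator b v) s volume) (weakDzb u) ⟨hB.memLp_left, n1⟩
  have h3 : eLpNorm (commutator b (weakDzb u)) s
      * eLpNorm (fun z => starRingEnd ℂ (weakDz u z)) q ≤ commutatorNorm q s b * 1 :=
    mul_le_mul' h2 n2
  rw [mul_one] at h3
  exact h1.trans h3

lemma norm_integral_polarJacobian_le_of_jacobianSup (hq : 1 ≤ q) (hb : LocallyIntegrable b)
    {D : Set (Fin 2 → ℂ → ℝ)} (hD : testFields ⊆ D) (hM : jacobianSup q D b ≠ ⊤) {U V : ℂ → ℂ}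
    (hU : IsTest U) (hV : IsTest V) : ‖∫ z, b z * polarJacobian U V z‖
      ≤ 16 * (jacobianSup q D b).toReal * wirtingerNorm q U * wirtingerNorm q V := by
  have := norm_integral_polarJacobian_le hq hb (M := 4 * (jacobianSup q D b).toReal) (by positivity)
    (fun U hU => norm_integral_complexJacobian_le hq hD hM hU) U V hU hV
  linarith

lemma ofReal_mul_sq_eq {M : ℝ≥0∞} (hM : M ≠ ⊤) (C : ℝ≥0) :
    ENNReal.ofReal (16 * M.toReal * (1 + C) ^ 2) = (16 * (1 + C) ^ 2 : ℝ≥0) * M := by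
  rw [show 16 * M.toReal * (1 + (C : ℝ)) ^ 2 = ((16 * (1 + C) ^ 2 : ℝ≥0) : ℝ) * M.toReal by
    push_cast; ring, ENNReal.ofReal_mul (by positivity), ENNReal.ofReal_coe_nnreal,
    ENNReal.ofReal_toReal hM]

lemma commutatorNorm_le_jacobianSup [hPqs : P.HolderTriple q s] [hsq : s.HolderConjugate q]
    (hq : 1 < q) (hq' : q ≠ ⊤) (hP : 1 ≤ P) (hB : BeurlingBound q C) (hb : MemLp b P) :
    commutatorNorm q s b ≤ (16 * (1 + C) ^ 2 : ℝ≥0) * jacobianSup q Set.univ b := by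
  rcases eq_or_ne (jacobianSup q Set.univ b) ⊤ with hM | hM
  · rw [hM, ENNReal.mul_top (by positivity)]; exact le_top
  have hqs : q.HolderConjugate s := ENNReal.HolderTriple.symm
  have hs := one_lt_conj_of_ne_top q s hq'
  have hs' := conj_ne_top_of_one_lt q s hq
  refine iSup₂_le fun v hv => ?_
  obtain ⟨mv, nv⟩ := hv
  obtain ⟨F, hF⟩ := hB.exists_isBeurling hq hq' mv
  refine eLpNorm_le_of_forall_pairing_le (q := q)
    (integral_commutator_mul (s := s) hq hq' hb hF hF).1 hs hs' fun g hg => ?_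
  obtain ⟨H, hH⟩ := hB.exists_isBeurling hq hq' hg
  have h := enorm_integral_commutator_mul_le (s := s) hq hq' hB hb hF hH (by positivity)
    fun U V hU hV => norm_integral_polarJacobian_le_of_jacobianSup hq.le
      (hb.locallyIntegrable hP) (Set.subset_univ _) hM hU hV
  rw [ofReal_mul_sq_eq hM] at h
  exact h.trans (mul_le_mul_left ((mul_le_mul_right nv _).trans (mul_one _).le) _)

end lp

/-! ### The commutator for locally integrable `b` -/

section loc

variable {q s : ℝ≥0∞} {b : ℂ → ℂ} {C : ℝ≥0}

/-- The Jacobian is the commutator form of `∂̄U` and the conjugate of `∂U`. -/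
lemma complexJacobian_eq_commutatorDensity {U : ℂ → ℂ} (hU : IsTest U) :
    complexJacobian U = commutatorDensity (dzb U) fun z => starRingEnd ℂ (dz U z) := by
  have e : (fun z => starRingEnd ℂ (dz U z)) = dzb fun z => starRingEnd ℂ (U z) := by
    ext z; rw [dzb_conj (hU.differentiable z)]
  ext z
  rw [commutatorDensity, cauchyTransform_dzb hU, e, cauchyTransform_dzb hU.conj,
    dz_conj (hU.differentiable z), complexJacobian]

lemma jacobianSup_le_testCommutatorNorm [hsq : s.HolderConjugate q] (hb : LocallyIntegrable b) :
    jacobianSup q testFields b ≤ testCommutatorNorm q s b := by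
  refine iSup₂_le fun u hu => ?_
  obtain ⟨hut, -, hn⟩ := hu
  set U := complexField u with hU_def
  have hU : IsTest U := isTest_complexField hut
  have n1 : eLpNorm (dzb U) q ≤ 1 := by
    rw [← eLpNorm_congr_ae (weakDzb_ae_eq hut)]; exact eLpNorm_weakDzb_le.trans hn
  have n2 : eLpNorm (fun z => starRingEnd ℂ (dz U z)) q ≤ 1 := by
    refine le_trans (le_of_eq ?_) (eLpNorm_weakDz_le.trans hn)
    rw [eLpNorm_congr_ae (weakDz_ae_eq hut)]
    exact eLpNorm_congr_norm_ae (Eventually.of_forall fun z => Complex.norm_conj _)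
  have h0 : (⨅ w ∈ {w : ℂ → ℂ | MemLp w s ∧ IsDistribCommutator b (dzb U) w}, eLpNorm w s)
      ≤ testCommutatorNorm q s b :=
    le_iSup₂ (f := fun v _ => ⨅ w ∈ {w : ℂ → ℂ | MemLp w s volume ∧ IsDistribCommutator b v w},
      eLpNorm w s volume) (dzb U) ⟨isTest_dzb hU, n1⟩
  refine le_trans (le_iInf₂ fun w hw => ?_) h0
  have e := (isDistribCommutator_iff hb (isTest_dzb hU)).1 hw.2 _ (isTest_dz hU).conj
  rw [integral_mul_jacobian b hut, complexJacobian_eq_commutatorDensity hU, ← e]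
  have h1 := enorm_integral_mul_le (p := s) (q := q) hw.1.1 (isTest_dz hU).conj.integrable.1
  have h2 : eLpNorm w s * eLpNorm (fun z => starRingEnd ℂ (dz U z)) q ≤ eLpNorm w s * 1 :=
    mul_le_mul_right n2 _
  rw [mul_one] at h2
  exact h1.trans h2

lemma cauchyTransform_add {g h : ℂ → ℂ} (hg : IsTest g) (hh : IsTest h) (z : ℂ) :
    cauchyTransform (fun z => g z + h z) z = cauchyTransform g z + cauchyTransform h z := by
  simp only [cauchyTransform]
  rw [← mul_add, ← integral_add (integrable_comp_sub_div hg z) (integrable_comp_sub_div hh z)]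
  simp_rw [add_div]

lemma cauchyTransform_const_mul (c : ℂ) (g : ℂ → ℂ) (z : ℂ) :
    cauchyTransform (fun z => c * g z) z = c * cauchyTransform g z := by
  simp only [cauchyTransform, mul_div_assoc]
  rw [integral_const_mul]; ring

lemma commutatorDensity_add {v g h : ℂ → ℂ} (hg : IsTest g) (hh : IsTest h) (z : ℂ) :
    commutatorDensity v (fun z => g z + h z) z
      = commutatorDensity v g z + commutatorDensity v h z := by
  simp only [commutatorDensity]
  rw [show cauchyTransform (fun z => g z + h z) = fun z => cauchyTransform g z + cauchyTransform h z
    from funext fun z => cauchyTransform_add hg hh z,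
    dz_add ((contDiff_cauchyTransform hg).differentiable (by simp) z)
      ((contDiff_cauchyTransform hh).differentiable (by simp) z)]
  ring

lemma commutatorDensity_const_mul {v g : ℂ → ℂ} (c : ℂ) (hg : IsTest g) (z : ℂ) :
    commutatorDensity v (fun z => c * g z) z = c * commutatorDensity v g z := by
  simp only [commutatorDensity]
  rw [show cauchyTransform (fun z => c * g z) = fun z => c * cauchyTransform g z
    from funext fun z => cauchyTransform_const_mul c g z,
    dz_const_mul c ((contDiff_cauchyTransform hg).differentiable (by simp) z)]
  ring

lemma testCommutatorNorm_le_jacobianSup [hsq : s.HolderConjugate q] (hq : 2 ≤ q) (hq' : q ≠ ⊤)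
    (hB : BeurlingBound q C) (hb : LocallyIntegrable b) :
    testCommutatorNorm q s b ≤ (16 * (1 + C) ^ 2 : ℝ≥0) * jacobianSup q testFields b := by
  rcases eq_or_ne (jacobianSup q testFields b) ⊤ with hM | hM
  · rw [hM, ENNReal.mul_top (by positivity)]; exact le_top
  have hq1 : 1 < q := lt_of_lt_of_le (by norm_num) hq
  set M := (jacobianSup q testFields b).toReal with hM_def
  have hM0 : 0 ≤ M := ENNReal.toReal_nonneg
  refine iSup₂_le fun v hv => ?_
  obtain ⟨tv, nv⟩ := hv
  have nv' : lpNorm v q volume ≤ 1 := by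
    rw [← toReal_eLpNorm (tv.memLp q).1, ← ENNReal.toReal_one]
    exact ENNReal.toReal_mono (by simp) nv
  have hbd (g) (hg : IsTest g) : ‖∫ z, b z * commutatorDensity v g z‖
      ≤ 16 * M * (1 + C) ^ 2 * lpNorm g q volume := by
    refine (norm_integral_commutatorDensity_le hB hq1 hb (by positivity : 0 ≤ 16 * M)
      (fun U V hU hV => norm_integral_polarJacobian_le_of_jacobianSup hq1.le hb subset_rfl hM hU hV)
      tv hg).trans ?_
    have h0 : 0 ≤ lpNorm g q volume := lpNorm_nonneg
    have h1 : 16 * M * ((1 + C) * lpNorm v q volume) * ((1 + C) * lpNorm g q volume)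
      = 16 * M * (1 + C) ^ 2 * lpNorm g q volume * lpNorm v q volume := by ring
    rw [h1]
    exact mul_le_of_le_one_right (by positivity) nv'
  obtain ⟨w, mw, nw, hw⟩ := exists_memLp_forall_integral_mul_eq (s := s) hq hq'
    (ℓ := fun g => ∫ z, b z * commutatorDensity v g z)
    (fun g h hg hh => by
      rw [← integral_add (integrable_mul_isTest hb (isTest_commutatorDensity tv hg))
        (integrable_mul_isTest hb (isTest_commutatorDensity tv hh))]
      congr 1; ext z; rw [commutatorDensity_add hg hh]; ring)
    (fun c g hg => by
      rw [← integral_const_mul]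
      congr 1; ext z; rw [commutatorDensity_const_mul c hg]; ring)
    (by positivity) hbd
  rw [ofReal_mul_sq_eq hM] at nw
  exact (iInf₂_le w ⟨mw, (isDistribCommutator_iff hb tv).2 hw⟩).trans nw

end loc

end JacobianCommutator

open JacobianCommutator in
theorem lemma3p1 (p : ℝ) (hp : 1 ≤ p) (q q' : ℝ≥0∞)
    (hq : q = ENNReal.ofReal (2 * p)) (hq' : q' = ENNReal.conjExponent q) :
    ∃ K : ℝ≥0,
      -- `b` in the dual of `L^p`: the whole Sobolev unit ball, and `[b, S]` on all of `L^{2p}`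
      (∀ b : ℂ → ℂ, MemLp b (ENNReal.conjExponent (ENNReal.ofReal p)) →
        (∀ u ∈ homSobolev q, Integrable fun z => b z * (jacobian u z : ℂ)) ∧
        (∀ v : ℂ → ℂ, MemLp v q →
          (∀ᵐ z, BeurlingExistsAt v z) ∧ (∀ᵐ z, BeurlingExistsAt (fun y => b y * v y) z) ∧
            MemLp (commutator b v) q') ∧
        jacobianSup q Set.univ b ≤ K * commutatorNorm q q' b ∧
        commutatorNorm q q' b ≤ K * jacobianSup q Set.univ b) ∧
      -- `b` merely locally integrable: test fields, and `[b, S]` defined on test functions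
      (∀ b : ℂ → ℂ, LocallyIntegrable b →
        jacobianSup q testFields b ≤ K * testCommutatorNorm q q' b ∧
        testCommutatorNorm q q' b ≤ K * jacobianSup q testFields b) := by
  set R := ENNReal.ofReal p with hR
  have hR1 : 1 ≤ R := by rw [hR, ← ENNReal.ofReal_one]; exact ENNReal.ofReal_le_ofReal hp
  have hqR : q = 2 * R := by rw [hq, ENNReal.ofReal_mul (by norm_num), ENNReal.ofReal_ofNat]
  have hq2 : 2 ≤ q := by rw [hqR]; exact le_mul_of_one_le_right' hR1
  have hqt : q ≠ ⊤ := by rw [hq]; exact ENNReal.ofReal_ne_top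
  have hq1 : 1 < q := lt_of_lt_of_le (by norm_num) hq2
  obtain ⟨P, hP, hRP⟩ : ∃ P, ENNReal.conjExponent R = P ∧ R.HolderConjugate P :=
    ⟨_, rfl, .conjExponent hR1⟩
  have hqs : q.HolderConjugate q' := by rw [hq']; exact .conjExponent hq1.le
  have hsq : q'.HolderConjugate q := ENNReal.HolderTriple.symm
  have hqq : q⁻¹ + q⁻¹ = R⁻¹ := by
    rw [hqR, ENNReal.mul_inv (by simp) (by simp), ← add_mul, ENNReal.inv_two_add_inv_two, one_mul]
  have hqqR : q.HolderTriple q R := ⟨hqq⟩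
  -- `P` is the conjugate exponent `p'`, and multiplication by `b ∈ L^{p'}` maps `L^{2p}` to its dual
  have hPqs : P.HolderTriple q q' := by
    refine ⟨?_⟩
    have h1 := ENNReal.HolderConjugate.inv_add_inv_eq_one R P
    have h2 := ENNReal.HolderConjugate.inv_add_inv_eq_one q q'
    rw [← hqq, ← h2, add_assoc] at h1
    rw [add_comm]
    exact (ENNReal.add_right_inj (ENNReal.inv_ne_top.2 (zero_lt_one.trans hq1).ne')).1 h1
  have hs := one_lt_conj_of_ne_top q q' hqt
  have hs' := conj_ne_top_of_one_lt q q' hq1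
  have hP1 : 1 ≤ P := by
    have hPR : P.HolderConjugate R := ENNReal.HolderTriple.symm
    exact ENNReal.HolderConjugate.one_le P R
  obtain ⟨C, hC⟩ := exists_beurlingBound hq1 hqt
  obtain ⟨C', hC'⟩ := exists_beurlingBound hs hs'
  have hK : (1 : ℝ≥0∞) ≤ (16 * (1 + C) ^ 2 : ℝ≥0) := by
    have h1 : (1 : ℝ≥0) ≤ (1 + C) ^ 2 := one_le_pow₀ (by simp)
    have : (1 : ℝ≥0) ≤ 16 * (1 + C) ^ 2 := one_le_mul (by norm_num) h1
    exact_mod_cast this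
  rw [hP]
  refine ⟨16 * (1 + C) ^ 2, fun b hb => ⟨fun u hu => integrable_mul_jacobian (R := R) hb hu,
    fun v hv => ?_, ?_, commutatorNorm_le_jacobianSup hq1 hqt hP1 hC hb⟩,
    fun b hb => ⟨?_, testCommutatorNorm_le_jacobianSup hq2 hqt hC hb⟩⟩
  · obtain ⟨F, hF⟩ := hC.exists_isBeurling hq1 hqt hv
    obtain ⟨G, hG⟩ := hC'.exists_isBeurling hs hs' (hv.mul' hb : MemLp (fun z => b z * v z) q')
    exact ⟨hF.ae_beurlingExistsAt hq1 hqt, hG.ae_beurlingExistsAt hs hs',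
      (integral_commutator_mul hq1 hqt hb hF hF).1⟩
  · exact (jacobianSup_le_commutatorNorm hq1 hqt hb).trans (le_mul_of_one_le_left' hK)
  · exact (jacobianSup_le_testCommutatorNorm hb).trans (le_mul_of_one_le_left' hK)
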